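/- Let $(M,g)$ be a compact connected smooth Riemannian manifold (without boundary) of dimension $n\ge 2$, with Ricci tensor $r$, scalar curvature $s$, Levi-Civita connection $\nabla$, Laplacian $\Delta=-\nabla^a\nabla_a=d^*d$ and volume measure $d\mu$. Let $f\colon M\to\mathbb{R}$ be a non-constant static potential, i.e. a non-constant smooth function with $$(\Delta f)\,g_{ab}+\nabla_a\nabla_b f-f\,r_{ab}=0 .$$ Then: 1. The scalar curvature $s$ is a positive constant, and $f$ is an eigenfunction of the Laplacian with eigenvalue $\frac{s}{n-1}$, that is, $\Delta f=\frac{s}{n-1}f$. 2. $f$ has mean zero: $\int_M f\,d\mu=0$. 3. The zero set $Z=f^{-1}(0)$ is non-empty, $\nabla f\neq 0$ at every point of $Z$, and $Z$ is a smooth embedded hypersurface. 4. $Z$ is totally geodesic: every geodesic of $M$ that is tangent to $Z$ at some time stays in $Z$ near that time. 5. $|\nabla f|$ is constant on each connected component of $Z$. -/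

import Mathlib

open Set Filter Topology MeasureTheory Bundle
open scoped Manifold ContDiff

noncomputable section

namespace Riem

/-! ### Tensor calculus on coordinate space

`G y` is the matrix `(g_ij)` of a metric at the point `y` of an open set of `ℝⁿ`. -/

section Coordinates

variable {n : ℕ}

/-- The partial derivative `∂_i F`. -/
def pderiv (i : Fin n) (F : EuclideanSpace ℝ (Fin n) → ℝ) (y : EuclideanSpace ℝ (Fin n)) : ℝ :=
  fderiv ℝ F y (EuclideanSpace.single i 1)

/-- `Γ^k_ij = ½ g^{kl} (∂_i g_jl + ∂_j g_il - ∂_l g_ij)`. -/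
def christoffel (G : EuclideanSpace ℝ (Fin n) → Matrix (Fin n) (Fin n) ℝ) (k i j : Fin n)
    (y : EuclideanSpace ℝ (Fin n)) : ℝ :=
  (1 / 2) * ∑ l, (G y)⁻¹ k l *
    (pderiv i (fun z => G z j l) y + pderiv j (fun z => G z i l) y
      - pderiv l (fun z => G z i j) y)

/-- The Ricci tensor `r_ij = ∂_k Γ^k_ij - ∂_j Γ^k_ik + Γ^k_kl Γ^l_ij - Γ^k_jl Γ^l_ik`
(non-negative for round spheres). -/
def ricci (G : EuclideanSpace ℝ (Fin n) → Matrix (Fin n) (Fin n) ℝ) (i j : Fin n)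
    (y : EuclideanSpace ℝ (Fin n)) : ℝ :=
  ∑ k, (pderiv k (christoffel G k i j) y - pderiv j (christoffel G k i k) y)
    + ∑ k, ∑ l, (christoffel G k k l y * christoffel G l i j y
      - christoffel G k j l y * christoffel G l i k y)

/-- The scalar curvature `s = g^{ij} r_ij`. -/
def scalar (G : EuclideanSpace ℝ (Fin n) → Matrix (Fin n) (Fin n) ℝ)
    (y : EuclideanSpace ℝ (Fin n)) : ℝ :=
  ∑ i, ∑ j, (G y)⁻¹ i j * ricci G i j y

/-- The Hessian `∇_i ∇_j F = ∂_i ∂_j F - Γ^k_ij ∂_k F`. -/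
def hess (G : EuclideanSpace ℝ (Fin n) → Matrix (Fin n) (Fin n) ℝ)
    (F : EuclideanSpace ℝ (Fin n) → ℝ) (i j : Fin n) (y : EuclideanSpace ℝ (Fin n)) : ℝ :=
  pderiv i (pderiv j F) y - ∑ k, christoffel G k i j y * pderiv k F y

/-- The Laplacian with the geometers' sign, `ΔF = - g^{ij} ∇_i ∇_j F = d^* d F`, a non-negative
operator. -/
def laplacian (G : EuclideanSpace ℝ (Fin n) → Matrix (Fin n) (Fin n) ℝ)
    (F : EuclideanSpace ℝ (Fin n) → ℝ) (y : EuclideanSpace ℝ (Fin n)) : ℝ :=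
  -∑ i, ∑ j, (G y)⁻¹ i j * hess G F i j y

end Coordinates

/-! ### Riemannian manifolds

A tensor on `M` is handled through its components in all charts of the maximal smooth atlas. -/

variable {n : ℕ} {M : Type*} [TopologicalSpace M] [ChartedSpace (EuclideanSpace ℝ (Fin n)) M]
  [IsManifold (𝓡 n) ∞ M]

/-- The components `g_ij` of the metric in the chart `e`, at the point `e.symm y` of `M`. -/
def coeff (g : ContMDiffRiemannianMetric (𝓡 n) ∞ (EuclideanSpace ℝ (Fin n))
      (fun x : M => TangentSpace (𝓡 n) x))
    (e : OpenPartialHomeomorph M (EuclideanSpace ℝ (Fin n))) (y : EuclideanSpace ℝ (Fin n)) :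
    Matrix (Fin n) (Fin n) ℝ :=
  Matrix.of fun i j => g.inner (e.symm y)
    (mfderiv (𝓡 n) (𝓡 n) e.symm y (EuclideanSpace.single i (1 : ℝ)))
    (mfderiv (𝓡 n) (𝓡 n) e.symm y (EuclideanSpace.single j (1 : ℝ)))

/-- `f` is a static potential: a smooth solution `f ≢ 0` of `(Δf) g + ∇∇f - f r = 0`. -/
structure IsStaticPotential
    (g : ContMDiffRiemannianMetric (𝓡 n) ∞ (EuclideanSpace ℝ (Fin n))
      (fun x : M => TangentSpace (𝓡 n) x)) (f : M → ℝ) : Prop where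
  smooth : ContMDiff (𝓡 n) 𝓘(ℝ, ℝ) ∞ f
  ne_zero : f ≠ 0
  equation : ∀ e ∈ IsManifold.maximalAtlas (𝓡 n) ∞ M, ∀ y ∈ e.target, ∀ i j : Fin n,
    laplacian (coeff g e) (f ∘ e.symm) y * coeff g e y i j
      + hess (coeff g e) (f ∘ e.symm) i j y
      - f (e.symm y) * ricci (coeff g e) i j y = 0

/-- The scalar curvature of `g` is the constant `s`. -/
def HasConstantScalarCurvature
    (g : ContMDiffRiemannianMetric (𝓡 n) ∞ (EuclideanSpace ℝ (Fin n))
      (fun x : M => TangentSpace (𝓡 n) x)) (s : ℝ) : Prop :=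
  ∀ e ∈ IsManifold.maximalAtlas (𝓡 n) ∞ M, ∀ y ∈ e.target, scalar (coeff g e) y = s

/-- `f` is an eigenfunction of the Laplacian, with eigenvalue `c`. -/
structure IsLaplaceEigenfunction
    (g : ContMDiffRiemannianMetric (𝓡 n) ∞ (EuclideanSpace ℝ (Fin n))
      (fun x : M => TangentSpace (𝓡 n) x)) (f : M → ℝ) (c : ℝ) : Prop where
  smooth : ContMDiff (𝓡 n) 𝓘(ℝ, ℝ) ∞ f
  ne_zero : f ≠ 0
  equation : ∀ e ∈ IsManifold.maximalAtlas (𝓡 n) ∞ M, ∀ y ∈ e.target,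
    laplacian (coeff g e) (f ∘ e.symm) y = c * f (e.symm y)

/-- The measure on `M`, carried by the domain of the chart `e`, that is `√(det g_ij) dy` in the
coordinates of that chart. -/
def chartVolume [MeasurableSpace M]
    (g : ContMDiffRiemannianMetric (𝓡 n) ∞ (EuclideanSpace ℝ (Fin n))
      (fun x : M => TangentSpace (𝓡 n) x))
    (e : OpenPartialHomeomorph M (EuclideanSpace ℝ (Fin n))) : Measure M :=
  (((volume : Measure (EuclideanSpace ℝ (Fin n))).restrict e.target).withDensity
    (fun y => ENNReal.ofReal √(coeff g e y).det)).map e.symm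

/-- The Riemannian volume measure `dμ_g`. The measures of the single charts agree on overlaps, so
the least measure above all of them is the measure which equals `√(det g_ij) dy` in every chart. -/
def volumeMeasure [MeasurableSpace M]
    (g : ContMDiffRiemannianMetric (𝓡 n) ∞ (EuclideanSpace ℝ (Fin n))
      (fun x : M => TangentSpace (𝓡 n) x)) : Measure M :=
  ⨆ e ∈ IsManifold.maximalAtlas (𝓡 n) ∞ M, chartVolume g e

/-- The inner product `g_p` as a bilinear form on `T_p M`. -/
def innerForm (g : ContMDiffRiemannianMetric (𝓡 n) ∞ (EuclideanSpace ℝ (Fin n))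
      (fun x : M => TangentSpace (𝓡 n) x)) (p : M) :
    LinearMap.BilinForm ℝ (TangentSpace (𝓡 n) p) :=
  LinearMap.mk₂ ℝ (fun v w => g.inner p v w) (by simp) (by simp) (by simp) (by simp)

theorem innerForm_nondegenerate
    (g : ContMDiffRiemannianMetric (𝓡 n) ∞ (EuclideanSpace ℝ (Fin n))
      (fun x : M => TangentSpace (𝓡 n) x)) (p : M) : (innerForm g p).Nondegenerate := by
  constructor
  · intro v hv
    by_contra h
    exact (g.pos p v h).ne' (hv v)
  · intro v hv
    by_contra h
    exact (g.pos p v h).ne' (hv v)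

instance finiteDimensional_tangentSpace (p : M) : FiniteDimensional ℝ (TangentSpace (𝓡 n) p) :=
  inferInstanceAs (FiniteDimensional ℝ (EuclideanSpace ℝ (Fin n)))

/-- The gradient `∇f`, the vector with `g (∇f, w) = df w` for all `w`. -/
def gradient (g : ContMDiffRiemannianMetric (𝓡 n) ∞ (EuclideanSpace ℝ (Fin n))
      (fun x : M => TangentSpace (𝓡 n) x)) (f : M → ℝ) (p : M) : TangentSpace (𝓡 n) p :=
  (LinearMap.BilinForm.toDual (innerForm g p) (innerForm_nondegenerate g p)).symm
    (mvfderiv (𝓡 n) f p).toLinearMap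

/-- `|∇f|`. -/
def gradientNorm (g : ContMDiffRiemannianMetric (𝓡 n) ∞ (EuclideanSpace ℝ (Fin n))
      (fun x : M => TangentSpace (𝓡 n) x)) (f : M → ℝ) (p : M) : ℝ :=
  √(g.inner p (gradient g f p) (gradient g f p))

/-- `Z` is a smooth (embedded) hypersurface: near each of its points there are smooth coordinates in
which `Z` is the zero set of one coordinate. -/
def IsSmoothHypersurface (n : ℕ) {M : Type*} [TopologicalSpace M]
    [ChartedSpace (EuclideanSpace ℝ (Fin n)) M] (Z : Set M) : Prop :=
  ∀ p ∈ Z, ∃ e ∈ IsManifold.maximalAtlas (𝓡 n) ∞ M, p ∈ e.source ∧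
    ∃ i : Fin n, ∀ q ∈ e.source, q ∈ Z ↔ e q i = 0

/-- The velocity `γ'(t)`, as a point of the tangent bundle over `γ t`. -/
def velocity (n : ℕ) {M : Type*} [TopologicalSpace M]
    [ChartedSpace (EuclideanSpace ℝ (Fin n)) M] (γ : ℝ → M) (t : ℝ) : TangentBundle (𝓡 n) M :=
  tangentMap 𝓘(ℝ, ℝ) (𝓡 n) γ ⟨t, (1 : ℝ)⟩

/-- The vectors tangent to `Z`: the velocities of smooth curves in `Z`. -/
def tangentVectors (n : ℕ) {M : Type*} [TopologicalSpace M]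
    [ChartedSpace (EuclideanSpace ℝ (Fin n)) M] (Z : Set M) : Set (TangentBundle (𝓡 n) M) :=
  {v | ∃ c : ℝ → M, ContMDiffAt 𝓘(ℝ, ℝ) (𝓡 n) ∞ c 0 ∧ (∀ᶠ t in 𝓝 0, c t ∈ Z) ∧
    velocity n c 0 = v}

/-- `γ` is a geodesic on the open interval `J`: a smooth curve satisfying
`ẍ^k + Γ^k_ij ẋ^i ẋ^j = 0` in every chart. -/
structure IsGeodesicOn
    (g : ContMDiffRiemannianMetric (𝓡 n) ∞ (EuclideanSpace ℝ (Fin n))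
      (fun x : M => TangentSpace (𝓡 n) x)) (γ : ℝ → M) (J : Set ℝ) : Prop where
  isOpen : IsOpen J
  ordConnected : J.OrdConnected
  smooth : ContMDiffOn 𝓘(ℝ, ℝ) (𝓡 n) ∞ γ J
  equation : ∀ e ∈ IsManifold.maximalAtlas (𝓡 n) ∞ M, ∀ t ∈ J, γ t ∈ e.source → ∀ k : Fin n,
    deriv (deriv fun τ => e (γ τ) k) t
      + ∑ i, ∑ j, christoffel (coeff g e) k i j (e (γ t))
        * deriv (fun τ => e (γ τ) i) t * deriv (fun τ => e (γ τ) j) t = 0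

/-- `Z` is totally geodesic: a geodesic of `M` that is tangent to `Z` at some time runs inside `Z`
around that time. -/
def IsTotallyGeodesic
    (g : ContMDiffRiemannianMetric (𝓡 n) ∞ (EuclideanSpace ℝ (Fin n))
      (fun x : M => TangentSpace (𝓡 n) x)) (Z : Set M) : Prop :=
  ∀ (γ : ℝ → M) (J : Set ℝ), IsGeodesicOn g γ J →
    ∀ t₀ ∈ J, velocity n γ t₀ ∈ tangentVectors n Z → ∀ᶠ t in 𝓝 t₀, γ t ∈ Z

end Riem

end

noncomputable section

namespace Riem

section Coordinates

variable {n : ℕ}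

/-! ### Calculus of partial derivatives -/

/-! Write the trace of the static equation as `(n - 1) Δf = s f`. Substituted back, it turns the
equation into the linear system `∇∇f = (r - s/(n-1) g) f`, and most of the theorem comes from the
factor `f` on the right (`hess_eq`).

A solution for which `f` and `df` vanish at one point vanishes near it, by Grönwall along segments
in a chart, hence on all of `M` by connectedness. So `df ≠ 0` on `Z`, which makes `f` a local
coordinate there and `Z` a hypersurface; also `f ≠ 0` on a dense set. The divergence of the static
equation, by the Ricci identity and the contracted Bianchi identity, is `f ds = 0` up to a constant
factor; density then gives `ds = 0`, so `s` is constant. Both identities are checked at the centre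
of normal coordinates, which are available because the equation is assumed in every chart
(`mul_pderiv_scalar_eq_zero`, `exists_chart_isNormalAt`).

Curvature is given by components, so the chart independence of `s` needs an argument. Instead of the
transformation law of the Ricci tensor, the weak form `∫ ⟨∇φ, ∇f⟩ = ∫ φ Δf` is used: its left side
involves no chart, so neither does `Δf = s f/(n-1)`, and `f ≠ 0` densely (`scalar_le_of_charts`).

With `c = s/(n-1)`, the weak form for `φ = f` reads `∫ |∇f|² = c ∫ f²` and yields `c > 0` when `f`
is not constant; for `φ = 1` it yields mean zero, hence a zero of `f`. Along a geodesic `γ`, `h = f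
∘ γ` solves `h'' = a h`; tangency to `Z` means `h = h' = 0` at one time, so `h` vanishes near that
time. Finally `d|∇f|² = 2 ∇∇f(∇f, ·)` vanishes on `Z`, so `|∇f|` is locally constant there. -/

theorem pderiv_congr {F F' : EuclideanSpace ℝ (Fin n) → ℝ} {y : EuclideanSpace ℝ (Fin n)}
    (i : Fin n) (h : F =ᶠ[𝓝 y] F') : pderiv i F y = pderiv i F' y := by
  unfold pderiv
  rw [h.fderiv_eq]

theorem pderiv_congr_of_isOpen {U : Set (EuclideanSpace ℝ (Fin n))} (hU : IsOpen U)
    {F F' : EuclideanSpace ℝ (Fin n) → ℝ} {y : EuclideanSpace ℝ (Fin n)} (hy : y ∈ U)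
    (i : Fin n) (h : ∀ z ∈ U, F z = F' z) : pderiv i F y = pderiv i F' y :=
  pderiv_congr i (eventually_of_mem (hU.mem_nhds hy) h)

theorem pderiv_const (i : Fin n) (c : ℝ) (y : EuclideanSpace ℝ (Fin n)) :
    pderiv i (fun _ => c) y = 0 := by
  simp [pderiv]

theorem pderiv_add {F F' : EuclideanSpace ℝ (Fin n) → ℝ} {y : EuclideanSpace ℝ (Fin n)}
    (i : Fin n) (h : DifferentiableAt ℝ F y) (h' : DifferentiableAt ℝ F' y) :
    pderiv i (fun z => F z + F' z) y = pderiv i F y + pderiv i F' y := by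
  simp [pderiv, fderiv_fun_add h h']

theorem pderiv_sub {F F' : EuclideanSpace ℝ (Fin n) → ℝ} {y : EuclideanSpace ℝ (Fin n)}
    (i : Fin n) (h : DifferentiableAt ℝ F y) (h' : DifferentiableAt ℝ F' y) :
    pderiv i (fun z => F z - F' z) y = pderiv i F y - pderiv i F' y := by
  simp [pderiv, fderiv_fun_sub h h']

theorem pderiv_neg {F : EuclideanSpace ℝ (Fin n) → ℝ} {y : EuclideanSpace ℝ (Fin n)}
    (i : Fin n) : pderiv i (fun z => -F z) y = -pderiv i F y := by
  simp [pderiv, fderiv_fun_neg]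

theorem pderiv_mul {F F' : EuclideanSpace ℝ (Fin n) → ℝ} {y : EuclideanSpace ℝ (Fin n)}
    (i : Fin n) (h : DifferentiableAt ℝ F y) (h' : DifferentiableAt ℝ F' y) :
    pderiv i (fun z => F z * F' z) y = pderiv i F y * F' y + F y * pderiv i F' y := by
  simp [pderiv, fderiv_fun_mul h h']
  ring

theorem pderiv_const_mul {F : EuclideanSpace ℝ (Fin n) → ℝ} {y : EuclideanSpace ℝ (Fin n)}
    (i : Fin n) (c : ℝ) (h : DifferentiableAt ℝ F y) :
    pderiv i (fun z => c * F z) y = c * pderiv i F y := by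
  rw [pderiv_mul i (differentiableAt_const c) h, pderiv_const]
  ring

theorem pderiv_sum {ι : Type*} {s : Finset ι} {F : ι → EuclideanSpace ℝ (Fin n) → ℝ}
    {y : EuclideanSpace ℝ (Fin n)} (i : Fin n) (h : ∀ k ∈ s, DifferentiableAt ℝ (F k) y) :
    pderiv i (fun z => ∑ k ∈ s, F k z) y = ∑ k ∈ s, pderiv i (F k) y := by
  simp [pderiv, fderiv_fun_sum h]

theorem fderiv_apply_eq_sum_pderiv (F : EuclideanSpace ℝ (Fin n) → ℝ)
    (y v : EuclideanSpace ℝ (Fin n)) : fderiv ℝ F y v = ∑ i, v i * pderiv i F y := by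
  conv_lhs => rw [← (EuclideanSpace.basisFun (Fin n) ℝ).sum_repr v]
  simp [pderiv]

theorem fderiv_eq_zero_of_pderiv {F : EuclideanSpace ℝ (Fin n) → ℝ}
    {y : EuclideanSpace ℝ (Fin n)} (h : ∀ i, pderiv i F y = 0) : fderiv ℝ F y = 0 := by
  ext v
  simp [fderiv_apply_eq_sum_pderiv, h]

theorem contDiffOn_pderiv {U : Set (EuclideanSpace ℝ (Fin n))} (hU : IsOpen U)
    {F : EuclideanSpace ℝ (Fin n) → ℝ} (hF : ContDiffOn ℝ ∞ F U) (i : Fin n) :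
    ContDiffOn ℝ ∞ (pderiv i F) U :=
  (hF.fderiv_of_isOpen hU (by simp)).clm_apply contDiffOn_const

theorem differentiableAt_of_contDiffOn {U : Set (EuclideanSpace ℝ (Fin n))} (hU : IsOpen U)
    {F : EuclideanSpace ℝ (Fin n) → ℝ} (hF : ContDiffOn ℝ ∞ F U)
    {y : EuclideanSpace ℝ (Fin n)} (hy : y ∈ U) : DifferentiableAt ℝ F y :=
  (hF.contDiffAt (hU.mem_nhds hy)).differentiableAt (by simp)

theorem pderiv_comm {U : Set (EuclideanSpace ℝ (Fin n))} (hU : IsOpen U)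
    {F : EuclideanSpace ℝ (Fin n) → ℝ} (hF : ContDiffOn ℝ ∞ F U)
    {y : EuclideanSpace ℝ (Fin n)} (hy : y ∈ U) (i j : Fin n) :
    pderiv i (pderiv j F) y = pderiv j (pderiv i F) y := by
  have hc : ContDiffAt ℝ ∞ F y := hF.contDiffAt (hU.mem_nhds hy)
  have hd : DifferentiableAt ℝ (fderiv ℝ F) y :=
    (hc.fderiv_right (m := ∞) (by simp)).differentiableAt (by simp)
  have key : ∀ a b : Fin n, pderiv a (pderiv b F) y =
      fderiv ℝ (fderiv ℝ F) y (EuclideanSpace.single a 1) (EuclideanSpace.single b 1) := by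
    intro a b
    unfold pderiv
    rw [fderiv_clm_apply hd (differentiableAt_const _)]
    simp
  rw [key, key]
  exact (hc.isSymmSndFDerivAt (by
    simpa using (WithTop.coe_le_coe.2 le_top : ((2 : ℕ∞) : WithTop ℕ∞) ≤ ((⊤ : ℕ∞) : WithTop ℕ∞)))).eq _ _

/-! ### Metrics in coordinates -/

/-- `G` is the coordinate matrix of a smooth Riemannian metric on the open set `U`. -/
structure IsMetricOn (U : Set (EuclideanSpace ℝ (Fin n)))
    (G : EuclideanSpace ℝ (Fin n) → Matrix (Fin n) (Fin n) ℝ) : Prop where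
  isOpen : IsOpen U
  smooth : ∀ i j, ContDiffOn ℝ ∞ (fun y => G y i j) U
  posDef : ∀ y ∈ U, (G y).PosDef

namespace IsMetricOn

variable {U : Set (EuclideanSpace ℝ (Fin n))}
  {G : EuclideanSpace ℝ (Fin n) → Matrix (Fin n) (Fin n) ℝ} {F : EuclideanSpace ℝ (Fin n) → ℝ}
  {y : EuclideanSpace ℝ (Fin n)}

theorem symm (h : IsMetricOn U G) (hy : y ∈ U) (i j : Fin n) : G y i j = G y j i := by
  simpa using ((h.posDef y hy).isHermitian.apply i j).symm

theorem isSymm (h : IsMetricOn U G) (hy : y ∈ U) : (G y).IsSymm := by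
  ext i j
  exact (h.symm hy i j).symm

theorem inv_isSymm (h : IsMetricOn U G) (hy : y ∈ U) : ((G y)⁻¹).IsSymm :=
  (h.isSymm hy).inv

theorem det_pos (h : IsMetricOn U G) (hy : y ∈ U) : 0 < (G y).det :=
  (h.posDef y hy).det_pos

theorem isUnit_det (h : IsMetricOn U G) (hy : y ∈ U) : IsUnit (G y).det :=
  (h.det_pos hy).ne'.isUnit

theorem contDiffOn_det (h : IsMetricOn U G) : ContDiffOn ℝ ∞ (fun y => (G y).det) U := by
  simp only [Matrix.det_apply']
  refine ContDiffOn.sum fun σ _ => contDiffOn_const.mul ?_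
  exact contDiffOn_prod fun i _ => h.smooth _ _

/-- By Cramer's rule the entries of the inverse are quotients of polynomials in the entries of `G`,
with the non-vanishing determinant as denominator. -/
theorem contDiffOn_inv (h : IsMetricOn U G) (i j : Fin n) :
    ContDiffOn ℝ ∞ (fun y => (G y)⁻¹ i j) U := by
  have e : ∀ y, (G y)⁻¹ i j = ((G y).det)⁻¹ * ((G y).updateRow j (Pi.single i 1)).det := by
    intro y
    simp [Matrix.inv_def, Matrix.adjugate_apply]
  simp only [e]
  refine (h.contDiffOn_det.inv fun y hy => (h.det_pos hy).ne').mul ?_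
  simp only [Matrix.det_apply']
  refine ContDiffOn.sum fun σ _ => contDiffOn_const.mul (contDiffOn_prod fun a _ => ?_)
  by_cases ha : σ a = j
  · simp only [ha, Matrix.updateRow_self]
    exact contDiffOn_const
  · simp only [Matrix.updateRow_ne ha]
    exact h.smooth _ _

theorem contDiffOn_christoffel (h : IsMetricOn U G) (k i j : Fin n) :
    ContDiffOn ℝ ∞ (christoffel G k i j) U := by
  unfold christoffel
  have hp := fun a b c => contDiffOn_pderiv h.isOpen (h.smooth b c) a
  exact contDiffOn_const.mul (ContDiffOn.sum fun l _ =>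
    (h.contDiffOn_inv k l).mul (((hp _ _ _).add (hp _ _ _)).sub (hp _ _ _)))

theorem contDiffOn_ricci (h : IsMetricOn U G) (i j : Fin n) :
    ContDiffOn ℝ ∞ (ricci G i j) U := by
  unfold ricci
  have hc := h.contDiffOn_christoffel
  have hp := fun a k i j => contDiffOn_pderiv h.isOpen (h.contDiffOn_christoffel k i j) a
  exact (ContDiffOn.sum fun k _ => (hp _ _ _ _).sub (hp _ _ _ _)).add
    (ContDiffOn.sum fun k _ => ContDiffOn.sum fun l _ =>
      ((hc _ _ _).mul (hc _ _ _)).sub ((hc _ _ _).mul (hc _ _ _)))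

theorem contDiffOn_scalar (h : IsMetricOn U G) : ContDiffOn ℝ ∞ (scalar G) U := by
  unfold scalar
  exact ContDiffOn.sum fun i _ => ContDiffOn.sum fun j _ =>
    (h.contDiffOn_inv i j).mul (h.contDiffOn_ricci i j)

theorem contDiffOn_hess (h : IsMetricOn U G) (hF : ContDiffOn ℝ ∞ F U) (i j : Fin n) :
    ContDiffOn ℝ ∞ (hess G F i j) U := by
  unfold hess
  have hp := contDiffOn_pderiv h.isOpen hF
  exact (contDiffOn_pderiv h.isOpen (hp j) i).sub (ContDiffOn.sum fun k _ =>
    (h.contDiffOn_christoffel k i j).mul (hp k))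

theorem contDiffOn_laplacian (h : IsMetricOn U G) (hF : ContDiffOn ℝ ∞ F U) :
    ContDiffOn ℝ ∞ (laplacian G F) U := by
  unfold laplacian
  exact (ContDiffOn.sum fun i _ => ContDiffOn.sum fun j _ =>
    (h.contDiffOn_inv i j).mul (h.contDiffOn_hess hF i j)).neg

theorem pderiv_symm (h : IsMetricOn U G) (hy : y ∈ U) (a i j : Fin n) :
    pderiv a (fun z => G z i j) y = pderiv a (fun z => G z j i) y :=
  pderiv_congr_of_isOpen h.isOpen hy a fun _ hz => h.symm hz i j

theorem christoffel_symm (h : IsMetricOn U G) (hy : y ∈ U) (k i j : Fin n) :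
    christoffel G k i j y = christoffel G k j i y := by
  unfold christoffel
  congr 1
  refine Finset.sum_congr rfl fun l _ => ?_
  rw [h.pderiv_symm hy l i j]
  ring

/-- The derivative of the inverse matrix, `∂_a g⁻¹ = - g⁻¹ (∂_a g) g⁻¹`. -/
theorem pderiv_inv (h : IsMetricOn U G) (hy : y ∈ U) (a : Fin n) :
    (Matrix.of fun i j => pderiv a (fun z => (G z)⁻¹ i j) y) =
      -((G y)⁻¹ * (Matrix.of fun i j => pderiv a (fun z => G z i j) y) * (G y)⁻¹) := by
  have d1 := fun i j => differentiableAt_of_contDiffOn h.isOpen (h.smooth i j) hy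
  have d2 := fun i j => differentiableAt_of_contDiffOn h.isOpen (h.contDiffOn_inv i j) hy
  -- Differentiate `G G⁻¹ = 1`, which holds on all of `U`, and then multiply by `G⁻¹` from the left.
  have key : (Matrix.of fun i j => pderiv a (fun z => G z i j) y) * (G y)⁻¹ +
      G y * (Matrix.of fun i j => pderiv a (fun z => (G z)⁻¹ i j) y) = 0 := by
    ext i j
    have h1 : pderiv a (fun z => ∑ k, G z i k * (G z)⁻¹ k j) y = 0 := by
      rw [pderiv_congr_of_isOpen h.isOpen hy a
        (F' := fun _ => (1 : Matrix (Fin n) (Fin n) ℝ) i j), pderiv_const]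
      intro z hz
      rw [← Matrix.mul_nonsing_inv (G z) (h.isUnit_det hz), Matrix.mul_apply]
    rw [pderiv_sum a fun k _ => (d1 i k).fun_mul (d2 k j)] at h1
    simp only [fun k => pderiv_mul a (d1 i k) (d2 k j), Finset.sum_add_distrib] at h1
    simpa [Matrix.mul_apply] using h1
  have := congrArg (fun X => (G y)⁻¹ * X) key
  simp only [mul_add, mul_zero, ← mul_assoc, Matrix.nonsing_inv_mul (G y) (h.isUnit_det hy),
    one_mul] at this
  exact eq_neg_of_add_eq_zero_right this

end IsMetricOn

end Coordinates

end Riem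

namespace Riem

section Coordinates

variable {n : ℕ}

theorem pderiv_pderiv_mul {U : Set (EuclideanSpace ℝ (Fin n))} (hU : IsOpen U)
    {F F' : EuclideanSpace ℝ (Fin n) → ℝ} (hF : ContDiffOn ℝ ∞ F U) (hF' : ContDiffOn ℝ ∞ F' U)
    {y : EuclideanSpace ℝ (Fin n)} (hy : y ∈ U) (a b : Fin n) :
    pderiv a (pderiv b fun z => F z * F' z) y =
      pderiv a (pderiv b F) y * F' y + pderiv b F y * pderiv a F' y
        + pderiv a F y * pderiv b F' y + F y * pderiv a (pderiv b F') y := by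
  have d := fun {z} hz => differentiableAt_of_contDiffOn hU hF (y := z) hz
  have d' := fun {z} hz => differentiableAt_of_contDiffOn hU hF' (y := z) hz
  have e := differentiableAt_of_contDiffOn hU (contDiffOn_pderiv hU hF b) hy
  have e' := differentiableAt_of_contDiffOn hU (contDiffOn_pderiv hU hF' b) hy
  rw [pderiv_congr_of_isOpen hU hy a fun z hz => pderiv_mul b (d hz) (d' hz),
    pderiv_add a (e.fun_mul (d' hy)) ((d hy).fun_mul e'), pderiv_mul a e (d' hy),
    pderiv_mul a (d hy) e']
  ring

namespace IsMetricOn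

variable {U : Set (EuclideanSpace ℝ (Fin n))}
  {G : EuclideanSpace ℝ (Fin n) → Matrix (Fin n) (Fin n) ℝ} {F : EuclideanSpace ℝ (Fin n) → ℝ}
  {y : EuclideanSpace ℝ (Fin n)}

theorem sum_inv_mul_self (h : IsMetricOn U G) (hy : y ∈ U) :
    ∑ i, ∑ j, (G y)⁻¹ i j * G y i j = n := by
  have h1 := congrArg Matrix.trace (Matrix.nonsing_inv_mul (G y) (h.isUnit_det hy))
  simp only [Matrix.trace, Matrix.diag, Matrix.mul_apply, Matrix.one_apply_eq, Finset.sum_const,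
    Finset.card_univ, Fintype.card_fin, nsmul_eq_mul, mul_one] at h1
  rw [← h1]
  refine Finset.sum_congr rfl fun i _ => Finset.sum_congr rfl fun j _ => ?_
  rw [h.symm hy]

/-- The trace of the static equation. -/
theorem laplacian_of_static (h : IsMetricOn U G) (hy : y ∈ U)
    (hst : ∀ i j, laplacian G F y * G y i j + hess G F i j y - F y * ricci G i j y = 0) :
    ((n : ℝ) - 1) * laplacian G F y = scalar G y * F y := by
  have e : ∑ i, ∑ j, (G y)⁻¹ i j *
      (laplacian G F y * G y i j + hess G F i j y - F y * ricci G i j y) = 0 := by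
    simp [hst]
  have e1 : ∑ i, ∑ j, (G y)⁻¹ i j * hess G F i j y = -laplacian G F y := by
    simp [laplacian]
  have e2 : ∑ i, ∑ j, (G y)⁻¹ i j * ricci G i j y = scalar G y := rfl
  have e3 : ∑ i, ∑ j, (G y)⁻¹ i j *
      (laplacian G F y * G y i j + hess G F i j y - F y * ricci G i j y) =
      laplacian G F y * ∑ i, ∑ j, (G y)⁻¹ i j * G y i j
        + ∑ i, ∑ j, (G y)⁻¹ i j * hess G F i j y
        - F y * ∑ i, ∑ j, (G y)⁻¹ i j * ricci G i j y := by
    simp only [Finset.mul_sum, ← Finset.sum_add_distrib, ← Finset.sum_sub_distrib]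
    refine Finset.sum_congr rfl fun i _ => Finset.sum_congr rfl fun j _ => ?_
    ring
  rw [e3, e1, e2, h.sum_inv_mul_self hy] at e
  linarith

/-! ### The divergence form of the Laplacian -/

/-- Jacobi's formula. In the Leibniz expansion, the terms in which column `k` is differentiated add
up to the determinant with that column replaced by its derivative; by Cramer this is the `k`-th
diagonal entry of `adjugate * B`. -/
theorem pderiv_det (h : IsMetricOn U G) (hy : y ∈ U) (a : Fin n) :
    pderiv a (fun z => (G z).det) y = (G y).det *
      ((G y)⁻¹ * (Matrix.of fun i j => pderiv a (fun z => G z i j) y)).trace := by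
  have d := fun i j => differentiableAt_of_contDiffOn h.isOpen (h.smooth i j) hy
  set B : Matrix (Fin n) (Fin n) ℝ := Matrix.of fun i j => pderiv a (fun z => G z i j) y with hB
  have h1 : pderiv a (fun z => (G z).det) y =
      ∑ σ : Equiv.Perm (Fin n), ((Equiv.Perm.sign σ : ℤ) : ℝ) *
        ∑ k, (∏ i ∈ Finset.univ.erase k, G y (σ i) i) * B (σ k) k := by
    simp only [Matrix.det_apply']
    have dp : ∀ σ : Equiv.Perm (Fin n),
        DifferentiableAt ℝ (fun z => ∏ i, G z (σ i) i) y := fun σ =>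
      differentiableAt_of_contDiffOn h.isOpen (contDiffOn_prod fun i _ => h.smooth _ _) hy
    rw [pderiv_sum a fun σ _ => (dp σ).const_mul _]
    refine Finset.sum_congr rfl fun σ _ => ?_
    rw [pderiv_const_mul a _ (dp σ)]
    congr 1
    unfold pderiv
    rw [fderiv_finsetProd fun i _ => d _ _]
    simp [hB, pderiv]
  have h2 : ∀ k, ((G y).updateCol k fun i => B i k).det =
      ∑ σ : Equiv.Perm (Fin n), ((Equiv.Perm.sign σ : ℤ) : ℝ) *
        ((∏ i ∈ Finset.univ.erase k, G y (σ i) i) * B (σ k) k) := by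
    intro k
    rw [Matrix.det_apply']
    refine Finset.sum_congr rfl fun σ _ => ?_
    congr 1
    rw [← Finset.prod_erase_mul _ _ (Finset.mem_univ k), Matrix.updateCol_self]
    congr 1
    refine Finset.prod_congr rfl fun i hi => ?_
    rw [Matrix.updateCol_ne (Finset.ne_of_mem_erase hi)]
  have h3 : (G y).det * ((G y)⁻¹ * B).trace = ((G y).adjugate * B).trace := by
    rw [Matrix.inv_def, Matrix.smul_mul, Matrix.trace_smul, smul_eq_mul, ← mul_assoc,
      Ring.mul_inverse_cancel _ (h.isUnit_det hy), one_mul]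
  rw [h3, h1]
  simp only [Finset.mul_sum]
  rw [Finset.sum_comm]
  simp only [← h2, Matrix.trace, Matrix.diag]
  refine Finset.sum_congr rfl fun k _ => ?_
  rw [← Matrix.cramer_apply, Matrix.cramer_eq_adjugate_mulVec]
  rfl

/-- `∂_a g_ij = g_il Γ^l_aj + g_jl Γ^l_ai`. -/
theorem pderiv_metric (h : IsMetricOn U G) (hy : y ∈ U) (a i j : Fin n) :
    pderiv a (fun z => G z i j) y =
      ∑ l, G y i l * christoffel G l a j y + ∑ l, G y j l * christoffel G l a i y := by
  -- Lowering the upper index cancels the inverse metric and leaves the Christoffel symbols of the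
  -- first kind; in the sum of two of them, everything but `∂_a g_ij` cancels.
  have lower : ∀ a i j, ∑ l, G y i l * christoffel G l a j y = (1 / 2) *
      (pderiv a (fun z => G z j i) y + pderiv j (fun z => G z a i) y
        - pderiv i (fun z => G z a j) y) := by
    intro a i j
    have e := congrFun (congrArg (fun X => Matrix.mulVec X fun l =>
      pderiv a (fun z => G z j l) y + pderiv j (fun z => G z a l) y
        - pderiv l (fun z => G z a j) y) (Matrix.mul_nonsing_inv (G y) (h.isUnit_det hy))) i
    simp only [← Matrix.mulVec_mulVec, Matrix.one_mulVec] at e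
    rw [← e]
    simp only [Matrix.mulVec, dotProduct, christoffel, Finset.mul_sum]
    refine Finset.sum_congr rfl fun l _ => Finset.sum_congr rfl fun m _ => ?_
    ring
  rw [lower, lower, h.pderiv_symm hy a j i, h.pderiv_symm hy j a i, h.pderiv_symm hy i a j]
  ring

/-- `Σ_i ∂_i (√g g^{ij} ∂_j F) = - √g ΔF`. -/
theorem pderiv_inv_apply (h : IsMetricOn U G) (hy : y ∈ U) (a i j : Fin n) :
    pderiv a (fun z => (G z)⁻¹ i j) y = -∑ k, christoffel G i a k y * (G y)⁻¹ k j
      - ∑ k, christoffel G j a k y * (G y)⁻¹ k i := by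
  let Γ : Matrix (Fin n) (Fin n) ℝ := Matrix.of fun k j => christoffel G k a j y
  let H := (G y)⁻¹
  -- Metric compatibility in matrix form, `∂_a G = GΓ + (GΓ)ᵀ`. Inserted into `∂_a G⁻¹ = -G⁻¹ (∂_a
  -- G) G⁻¹`, it leaves `-ΓG⁻¹ - (ΓG⁻¹)ᵀ`.
  have hB : (Matrix.of fun i j => pderiv a (fun z => G z i j) y) =
      G y * Γ + (G y * Γ).transpose := by
    ext i j
    simp only [Matrix.of_apply, h.pderiv_metric hy, Matrix.add_apply, Matrix.transpose_apply,
      Matrix.mul_apply, Γ]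
  have u := h.isUnit_det hy
  have hGT : (G y).transpose = G y := h.isSymm hy
  have e := congrFun (congrFun (h.pderiv_inv hy a) i) j
  rw [Matrix.of_apply, hB, mul_add, add_mul, ← mul_assoc, Matrix.nonsing_inv_mul _ u, one_mul,
    Matrix.transpose_mul, hGT, mul_assoc, mul_assoc, Matrix.mul_nonsing_inv _ u, mul_one] at e
  have e2 : (G y)⁻¹ * Γ.transpose = (Γ * H).transpose := by
    rw [Matrix.transpose_mul]
    congr 1
    exact (h.inv_isSymm hy).symm
  have e3 : ∀ i j, ∑ k, christoffel G i a k y * (G y)⁻¹ k j = (Γ * H) i j := fun i j => rfl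
  rw [e, e2, e3, e3, Matrix.neg_apply, Matrix.add_apply, Matrix.transpose_apply]
  ring

/-- The divergence form of the Laplacian. The derivative `∂_i √g = √g Γ^k_ik` cancels one of the two
Christoffel terms in `∂_i g^{ij}`, by symmetry of `Γ`; the other one is the Christoffel term of the
Hessian. -/
theorem sum_pderiv_flux (h : IsMetricOn U G) (hF : ContDiffOn ℝ ∞ F U) (hy : y ∈ U) :
    ∑ i, pderiv i (fun z => √(G z).det * ∑ j, (G z)⁻¹ i j * pderiv j F z) y =
      -(√(G y).det * laplacian G F y) := by
  have dF := fun j => differentiableAt_of_contDiffOn h.isOpen (contDiffOn_pderiv h.isOpen hF j) hy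
  have dH := fun i j => differentiableAt_of_contDiffOn h.isOpen (h.contDiffOn_inv i j) hy
  have ddet := differentiableAt_of_contDiffOn h.isOpen h.contDiffOn_det hy
  have dw : DifferentiableAt ℝ (fun z => √(G z).det) y := ddet.sqrt (h.det_pos hy).ne'
  let Γ : Fin n → Matrix (Fin n) (Fin n) ℝ := fun a => Matrix.of fun k j => christoffel G k a j y
  let H := (G y)⁻¹
  have hB : ∀ a, (Matrix.of fun i j => pderiv a (fun z => G z i j) y) =
      G y * Γ a + (G y * Γ a).transpose := by
    intro a
    ext i j
    simp only [Matrix.of_apply, h.pderiv_metric hy, Matrix.add_apply, Matrix.transpose_apply,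
      Matrix.mul_apply, Γ]
  have u := h.isUnit_det hy
  have hGT : (G y).transpose = G y := h.isSymm hy
  have hdetd : ∀ a, pderiv a (fun z => (G z).det) y = 2 * (G y).det * (Γ a).trace := by
    intro a
    have t1 : ((G y)⁻¹ * (G y * Γ a)).trace = (Γ a).trace := by
      rw [← mul_assoc, Matrix.nonsing_inv_mul _ u, one_mul]
    have t2 : ((G y)⁻¹ * (G y * Γ a).transpose).trace = (Γ a).trace := by
      rw [Matrix.transpose_mul, hGT, Matrix.trace_mul_comm, mul_assoc, Matrix.mul_nonsing_inv _ u,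
        mul_one, Matrix.trace_transpose]
    rw [h.pderiv_det hy, hB, mul_add, Matrix.trace_add, t1, t2]
    ring
  have hwd : ∀ a, pderiv a (fun z => √(G z).det) y = √(G y).det * (Γ a).trace := by
    intro a
    have e1 : pderiv a (fun z => √(G z).det) y =
        1 / (2 * √(G y).det) * pderiv a (fun z => (G z).det) y := by
      unfold pderiv
      rw [fderiv_sqrt ddet (h.det_pos hy).ne']
      simp
    have e2 : √(G y).det ≠ 0 := (Real.sqrt_pos.2 (h.det_pos hy)).ne'
    rw [e1, hdetd]
    field_simp
    rw [Real.sq_sqrt (h.det_pos hy).le]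
  have hHd : ∀ a i j, pderiv a (fun z => (G z)⁻¹ i j) y =
      -(Γ a * H) i j - (Γ a * H) j i := fun a i j => h.pderiv_inv_apply hy a i j
  have key : ∀ i, pderiv i (fun z => √(G z).det * ∑ j, (G z)⁻¹ i j * pderiv j F z) y =
      √(G y).det * ∑ j, ((Γ i).trace * (H i j * pderiv j F y)
        + (-(Γ i * H) i j - (Γ i * H) j i) * pderiv j F y + H i j * pderiv i (pderiv j F) y) := by
    intro i
    rw [pderiv_mul i dw (DifferentiableAt.fun_sum fun j _ => (dH i j).fun_mul (dF j)),
      pderiv_sum i fun j _ => (dH i j).fun_mul (dF j), hwd, mul_assoc, ← mul_add, Finset.mul_sum,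
      ← Finset.sum_add_distrib]
    congr 1
    refine Finset.sum_congr rfl fun j _ => ?_
    rw [pderiv_mul i (dH i j) (dF j), hHd]
    ring
  simp only [key, laplacian, ← Finset.mul_sum, ← mul_neg, neg_neg]
  congr 1
  have c1 : ∑ i, ∑ j, (Γ i).trace * (H i j * pderiv j F y) =
      ∑ i, ∑ j, (Γ i * H) i j * pderiv j F y := by
    rw [Finset.sum_comm, Finset.sum_comm (f := fun i j => (Γ i * H) i j * pderiv j F y)]
    refine Finset.sum_congr rfl fun j _ => ?_
    simp only [Matrix.mul_apply, Matrix.trace, Matrix.diag, Finset.sum_mul]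
    rw [Finset.sum_comm]
    refine Finset.sum_congr rfl fun k _ => Finset.sum_congr rfl fun i _ => ?_
    simp only [Γ, Matrix.of_apply]
    rw [h.christoffel_symm hy k i k]
    ring
  have c2 : ∑ i, ∑ j, (Γ i * H) j i * pderiv j F y =
      ∑ i, ∑ j, H i j * ∑ k, christoffel G k i j y * pderiv k F y := by
    refine Finset.sum_congr rfl fun i _ => ?_
    simp only [Matrix.mul_apply, Finset.sum_mul, Finset.mul_sum]
    rw [Finset.sum_comm]
    refine Finset.sum_congr rfl fun j _ => Finset.sum_congr rfl fun k _ => ?_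
    simp only [Γ, Matrix.of_apply]
    have e : H j i = H i j := (h.inv_isSymm hy).apply i j
    rw [e]
    ring
  simp only [Finset.sum_add_distrib, sub_mul, neg_mul, Finset.sum_sub_distrib,
    Finset.sum_neg_distrib, hess, mul_sub, c1, c2, H]
  ring

/-- `∂_a |∇F|² = 2 g^{ij} ∇_a∇_i F ∂_j F`. -/
theorem pderiv_gradient_norm_sq (h : IsMetricOn U G) (hF : ContDiffOn ℝ ∞ F U) (hy : y ∈ U)
    (a : Fin n) :
    pderiv a (fun z => ∑ i, ∑ j, (G z)⁻¹ i j * pderiv i F z * pderiv j F z) y =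
      2 * ∑ i, ∑ j, (G y)⁻¹ i j * hess G F a i y * pderiv j F y := by
  have dF := fun j => differentiableAt_of_contDiffOn h.isOpen (contDiffOn_pderiv h.isOpen hF j) hy
  have dH := fun i j => differentiableAt_of_contDiffOn h.isOpen (h.contDiffOn_inv i j) hy
  have dHF := fun i j => (dH i j).fun_mul (dF i)
  have hsymm : ∀ i j, (G y)⁻¹ i j = (G y)⁻¹ j i := fun i j => ((h.inv_isSymm hy).apply i j).symm
  rw [pderiv_sum a fun i _ => DifferentiableAt.fun_sum fun j _ => (dHF i j).fun_mul (dF j)]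
  simp only [fun i => pderiv_sum a fun j (_ : j ∈ Finset.univ) => (dHF i j).fun_mul (dF j),
    fun i j => pderiv_mul a (dHF i j) (dF j), fun i j => pderiv_mul a (dH i j) (dF i),
    h.pderiv_inv_apply hy]
  have swap : ∀ P : Fin n → Fin n → ℝ, ∑ i, ∑ j, P i j = ∑ i, ∑ j, P j i := fun P =>
    Finset.sum_comm
  -- After relabelling, each of the two Christoffel terms in `∂_a g^{ij}` is the correction that
  -- turns a second partial derivative of `F` into a component of the Hessian.
  have c1 : ∑ i, ∑ j, (∑ k, christoffel G i a k y * (G y)⁻¹ k j) * pderiv i F y * pderiv j F y =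
      ∑ i, ∑ j, (G y)⁻¹ i j * (∑ k, christoffel G k a i y * pderiv k F y) * pderiv j F y := by
    rw [swap, swap fun i j => (G y)⁻¹ i j * (∑ k, christoffel G k a i y * pderiv k F y) *
      pderiv j F y]
    refine Finset.sum_congr rfl fun j _ => ?_
    simp only [Finset.sum_mul, Finset.mul_sum]
    rw [Finset.sum_comm]
    refine Finset.sum_congr rfl fun k _ => Finset.sum_congr rfl fun i _ => ?_
    ring
  have c2 : ∑ i, ∑ j, (∑ k, christoffel G j a k y * (G y)⁻¹ k i) * pderiv i F y * pderiv j F y =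
      ∑ i, ∑ j, (∑ k, christoffel G i a k y * (G y)⁻¹ k j) * pderiv i F y * pderiv j F y := by
    rw [swap]
    refine Finset.sum_congr rfl fun i _ => Finset.sum_congr rfl fun j _ => ?_
    ring
  have c3 : ∑ i, ∑ j, (G y)⁻¹ i j * pderiv i F y * pderiv a (pderiv j F) y =
      ∑ i, ∑ j, (G y)⁻¹ i j * pderiv a (pderiv i F) y * pderiv j F y := by
    rw [swap]
    refine Finset.sum_congr rfl fun i _ => Finset.sum_congr rfl fun j _ => ?_
    rw [hsymm j i]
    ring
  simp only [hess, add_mul, sub_mul, mul_sub, neg_mul, Finset.sum_add_distrib,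
    Finset.sum_sub_distrib, Finset.sum_neg_distrib, c2, c1, c3]
  ring

end IsMetricOn

end Coordinates

end Riem

namespace Riem

section Coordinates

variable {n : ℕ}

/-! ### Normal coordinates -/

/-- `G` is the coordinate matrix of a metric on `U`, with `g_ij = δ_ij` and `∂_a g_ij = 0` at
the point `y`. -/
structure IsNormalAt (U : Set (EuclideanSpace ℝ (Fin n)))
    (G : EuclideanSpace ℝ (Fin n) → Matrix (Fin n) (Fin n) ℝ) (y : EuclideanSpace ℝ (Fin n)) :
    Prop extends IsMetricOn U G where
  mem : y ∈ U
  eq_one : G y = 1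
  pderiv_eq_zero : ∀ a i j, pderiv a (fun z => G z i j) y = 0

namespace IsNormalAt

variable {U : Set (EuclideanSpace ℝ (Fin n))}
  {G : EuclideanSpace ℝ (Fin n) → Matrix (Fin n) (Fin n) ℝ} {F : EuclideanSpace ℝ (Fin n) → ℝ}
  {y : EuclideanSpace ℝ (Fin n)}

theorem inv_eq_one (h : IsNormalAt U G y) : (G y)⁻¹ = 1 := by
  rw [h.eq_one, inv_one]

theorem pderiv_inv_eq_zero (h : IsNormalAt U G y) (a i j : Fin n) :
    pderiv a (fun z => (G z)⁻¹ i j) y = 0 := by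
  have e := congrFun (congrFun (h.pderiv_inv h.mem a) i) j
  have z : (Matrix.of fun i j => pderiv a (fun z => G z i j) y) = 0 := by
    ext i j
    simp [h.pderiv_eq_zero]
  rw [z] at e
  simpa using e

theorem christoffel_eq_zero (h : IsNormalAt U G y) (k i j : Fin n) :
    christoffel G k i j y = 0 := by
  simp [christoffel, h.pderiv_eq_zero]

theorem sum_inv_apply_mul (h : IsNormalAt U G y) (k : Fin n) (v : Fin n → ℝ) :
    ∑ l, (G y)⁻¹ k l * v l = v k := by
  simp [h.inv_eq_one, Matrix.one_apply]

theorem sum_sum_inv_mul (h : IsNormalAt U G y) (v : Fin n → Fin n → ℝ) :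
    ∑ i, ∑ j, (G y)⁻¹ i j * v i j = ∑ i, v i i := by
  simp [h.inv_eq_one, Matrix.one_apply]

/-- To first order at the centre, contraction with `g⁻¹` is the Euclidean trace. -/
theorem pderiv_sum_sum_inv_mul (h : IsNormalAt U G y)
    {A : Fin n → Fin n → EuclideanSpace ℝ (Fin n) → ℝ} (hA : ∀ i j, ContDiffOn ℝ ∞ (A i j) U)
    (a : Fin n) :
    pderiv a (fun z => ∑ i, ∑ j, (G z)⁻¹ i j * A i j z) y = ∑ i, pderiv a (A i i) y := by
  have d := fun i j => differentiableAt_of_contDiffOn h.isOpen (hA i j) h.mem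
  have d' := fun i j => differentiableAt_of_contDiffOn h.isOpen (h.contDiffOn_inv i j) h.mem
  rw [pderiv_sum a fun i _ => DifferentiableAt.fun_sum fun j _ => (d' i j).fun_mul (d i j)]
  simp only [fun i => pderiv_sum a fun j (_ : j ∈ Finset.univ) => (d' i j).fun_mul (d i j),
    fun i j => pderiv_mul a (d' i j) (d i j), h.pderiv_inv_eq_zero, zero_mul, zero_add]
  exact h.sum_sum_inv_mul _

/-- `∂_a Γ^k_ij = ½ (∂_a ∂_i g_jk + ∂_a ∂_j g_ik - ∂_a ∂_k g_ij)` at the centre. -/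
theorem pderiv_christoffel (h : IsNormalAt U G y) (a k i j : Fin n) :
    pderiv a (christoffel G k i j) y = (1 / 2) *
      (pderiv a (pderiv i fun z => G z j k) y + pderiv a (pderiv j fun z => G z i k) y
        - pderiv a (pderiv k fun z => G z i j) y) := by
  have d := fun a i j => differentiableAt_of_contDiffOn h.isOpen
    (contDiffOn_pderiv h.isOpen (h.smooth i j) a) h.mem
  have d' := fun i j => differentiableAt_of_contDiffOn h.isOpen (h.contDiffOn_inv i j) h.mem
  have dl := fun l => ((d i j l).fun_add (d j i l)).fun_sub (d l i j)
  unfold christoffel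
  rw [pderiv_const_mul a _ (DifferentiableAt.fun_sum fun l _ => (d' k l).fun_mul (dl l)),
    pderiv_sum a fun l _ => (d' k l).fun_mul (dl l)]
  simp only [fun l => pderiv_mul a (d' k l) (dl l), h.pderiv_inv_eq_zero, zero_mul, zero_add,
    fun l => pderiv_sub a ((d i j l).fun_add (d j i l)) (d l i j),
    fun l => pderiv_add a (d i j l) (d j i l), h.sum_inv_apply_mul]

/-- The second derivatives of the Christoffel symbols at the centre. -/
theorem pderiv_pderiv_christoffel (h : IsNormalAt U G y) (a b k i j : Fin n) :
    pderiv a (pderiv b (christoffel G k i j)) y = (1 / 2) *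
      (pderiv a (pderiv b (pderiv i fun z => G z j k)) y
        + pderiv a (pderiv b (pderiv j fun z => G z i k)) y
        - pderiv a (pderiv b (pderiv k fun z => G z i j)) y) := by
  have hU := h.isOpen
  have s1 := fun a i j => contDiffOn_pderiv hU (h.smooth i j) a
  have s2 := fun b a i j => contDiffOn_pderiv hU (s1 a i j) b
  have d1 := fun {z} (hz : z ∈ U) a i j => differentiableAt_of_contDiffOn hU (s1 a i j) hz
  have d2 := fun b a i j => differentiableAt_of_contDiffOn hU (s2 b a i j) h.mem
  have sl : ∀ l, ContDiffOn ℝ ∞ (fun z => pderiv i (fun z => G z j l) z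
      + pderiv j (fun z => G z i l) z - pderiv l (fun z => G z i j) z) U := fun l =>
    ((s1 i j l).add (s1 j i l)).sub (s1 l i j)
  have sp := fun l => (h.contDiffOn_inv k l).mul (sl l)
  have sp1 := fun b l => contDiffOn_pderiv hU (sp l) b
  have dp := fun {z} (hz : z ∈ U) l => differentiableAt_of_contDiffOn hU (sp l) hz
  have dp1 := fun b l => differentiableAt_of_contDiffOn hU (sp1 b l) h.mem
  have e : ∀ z ∈ U, pderiv b (christoffel G k i j) z = (1 / 2) * ∑ l, pderiv b (fun z =>
      (G z)⁻¹ k l * (pderiv i (fun z => G z j l) z + pderiv j (fun z => G z i l) z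
        - pderiv l (fun z => G z i j) z)) z := by
    intro z hz
    unfold christoffel
    rw [pderiv_const_mul b _ (DifferentiableAt.fun_sum fun l _ => dp hz l),
      pderiv_sum b fun l _ => dp hz l]
  have e2 : ∀ l, pderiv a (pderiv b (fun z =>
      (G z)⁻¹ k l * (pderiv i (fun z => G z j l) z + pderiv j (fun z => G z i l) z
        - pderiv l (fun z => G z i j) z))) y =
      (G y)⁻¹ k l * (pderiv a (pderiv b (pderiv i fun z => G z j l)) y
        + pderiv a (pderiv b (pderiv j fun z => G z i l)) y
        - pderiv a (pderiv b (pderiv l fun z => G z i j)) y) := by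
    intro l
    rw [pderiv_pderiv_mul hU (h.contDiffOn_inv k l) (sl l) h.mem]
    -- The second derivatives of `g⁻¹` need not vanish, but they multiply first derivatives of `g`,
    -- which are zero at the centre.
    simp only [h.pderiv_inv_eq_zero, h.pderiv_eq_zero]
    rw [pderiv_congr_of_isOpen hU h.mem a fun z hz =>
      pderiv_sub b ((d1 hz i j l).fun_add (d1 hz j i l)) (d1 hz l i j)]
    rw [pderiv_congr_of_isOpen hU h.mem a fun z hz =>
      congrArg (· - _) (pderiv_add b (d1 hz i j l) (d1 hz j i l))]
    rw [pderiv_sub a ((d2 b i j l).fun_add (d2 b j i l)) (d2 b l i j),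
      pderiv_add a (d2 b i j l) (d2 b j i l)]
    ring
  rw [pderiv_congr_of_isOpen hU h.mem a e,
    pderiv_const_mul a _ (DifferentiableAt.fun_sum fun l _ => dp1 b l),
    pderiv_sum a fun l _ => dp1 b l]
  simp only [e2, h.sum_inv_apply_mul]

theorem ricci_eq (h : IsNormalAt U G y) (i j : Fin n) :
    ricci G i j y =
      ∑ k, (pderiv k (christoffel G k i j) y - pderiv j (christoffel G k i k) y) := by
  simp [ricci, h.christoffel_eq_zero]

/-- The quadratic part `ΓΓ` vanishes to second order at the centre and contributes nothing to first
derivatives. -/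
theorem pderiv_ricci (h : IsNormalAt U G y) (a i j : Fin n) :
    pderiv a (ricci G i j) y = ∑ k, (pderiv a (pderiv k (christoffel G k i j)) y
      - pderiv a (pderiv j (christoffel G k i k)) y) := by
  have hU := h.isOpen
  have d := fun k i j => differentiableAt_of_contDiffOn hU (h.contDiffOn_christoffel k i j) h.mem
  have d1 := fun b k i j => differentiableAt_of_contDiffOn hU
    (contDiffOn_pderiv hU (h.contDiffOn_christoffel k i j) b) h.mem
  have d2 := fun k l => ((d k k l).fun_mul (d l i j)).fun_sub ((d k j l).fun_mul (d l i k))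
  unfold ricci
  rw [pderiv_add a (DifferentiableAt.fun_sum fun k _ => (d1 k k i j).fun_sub (d1 j k i k))
      (DifferentiableAt.fun_sum fun k _ => DifferentiableAt.fun_sum fun l _ => d2 k l),
    pderiv_sum a fun k _ => (d1 k k i j).fun_sub (d1 j k i k),
    pderiv_sum a fun k _ => DifferentiableAt.fun_sum fun l _ => d2 k l]
  simp only [fun k => pderiv_sub a (d1 k k i j) (d1 j k i k),
    fun k => pderiv_sum a fun l (_ : l ∈ Finset.univ) => d2 k l,
    fun k l => pderiv_sub a ((d k k l).fun_mul (d l i j)) ((d k j l).fun_mul (d l i k)),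
    fun k l i j k' l' => pderiv_mul a (d k l i) (d j k' l'), h.christoffel_eq_zero, mul_zero,
    zero_mul, add_zero, sub_zero, Finset.sum_const_zero]

theorem pderiv_hess (h : IsNormalAt U G y) (hF : ContDiffOn ℝ ∞ F U) (a i j : Fin n) :
    pderiv a (hess G F i j) y = pderiv a (pderiv i (pderiv j F)) y
      - ∑ k, pderiv a (christoffel G k i j) y * pderiv k F y := by
  have hU := h.isOpen
  have d := fun k i j => differentiableAt_of_contDiffOn hU (h.contDiffOn_christoffel k i j) h.mem
  have s1 := fun k => contDiffOn_pderiv hU hF k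
  have d1 := fun k => differentiableAt_of_contDiffOn hU (s1 k) h.mem
  have d2 := differentiableAt_of_contDiffOn hU (contDiffOn_pderiv hU (s1 j) i) h.mem
  unfold hess
  rw [pderiv_sub a d2 (DifferentiableAt.fun_sum fun k _ => (d k i j).fun_mul (d1 k)),
    pderiv_sum a fun k _ => (d k i j).fun_mul (d1 k)]
  simp only [fun k => pderiv_mul a (d k i j) (d1 k), h.christoffel_eq_zero, zero_mul, add_zero]

/-- The contracted Bianchi identity `2 ∇^i r_ij = ∂_j s`, at the centre of normal coordinates. -/
theorem contracted_bianchi (h : IsNormalAt U G y) (j : Fin n) :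
    2 * ∑ i, pderiv i (ricci G i j) y = pderiv j (scalar G) y := by
  have hU := h.isOpen
  have s1 := fun c p q => contDiffOn_pderiv hU (h.smooth p q) c
  -- At the centre both sides are linear in the third derivatives `∂_a ∂_b ∂_c g_pq`, so only the
  -- symmetries of `T` in `a, b, c` and in `p, q`, and the renaming of summed indices, are needed.
  let T : Fin n → Fin n → Fin n → Fin n → Fin n → ℝ := fun a b c p q =>
    pderiv a (pderiv b (pderiv c fun z => G z p q)) y
  have T1 : ∀ a b c p q, T a b c p q = T b a c p q := fun a b c p q =>
    pderiv_comm hU (s1 c p q) h.mem a b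
  have T2 : ∀ a b c p q, T a b c p q = T a c b p q := fun a b c p q =>
    pderiv_congr_of_isOpen hU h.mem a fun z hz => pderiv_comm hU (h.smooth p q) hz b c
  have T3 : ∀ a b c p q, T a b c p q = T a b c q p := fun a b c p q =>
    pderiv_congr_of_isOpen hU h.mem a fun z hz => pderiv_congr_of_isOpen hU hz b
      fun w hw => h.pderiv_symm hw c p q
  have r : ∀ a i j, pderiv a (ricci G i j) y = ∑ k, ((1 / 2) * (T a k i j k + T a k j i k
      - T a k k i j) - (1 / 2) * (T a j i k k + T a j k i k - T a j k i k)) := by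
    intro a i j
    rw [h.pderiv_ricci]
    simp only [h.pderiv_pderiv_christoffel]
    rfl
  have hs : pderiv j (scalar G) y = ∑ i, pderiv j (ricci G i i) y :=
    h.pderiv_sum_sum_inv_mul h.contDiffOn_ricci j
  rw [hs]
  simp only [r, Finset.mul_sum, add_sub_cancel_right]
  have sw : ∑ i, ∑ k, T i k i j k = ∑ i, ∑ k, T i k k i j := by
    rw [Finset.sum_comm]
    refine Finset.sum_congr rfl fun i _ => Finset.sum_congr rfl fun k _ => ?_
    rw [T1, T3]
  have sw' : ∑ i, ∑ k, T j k k i i = ∑ i, ∑ k, T j i i k k := Finset.sum_comm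
  have e1 : ∀ i k, T i k j i k = T j k i i k := fun i k => by rw [T2, T1, T2]
  have e2 : ∀ i k, T i j i k k = T j i i k k := fun i k => T1 _ _ _ _ _
  have l : ∀ i k, 2 * ((1 / 2) * (T i k i j k + T i k j i k - T i k k i j)
      - (1 / 2) * T i j i k k) = T i k i j k - T i k k i j + (T j k i i k - T j i i k k) := by
    intro i k
    rw [e1, e2]
    ring
  have l' : ∀ i k, (1 / 2) * (T j k i i k + T j k i i k - T j k k i i)
      - (1 / 2) * T j i i k k =
      (T j k i i k - T j i i k k) - (1 / 2) * (T j k k i i - T j i i k k) := by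
    intro i k
    ring
  simp only [l, l', Finset.sum_add_distrib, Finset.sum_sub_distrib, ← Finset.mul_sum, sw, sw']
  ring

/-- The divergence of the static equation at the centre of normal coordinates: `f ∂_j s = 0`. -/
theorem mul_pderiv_scalar_eq_zero (h : IsNormalAt U G y) (hF : ContDiffOn ℝ ∞ F U)
    (hst : ∀ z ∈ U, ∀ i j,
      laplacian G F z * G z i j + hess G F i j z - F z * ricci G i j z = 0) (j : Fin n) :
    F y * pderiv j (scalar G) y = 0 := by
  have hU := h.isOpen
  have sF := fun k => contDiffOn_pderiv hU hF k
  have dF := differentiableAt_of_contDiffOn hU hF h.mem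
  have dL := differentiableAt_of_contDiffOn hU (h.contDiffOn_laplacian hF) h.mem
  have dG := fun i j => differentiableAt_of_contDiffOn hU (h.smooth i j) h.mem
  have dH := fun i j => differentiableAt_of_contDiffOn hU (h.contDiffOn_hess hF i j) h.mem
  have dr := fun i j => differentiableAt_of_contDiffOn hU (h.contDiffOn_ricci i j) h.mem
  -- The `i`-th derivative of the `(i, j)` component of the static equation; its sum over `i` is the
  -- divergence.
  have e : ∀ i, pderiv i (laplacian G F) y * G y i j + pderiv i (hess G F i j) y
      - (pderiv i F y * ricci G i j y + F y * pderiv i (ricci G i j) y) = 0 := by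
    intro i
    have e1 := pderiv_congr_of_isOpen hU h.mem i fun z hz => hst z hz i j
    rw [pderiv_const, pderiv_sub i ((dL.fun_mul (dG i j)).fun_add (dH i j))
      (dF.fun_mul (dr i j)), pderiv_add i (dL.fun_mul (dG i j)) (dH i j),
      pderiv_mul i dL (dG i j), pderiv_mul i dF (dr i j), h.pderiv_eq_zero, mul_zero,
      add_zero] at e1
    exact e1
  have eL : pderiv j (laplacian G F) y = -∑ i, pderiv j (hess G F i i) y := by
    unfold laplacian
    rw [pderiv_neg, h.pderiv_sum_sum_inv_mul (h.contDiffOn_hess hF) j]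
  have s := Finset.sum_congr rfl fun i (_ : i ∈ (Finset.univ : Finset (Fin n))) => e i
  have eL' : ∑ i, pderiv i (laplacian G F) y * G y i j = pderiv j (laplacian G F) y := by
    simp [h.eq_one, Matrix.one_apply]
  simp only [Finset.sum_sub_distrib, Finset.sum_add_distrib, ← Finset.mul_sum, eL', eL,
    h.pderiv_hess hF, Finset.sum_const_zero] at s
  let D : Fin n → Fin n → Fin n → Fin n → ℝ := fun a b p q =>
    pderiv a (pderiv b fun z => G z p q) y
  have D1 : ∀ a b p q, D a b p q = D b a p q := fun a b p q =>
    pderiv_comm hU (h.smooth p q) h.mem a b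
  have D2 : ∀ a b p q, D a b p q = D a b q p := fun a b p q =>
    pderiv_congr_of_isOpen hU h.mem a fun z hz => h.pderiv_symm hz b p q
  have c : ∀ a k i j, pderiv a (christoffel G k i j) y =
      (1 / 2) * (D a i j k + D a j i k - D a k i j) := fun a k i j => h.pderiv_christoffel a k i j
  have third : ∀ i, pderiv j (pderiv i (pderiv i F)) y = pderiv i (pderiv i (pderiv j F)) y := by
    intro i
    rw [pderiv_comm hU (sF i) h.mem,
      pderiv_congr_of_isOpen hU h.mem i fun z hz => pderiv_comm hU hF hz j i]
  have b := h.contracted_bianchi j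
  -- The Ricci identity `∇^i ∇_i ∇_j F + ∇_j ΔF = r_jk ∇^k F`, once the third derivatives of `F`
  -- have cancelled. It removes every term of the divergence except `F ∇^i r_ij`.
  have curv : ∑ i, ∑ k, pderiv j (christoffel G k i i) y * pderiv k F y
      - ∑ i, ∑ k, pderiv i (christoffel G k i j) y * pderiv k F y
      - ∑ k, pderiv k F y * ricci G k j y = 0 := by
    have e3 : ∑ k, pderiv k F y * ricci G k j y =
        ∑ i, ∑ k, (pderiv i (christoffel G i k j) y - pderiv j (christoffel G i k i) y)
          * pderiv k F y := by
      rw [Finset.sum_comm]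
      refine Finset.sum_congr rfl fun k _ => ?_
      rw [h.ricci_eq, mul_comm, Finset.sum_mul]
    rw [e3, ← Finset.sum_sub_distrib, ← Finset.sum_sub_distrib]
    refine Finset.sum_eq_zero fun i _ => ?_
    rw [← Finset.sum_sub_distrib, ← Finset.sum_sub_distrib]
    refine Finset.sum_eq_zero fun k _ => ?_
    simp only [c]
    rw [D1 i j i k, D1 i k i j, show D i k j i = D k i i j by rw [D1, D2],
      show D i j k i = D j i i k by rw [D1, D2], D2 i i k j]
    ring
  simp only [third] at s
  rw [← b]
  linear_combination (-2) * s + 2 * curv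

end IsNormalAt

end Coordinates

end Riem

namespace Riem

/-! ### Vanishing of solutions of linear differential equations -/

/-- Grönwall's inequality, which runs forward in time; the past of `t₀` is handled by the reflection
`s ↦ t₀ - s`. -/
theorem eventually_eq_zero_of_norm_deriv_le {E : Type*} [NormedAddCommGroup E] [NormedSpace ℝ E]
    {u u' : ℝ → E} {t₀ K : ℝ}
    (h : ∀ᶠ t in 𝓝 t₀, HasDerivAt u (u' t) t ∧ ‖u' t‖ ≤ K * ‖u t‖) (h₀ : u t₀ = 0) :
    ∀ᶠ t in 𝓝 t₀, u t = 0 := by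
  obtain ⟨ε, hε, hb⟩ := Metric.eventually_nhds_iff_ball.1 h
  filter_upwards [Metric.ball_mem_nhds t₀ hε] with t ht
  have ht' : |t - t₀| < ε := by simpa [Real.dist_eq] using ht
  have hI : ∀ s ∈ Icc 0 |t - t₀|, t₀ + s ∈ Metric.ball t₀ ε ∧ t₀ - s ∈ Metric.ball t₀ ε := by
    intro s hs
    simp only [Metric.mem_ball, Real.dist_eq, add_sub_cancel_left, sub_sub_cancel_left, abs_neg,
      abs_of_nonneg hs.1, and_self]
    exact hs.2.trans_lt ht'
  have fwd : ∀ s ∈ Icc 0 |t - t₀|, u (t₀ + s) = 0 := by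
    have hd : ∀ s ∈ Icc 0 |t - t₀|, HasDerivAt (fun s => u (t₀ + s)) (u' (t₀ + s)) s := by
      intro s hs
      exact (hb _ (hI s hs).1).1.comp_const_add t₀ s
    exact eq_zero_of_abs_deriv_le_mul_abs_self_of_eq_zero_right
      (fun s hs => (hd s hs).continuousAt.continuousWithinAt)
      (fun s hs => (hd s ⟨hs.1, hs.2.le⟩).hasDerivWithinAt) (by simpa using h₀)
      fun s hs => (hb _ (hI s ⟨hs.1, hs.2.le⟩).1).2
  have bwd : ∀ s ∈ Icc 0 |t - t₀|, u (t₀ - s) = 0 := by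
    have hd : ∀ s ∈ Icc 0 |t - t₀|, HasDerivAt (fun s => u (t₀ - s)) (-u' (t₀ - s)) s := by
      intro s hs
      exact (hb _ (hI s hs).2).1.comp_const_sub t₀ s
    exact eq_zero_of_abs_deriv_le_mul_abs_self_of_eq_zero_right
      (fun s hs => (hd s hs).continuousAt.continuousWithinAt)
      (fun s hs => (hd s ⟨hs.1, hs.2.le⟩).hasDerivWithinAt) (by simpa using h₀)
      fun s hs => by simpa using (hb _ (hI s ⟨hs.1, hs.2.le⟩).2).2
  rcases le_total t₀ t with h1 | h1
  · have := fwd (t - t₀) ⟨by linarith, le_abs_self _⟩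
    simpa using this
  · have := bwd (t₀ - t) ⟨by linarith, by rw [abs_sub_comm]; exact le_abs_self _⟩
    simpa using this

/-- The equation `h'' = a h` is a first-order linear system for `(h, h')`. Near `t₀` the coefficient
is bounded by `|a t₀| + 1`, and the summand `1` in `K` accounts for the component `h`, whose
derivative is `h'`. -/
theorem eventually_eq_zero_of_deriv_deriv_eq_mul {h a : ℝ → ℝ} {t₀ : ℝ} (ha : ContinuousAt a t₀)
    (hd : ∀ᶠ t in 𝓝 t₀, DifferentiableAt ℝ h t ∧ HasDerivAt (deriv h) (a t * h t) t)
    (h₀ : h t₀ = 0) (h₁ : deriv h t₀ = 0) : ∀ᶠ t in 𝓝 t₀, h t = 0 := by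
  have key : ∀ᶠ t in 𝓝 t₀, (fun t => (h t, deriv h t)) t = 0 := by
    refine eventually_eq_zero_of_norm_deriv_le (K := 1 + (|a t₀| + 1))
      (u' := fun t => (deriv h t, a t * h t)) ?_ (by simp [h₀, h₁])
    have hb : ∀ᶠ t in 𝓝 t₀, |a t| < |a t₀| + 1 :=
      ha.abs.eventually (gt_mem_nhds (lt_add_one _))
    filter_upwards [hd, hb] with t ht hbt
    refine ⟨ht.1.hasDerivAt.prodMk ht.2, ?_⟩
    have n1 : |h t| ≤ ‖((h t, deriv h t) : ℝ × ℝ)‖ := norm_fst_le (h t, deriv h t)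
    have n2 : |deriv h t| ≤ ‖((h t, deriv h t) : ℝ × ℝ)‖ := norm_snd_le (h t, deriv h t)
    set N := ‖((h t, deriv h t) : ℝ × ℝ)‖
    have hN : 0 ≤ N := norm_nonneg _
    have n3 : |a t| * |h t| ≤ (|a t₀| + 1) * N :=
      mul_le_mul hbt.le n1 (abs_nonneg _) (by positivity)
    have n4 : 0 ≤ (|a t₀| + 1) * N := by positivity
    rw [Prod.norm_def]
    simp only [Real.norm_eq_abs, abs_mul]
    exact max_le (by linarith) (by linarith)
  filter_upwards [key] with t ht
  exact congrArg Prod.fst ht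

section Coordinates

variable {n : ℕ} {U : Set (EuclideanSpace ℝ (Fin n))} {F : EuclideanSpace ℝ (Fin n) → ℝ}
  {y : EuclideanSpace ℝ (Fin n)}

/-- A solution of a linear system expressing `∂_i ∂_j F` through `F` and `∂_k F` vanishes near a
point where `F` and `dF` vanish. -/
theorem eventually_eq_zero_of_pderiv_pderiv_eq (hU : IsOpen U) (hF : ContDiffOn ℝ ∞ F U)
    {A : Fin n → Fin n → Fin n → EuclideanSpace ℝ (Fin n) → ℝ}
    {q : Fin n → Fin n → EuclideanSpace ℝ (Fin n) → ℝ}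
    (hA : ∀ k i j, ContinuousOn (A k i j) U) (hq : ∀ i j, ContinuousOn (q i j) U)
    (heq : ∀ z ∈ U, ∀ i j,
      pderiv i (pderiv j F) z = ∑ k, A k i j z * pderiv k F z + q i j z * F z)
    (hy : y ∈ U) (h₀ : F y = 0) (h₁ : ∀ i, pderiv i F y = 0) : ∀ᶠ z in 𝓝 y, F z = 0 := by
  obtain ⟨ε, hε, hb⟩ := Metric.isOpen_iff.1 hU y hy
  filter_upwards [Metric.ball_mem_nhds y hε] with z hz
  set v := z - y with hv
  have hseg : ∀ t ∈ Icc (0 : ℝ) 1, y + t • v ∈ U := by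
    intro t ht
    apply hb
    rw [Metric.mem_ball, dist_eq_norm, add_sub_cancel_left, norm_smul, Real.norm_eq_abs,
      abs_of_nonneg ht.1]
    rw [Metric.mem_ball, dist_eq_norm] at hz
    nlinarith [norm_nonneg v, ht.2]
  have hcs : Continuous fun t : ℝ => y + t • v := by fun_prop
  have hd : ∀ {F' : EuclideanSpace ℝ (Fin n) → ℝ}, ContDiffOn ℝ ∞ F' U → ∀ t ∈ Icc (0 : ℝ) 1,
      HasDerivAt (fun t : ℝ => F' (y + t • v)) (∑ i, v i * pderiv i F' (y + t • v)) t := by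
    intro F' hF' t ht
    have e := (differentiableAt_of_contDiffOn hU hF' (hseg t ht)).hasFDerivAt.comp_hasDerivAt t
      (((hasDerivAt_id t).smul_const v).const_add y)
    rw [one_smul, fderiv_apply_eq_sum_pderiv] at e
    exact e
  -- The 1-jet of `F` along the segment from `y` to `z`; the system makes its derivative a linear
  -- function of itself.
  let u : ℝ → ℝ × (Fin n → ℝ) := fun t => (F (y + t • v), fun j => pderiv j F (y + t • v))
  let u' : ℝ → ℝ × (Fin n → ℝ) := fun t => (∑ i, v i * pderiv i F (y + t • v),
    fun j => ∑ i, v i * pderiv i (pderiv j F) (y + t • v))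
  have hu : ∀ t ∈ Icc (0 : ℝ) 1, HasDerivAt u (u' t) t := fun t ht =>
    (hd hF t ht).prodMk (hasDerivAt_pi.2 fun j => hd (contDiffOn_pderiv hU hF j) t ht)
  -- A continuous bound for `‖u'‖ / ‖u‖`: the `1` serves the component `F`, and the sum over `j`
  -- dominates each component `∂_j F` in the sup norm.
  let c : ℝ → ℝ := fun t => ∑ i, |v i| * (1 + ∑ j, (∑ k, |A k i j (y + t • v)|
    + |q i j (y + t • v)|))
  have hc : ContinuousOn c (Icc 0 1) := by
    have m : MapsTo (fun t : ℝ => y + t • v) (Icc 0 1) U := hseg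
    have cA := fun k i j => ((hA k i j).comp hcs.continuousOn m).abs
    have cq := fun i j => ((hq i j).comp hcs.continuousOn m).abs
    exact continuousOn_finsetSum _ fun i _ => continuousOn_const.mul (continuousOn_const.add
      (continuousOn_finsetSum _ fun j _ => (continuousOn_finsetSum _ fun k _ => cA k i j).add
        (cq i j)))
  obtain ⟨K, hK⟩ := isCompact_Icc.exists_bound_of_continuousOn hc
  have bound : ∀ t ∈ Icc (0 : ℝ) 1, ‖u' t‖ ≤ K * ‖u t‖ := by
    intro t ht
    have hcK : c t ≤ K := (le_abs_self _).trans (hK t ht)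
    refine le_trans ?_ (mul_le_mul_of_nonneg_right hcK (norm_nonneg _))
    have n1 : |F (y + t • v)| ≤ ‖u t‖ := norm_fst_le (u t)
    have n2 : ∀ j, |pderiv j F (y + t • v)| ≤ ‖u t‖ := fun j =>
      (norm_le_pi_norm (u t).2 j).trans (norm_snd_le (u t))
    have hN := norm_nonneg (u t)
    have pos : ∀ i j, 0 ≤ ∑ k, |A k i j (y + t • v)| + |q i j (y + t • v)| := fun i j => by
      positivity
    rw [Prod.norm_def]
    refine max_le ?_ ((pi_norm_le_iff_of_nonneg (mul_nonneg (by positivity) hN)).2 fun j => ?_)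
    · change |∑ i, v i * pderiv i F (y + t • v)| ≤ _
      refine (Finset.abs_sum_le_sum_abs _ _).trans ?_
      simp only [c, Finset.sum_mul]
      refine Finset.sum_le_sum fun i _ => ?_
      rw [abs_mul, mul_assoc]
      refine mul_le_mul_of_nonneg_left ((n2 i).trans ?_) (abs_nonneg _)
      nlinarith [Finset.sum_nonneg fun j (_ : j ∈ Finset.univ) => pos i j]
    · change |∑ i, v i * pderiv i (pderiv j F) (y + t • v)| ≤ _
      refine (Finset.abs_sum_le_sum_abs _ _).trans ?_
      simp only [c, Finset.sum_mul]
      refine Finset.sum_le_sum fun i _ => ?_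
      rw [abs_mul, mul_assoc]
      refine mul_le_mul_of_nonneg_left ?_ (abs_nonneg _)
      rw [heq _ (hseg t ht)]
      have b1 : |∑ k, A k i j (y + t • v) * pderiv k F (y + t • v)
          + q i j (y + t • v) * F (y + t • v)| ≤
          (∑ k, |A k i j (y + t • v)| + |q i j (y + t • v)|) * ‖u t‖ := by
        rw [add_mul, Finset.sum_mul]
        refine (abs_add_le _ _).trans (add_le_add ((Finset.abs_sum_le_sum_abs _ _).trans
          (Finset.sum_le_sum fun k _ => ?_)) ?_)
        · rw [abs_mul]
          exact mul_le_mul_of_nonneg_left (n2 k) (abs_nonneg _)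
        · rw [abs_mul]
          exact mul_le_mul_of_nonneg_left n1 (abs_nonneg _)
      have b2 := Finset.single_le_sum (fun j _ => pos i j) (Finset.mem_univ j)
      exact b1.trans (mul_le_mul_of_nonneg_right (b2.trans (by linarith)) hN)
  have fin := eq_zero_of_abs_deriv_le_mul_abs_self_of_eq_zero_right
    (fun t ht => (hu t ht).continuousAt.continuousWithinAt)
    (fun t ht => (hu t ⟨ht.1, ht.2.le⟩).hasDerivWithinAt)
    (by ext <;> simp [u, h₀, h₁]) (fun t ht => bound t ⟨ht.1, ht.2.le⟩) 1 (by simp)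
  simpa [u, hv] using congrArg Prod.fst fin

/-! ### Integration by parts -/

namespace IsMetricOn

variable {G : EuclideanSpace ℝ (Fin n) → Matrix (Fin n) (Fin n) ℝ}
  {φ : EuclideanSpace ℝ (Fin n) → ℝ}

theorem contDiffOn_sqrt_det (h : IsMetricOn U G) : ContDiffOn ℝ ∞ (fun y => √(G y).det) U :=
  h.contDiffOn_det.sqrt fun _ hy => (h.det_pos hy).ne'

/-- The fluxes `W i` turn this into Euclidean integration by parts of each `φ ∂_i W_i`. Nothing is
known of `F` and `G` outside `U`, so every integrand must carry `φ` or `∂_i φ` as a factor. -/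
theorem integral_mul_laplacian (h : IsMetricOn U G) (hF : ContDiffOn ℝ ∞ F U)
    (hφ : ContDiffOn ℝ ∞ φ U) (hc : HasCompactSupport φ) (hs : tsupport φ ⊆ U) :
    ∫ y, φ y * laplacian G F y * √(G y).det =
      ∫ y, (∑ i, ∑ j, (G y)⁻¹ i j * pderiv i φ y * pderiv j F y) * √(G y).det := by
  have hU := h.isOpen
  let W : Fin n → EuclideanSpace ℝ (Fin n) → ℝ := fun i z =>
    √(G z).det * ∑ j, (G z)⁻¹ i j * pderiv j F z
  have hW : ∀ i, ContDiffOn ℝ ∞ (W i) U := fun i => h.contDiffOn_sqrt_det.mul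
    (ContDiffOn.sum fun j _ => (h.contDiffOn_inv i j).mul (contDiffOn_pderiv hU hF j))
  have zφ : ∀ y, y ∉ U → φ y = 0 := fun y hy => image_eq_zero_of_notMem_tsupport fun m => hy (hs m)
  have zd : ∀ i, Function.support (pderiv i φ) ⊆ tsupport φ := by
    intro i y hy
    by_contra hn
    apply hy
    rw [pderiv_congr i (notMem_tsupport_iff_eventuallyEq.1 hn)]
    exact pderiv_const i 0 y
  have intg : ∀ a : EuclideanSpace ℝ (Fin n) → ℝ, ContinuousOn a U →
      Function.support a ⊆ tsupport φ → Integrable a := by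
    intro a ha hsa
    have ht : tsupport a ⊆ tsupport φ := closure_minimal hsa (isClosed_tsupport _)
    refine (ha.continuous_of_tsupport_subset hU (ht.trans hs)).integrable_of_hasCompactSupport ?_
    exact hc.of_isClosed_subset (isClosed_tsupport _) ht
  have i1 : ∀ i, Integrable fun y => pderiv i φ y * W i y := fun i =>
    intg _ ((contDiffOn_pderiv hU hφ i).continuousOn.mul (hW i).continuousOn)
      ((Function.support_mul_subset_left _ _).trans (zd i))
  have i2 : ∀ i, Integrable fun y => φ y * pderiv i (W i) y := fun i =>
    intg _ (hφ.continuousOn.mul (contDiffOn_pderiv hU (hW i) i).continuousOn)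
      ((Function.support_mul_subset_left _ _).trans (subset_tsupport _))
  have i3 : ∀ i, Integrable fun y => φ y * W i y := fun i =>
    intg _ (hφ.continuousOn.mul (hW i).continuousOn)
      ((Function.support_mul_subset_left _ _).trans (subset_tsupport _))
  have dφ : ∀ y, DifferentiableAt ℝ φ y := by
    intro y
    by_cases hy : y ∈ tsupport φ
    · exact differentiableAt_of_contDiffOn hU hφ (hs hy)
    · exact (differentiableAt_const (0 : ℝ)).congr_of_eventuallyEq
        (notMem_tsupport_iff_eventuallyEq.1 hy)
  have parts : ∀ i, ∫ y, φ y * pderiv i (W i) y = -∫ y, pderiv i φ y * W i y := fun i =>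
    integral_mul_fderiv_eq_neg_fderiv_mul_of_integrable (i1 i) (i2 i) (i3 i)
      (fun y _ => dφ y) fun y hy => differentiableAt_of_contDiffOn hU (hW i) (hs hy)
  have e1 : (fun y => φ y * laplacian G F y * √(G y).det) =
      fun y => -∑ i, φ y * pderiv i (W i) y := by
    funext y
    by_cases hy : y ∈ U
    · rw [← Finset.mul_sum, h.sum_pderiv_flux hF hy]
      ring
    · simp [zφ y hy]
  have e2 : (fun y => (∑ i, ∑ j, (G y)⁻¹ i j * pderiv i φ y * pderiv j F y) * √(G y).det) =
      fun y => ∑ i, pderiv i φ y * W i y := by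
    funext y
    simp only [Finset.sum_mul, W, Finset.mul_sum]
    refine Finset.sum_congr rfl fun i _ => Finset.sum_congr rfl fun j _ => ?_
    ring
  rw [e1, e2, integral_neg, integral_finsetSum _ fun i _ => i2 i,
    integral_finsetSum _ fun i _ => i1 i, ← Finset.sum_neg_distrib]
  exact Finset.sum_congr rfl fun i _ => by rw [parts, neg_neg]

end IsMetricOn

end Coordinates

end Riem

namespace Riem

set_option linter.unusedSectionVars false

variable {n : ℕ} {M : Type*} [TopologicalSpace M] [ChartedSpace (EuclideanSpace ℝ (Fin n)) M]
  [IsManifold (𝓡 n) ∞ M]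
  {e e' : OpenPartialHomeomorph M (EuclideanSpace ℝ (Fin n))} {y : EuclideanSpace ℝ (Fin n)}

/-! ### Charts and coordinate frames -/

theorem mdifferentiableAt_chart_symm (he : e ∈ IsManifold.maximalAtlas (𝓡 n) ∞ M)
    (hy : y ∈ e.target) : MDifferentiableAt (𝓡 n) (𝓡 n) e.symm y :=
  (contMDiffAt_symm_of_mem_maximalAtlas he hy).mdifferentiableAt (by simp)

theorem mdifferentiableAt_chart (he : e ∈ IsManifold.maximalAtlas (𝓡 n) ∞ M) {p : M}
    (hp : p ∈ e.source) : MDifferentiableAt (𝓡 n) (𝓡 n) e p :=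
  (contMDiffAt_of_mem_maximalAtlas he hp).mdifferentiableAt (by simp)

/-- The differential of the inverse of the chart `e` at `y`, on the model space. -/
def chartFrame (e : OpenPartialHomeomorph M (EuclideanSpace ℝ (Fin n)))
    (y : EuclideanSpace ℝ (Fin n)) : EuclideanSpace ℝ (Fin n) →L[ℝ] EuclideanSpace ℝ (Fin n) :=
  mfderiv (𝓡 n) (𝓡 n) e.symm y

/-- The differential of the chart `e` at `p`, on the model space. -/
def chartCoframe (e : OpenPartialHomeomorph M (EuclideanSpace ℝ (Fin n))) (p : M) :
    EuclideanSpace ℝ (Fin n) →L[ℝ] EuclideanSpace ℝ (Fin n) :=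
  mfderiv (𝓡 n) (𝓡 n) e p

theorem chartCoframe_chartFrame (he : e ∈ IsManifold.maximalAtlas (𝓡 n) ∞ M)
    (hy : y ∈ e.target) (v : EuclideanSpace ℝ (Fin n)) :
    chartCoframe e (e.symm y) (chartFrame e y v) = v := by
  have h1 := mfderiv_comp_apply (I := 𝓡 n) (I' := 𝓡 n) (I'' := 𝓡 n) y
    (mdifferentiableAt_chart he (e.map_target hy)) (mdifferentiableAt_chart_symm he hy) v
  have h2 : (e ∘ e.symm) =ᶠ[𝓝 y] id :=
    eventually_of_mem (e.open_target.mem_nhds hy) fun z hz => e.right_inv hz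
  rw [h2.mfderiv_eq, mfderiv_id] at h1
  exact h1.symm

theorem chartFrame_injective (he : e ∈ IsManifold.maximalAtlas (𝓡 n) ∞ M)
    (hy : y ∈ e.target) : Function.Injective (chartFrame e y) :=
  Function.LeftInverse.injective (chartCoframe_chartFrame he hy)

theorem chartFrame_surjective (he : e ∈ IsManifold.maximalAtlas (𝓡 n) ∞ M)
    (hy : y ∈ e.target) : Function.Surjective (chartFrame e y) :=
  LinearMap.injective_iff_surjective (f := (chartFrame e y).toLinearMap) |>.1
    (chartFrame_injective he hy)

theorem eq_sum_single (v : EuclideanSpace ℝ (Fin n)) :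
    v = ∑ i, v i • EuclideanSpace.single i (1 : ℝ) := by
  simpa using ((EuclideanSpace.basisFun (Fin n) ℝ).sum_repr v).symm

/-- The differentials of two charts are related by the differential of the transition map. -/
theorem chartFrame_transition (he : e ∈ IsManifold.maximalAtlas (𝓡 n) ∞ M)
    (he' : e' ∈ IsManifold.maximalAtlas (𝓡 n) ∞ M) (hy : y ∈ e.target)
    (hy' : e.symm y ∈ e'.source) (v : EuclideanSpace ℝ (Fin n)) :
    chartFrame e y v = chartFrame e' (e' (e.symm y)) (fderiv ℝ (e' ∘ e.symm) y v) := by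
  have h0 : MDifferentiableAt (𝓡 n) (𝓡 n) (e' ∘ e.symm) y :=
    (mdifferentiableAt_chart he' hy').comp y (mdifferentiableAt_chart_symm he hy)
  have h1 := mfderiv_comp_apply (I := 𝓡 n) (I' := 𝓡 n) (I'' := 𝓡 n) y
    (mdifferentiableAt_chart_symm he' (e'.map_source hy')) h0 v
  have h2 : (e'.symm ∘ e' ∘ e.symm) =ᶠ[𝓝 y] e.symm := by
    have hc := e.continuousAt_symm hy
    filter_upwards [hc.preimage_mem_nhds (e'.open_source.mem_nhds hy')] with z hz
    exact e'.left_inv hz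
  rw [h2.mfderiv_eq] at h1
  rw [mfderiv_eq_fderiv] at h1
  exact h1

theorem contDiffOn_comp_chart_symm (he : e ∈ IsManifold.maximalAtlas (𝓡 n) ∞ M) {f : M → ℝ}
    (hf : ContMDiff (𝓡 n) 𝓘(ℝ, ℝ) ∞ f) : ContDiffOn ℝ ∞ (f ∘ e.symm) e.target :=
  contMDiffOn_iff_contDiffOn.1 (hf.comp_contMDiffOn (contMDiffOn_symm_of_mem_maximalAtlas he))

theorem contDiffOn_chart_transition (he : e ∈ IsManifold.maximalAtlas (𝓡 n) ∞ M)
    (he' : e' ∈ IsManifold.maximalAtlas (𝓡 n) ∞ M) :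
    ContDiffOn ℝ ∞ (e' ∘ e.symm) (e.target ∩ e.symm ⁻¹' e'.source) :=
  contMDiffOn_iff_contDiffOn.1 ((contMDiffOn_of_mem_maximalAtlas he').comp
    ((contMDiffOn_symm_of_mem_maximalAtlas he).mono inter_subset_left) inter_subset_right)

theorem isOpen_chart_transition_source :
    IsOpen (e.target ∩ e.symm ⁻¹' e'.source) :=
  e.symm.isOpen_inter_preimage e'.open_source

/-! ### Metrics and gradients in charts -/

variable (g : ContMDiffRiemannianMetric (𝓡 n) ∞ (EuclideanSpace ℝ (Fin n))
      (fun x : M => TangentSpace (𝓡 n) x))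

/-- The metric at `p`, on the model space. -/
def metricForm (p : M) :
    EuclideanSpace ℝ (Fin n) →L[ℝ] EuclideanSpace ℝ (Fin n) →L[ℝ] ℝ :=
  g.inner p

theorem coeff_apply (i j : Fin n) : coeff g e y i j = metricForm g (e.symm y)
    (chartFrame e y (EuclideanSpace.single i 1)) (chartFrame e y (EuclideanSpace.single j 1)) :=
  rfl

theorem metricForm_chartFrame (v w : EuclideanSpace ℝ (Fin n)) :
    metricForm g (e.symm y) (chartFrame e y v) (chartFrame e y w) =
      ∑ i, ∑ j, v i * w j * coeff g e y i j := by
  conv_lhs => rw [eq_sum_single v, eq_sum_single w]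
  simp only [map_sum, map_smul, coeff_apply, sum_apply,
    smul_apply, smul_eq_mul, Finset.mul_sum, mul_assoc]
  rw [Finset.sum_comm]
  refine Finset.sum_congr rfl fun i _ => Finset.sum_congr rfl fun j _ => ?_
  ring

/-- The coordinate vector fields are smooth, being the tangent map of `e.symm` applied to constant
sections; pairing them by the smooth section `g` of the bundle of bilinear forms keeps smoothness.
-/
theorem contDiffOn_coeff (he : e ∈ IsManifold.maximalAtlas (𝓡 n) ∞ M) (i j : Fin n) :
    ContDiffOn ℝ ∞ (fun y => coeff g e y i j) e.target := by
  have hs : ∀ i : Fin n, ContMDiffOn (𝓡 n) ((𝓡 n).prod 𝓘(ℝ, EuclideanSpace ℝ (Fin n))) ∞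
      (fun y => TotalSpace.mk' (EuclideanSpace ℝ (Fin n)) (E := fun x : M => TangentSpace (𝓡 n) x)
        (e.symm y) (mfderiv (𝓡 n) (𝓡 n) e.symm y (EuclideanSpace.single i (1 : ℝ))))
      e.target := by
    intro i
    have h1 := (contMDiffOn_symm_of_mem_maximalAtlas he).contMDiffOn_tangentMapWithin
      (m := ∞) (by simp) e.open_target.uniqueMDiffOn
    have h2 : ContMDiffOn (𝓡 n) ((𝓡 n).prod 𝓘(ℝ, EuclideanSpace ℝ (Fin n))) ∞
        (fun y : EuclideanSpace ℝ (Fin n) => TotalSpace.mk' (EuclideanSpace ℝ (Fin n))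
          (E := fun x : EuclideanSpace ℝ (Fin n) => TangentSpace (𝓡 n) x)
          y (EuclideanSpace.single i (1 : ℝ))) e.target :=
      contMDiffOn_vectorSpace_iff_contDiffOn.2 contDiffOn_const
    refine (h1.comp h2 fun y hy => hy).congr fun y hy => ?_
    exact (tangentMapWithin_eq_tangentMap (p := ⟨y, EuclideanSpace.single i (1 : ℝ)⟩)
      (e.open_target.uniqueMDiffWithinAt hy) (mdifferentiableAt_chart_symm he hy)).symm
  have hg : ContMDiffOn (𝓡 n) ((𝓡 n).prod 𝓘(ℝ, EuclideanSpace ℝ (Fin n) →L[ℝ]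
      EuclideanSpace ℝ (Fin n) →L[ℝ] ℝ)) ∞
      (fun y => TotalSpace.mk' (EuclideanSpace ℝ (Fin n) →L[ℝ] EuclideanSpace ℝ (Fin n) →L[ℝ] ℝ)
        (E := fun x : M => TangentSpace (𝓡 n) x →L[ℝ] TangentSpace (𝓡 n) x →L[ℝ] ℝ)
        (e.symm y) (g.inner (e.symm y))) e.target :=
    g.contMDiff.comp_contMDiffOn (contMDiffOn_symm_of_mem_maximalAtlas he)
  have h3 := ContMDiffOn.clm_bundle_apply₂ (E₃ := fun _ : M => ℝ) (F₃ := ℝ) hg (hs i) (hs j)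
  intro y hy
  have h4 := h3 y hy
  rw [Bundle.contMDiffWithinAt_totalSpace] at h4
  exact h4.2.contDiffWithinAt

theorem isMetricOn_coeff (he : e ∈ IsManifold.maximalAtlas (𝓡 n) ∞ M) :
    IsMetricOn e.target (coeff g e) where
  isOpen := e.open_target
  smooth := contDiffOn_coeff g he
  posDef y hy := by
    refine Matrix.PosDef.of_dotProduct_mulVec_pos ?_ fun x hx => ?_
    · ext i j
      exact g.symm _ _ _
    · have hx' : chartFrame e y (WithLp.toLp 2 x) ≠ 0 := by
        intro h0
        apply hx
        have := chartFrame_injective he hy (h0.trans (map_zero _).symm)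
        exact congrArg WithLp.ofLp this
      have h1 : 0 < metricForm g (e.symm y) (chartFrame e y (WithLp.toLp 2 x))
        (chartFrame e y (WithLp.toLp 2 x)) := g.pos _ _ hx'
      rw [metricForm_chartFrame] at h1
      refine h1.trans_eq ?_
      simp only [dotProduct, Matrix.mulVec, Finset.mul_sum, star_trivial]
      refine Finset.sum_congr rfl fun i _ => Finset.sum_congr rfl fun j _ => ?_
      ring

/-- The transformation law of the metric under a change of coordinates. -/
theorem coeff_transition (he : e ∈ IsManifold.maximalAtlas (𝓡 n) ∞ M)
    (he' : e' ∈ IsManifold.maximalAtlas (𝓡 n) ∞ M) (hy : y ∈ e.target)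
    (hy' : e.symm y ∈ e'.source) (i j : Fin n) :
    coeff g e y i j = ∑ a, ∑ b, fderiv ℝ (e' ∘ e.symm) y (EuclideanSpace.single i 1) a *
      fderiv ℝ (e' ∘ e.symm) y (EuclideanSpace.single j 1) b *
      coeff g e' (e' (e.symm y)) a b := by
  rw [← metricForm_chartFrame, ← chartFrame_transition he he' hy hy',
    ← chartFrame_transition he he' hy hy', e'.left_inv hy', coeff_apply]

/-- The differential of `f` at `p`, on the model space. -/
def differential (f : M → ℝ) (p : M) : EuclideanSpace ℝ (Fin n) →L[ℝ] ℝ :=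
  mvfderiv (𝓡 n) f p

theorem differential_chartFrame (he : e ∈ IsManifold.maximalAtlas (𝓡 n) ∞ M) (hy : y ∈ e.target)
    {f : M → ℝ} (hf : ContMDiff (𝓡 n) 𝓘(ℝ, ℝ) ∞ f) (v : EuclideanSpace ℝ (Fin n)) :
    differential f (e.symm y) (chartFrame e y v) = fderiv ℝ (f ∘ e.symm) y v := by
  have h := mvfderiv_comp_apply (I := 𝓡 n) (I' := 𝓡 n) y
    (hf.mdifferentiableAt (x := e.symm y) (by simp)) (mdifferentiableAt_chart_symm he hy) v
  unfold mvfderiv at h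
  rw [mfderiv_eq_fderiv] at h
  exact h.symm

/-- The gradient of `f` at `p`, in the model space. -/
def gradientVector (f : M → ℝ) (p : M) : EuclideanSpace ℝ (Fin n) :=
  gradient g f p

theorem metricForm_gradientVector (f : M → ℝ) (p : M) (v : EuclideanSpace ℝ (Fin n)) :
    metricForm g p (gradientVector g f p) v = differential f p v :=
  LinearMap.BilinForm.apply_toDual_symm_apply (B := innerForm g p)
    (hB := innerForm_nondegenerate g p) (mvfderiv (𝓡 n) f p).toLinearMap v

theorem eq_gradientVector {f : M → ℝ} {p : M} {w : EuclideanSpace ℝ (Fin n)}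
    (h : ∀ v, metricForm g p w v = differential f p v) : w = gradientVector g f p := by
  by_contra hne
  have h1 : 0 < metricForm g p (w - gradientVector g f p) (w - gradientVector g f p) :=
    g.pos p _ (sub_ne_zero.2 hne)
  have h2 : metricForm g p (w - gradientVector g f p) (w - gradientVector g f p) = 0 := by
    rw [map_sub (metricForm g p), sub_apply, h, metricForm_gradientVector,
      sub_self]
  exact h1.ne' h2

/-- By nondegeneracy it is enough to pair with vectors of the coordinate frame, where `G G⁻¹ = 1`
gives back the components of `df`. -/
theorem gradientVector_chart (he : e ∈ IsManifold.maximalAtlas (𝓡 n) ∞ M) (hy : y ∈ e.target)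
    {f : M → ℝ} (hf : ContMDiff (𝓡 n) 𝓘(ℝ, ℝ) ∞ f) :
    gradientVector g f (e.symm y) = chartFrame e y
      (WithLp.toLp 2 fun i => ∑ j, (coeff g e y)⁻¹ i j * pderiv j (f ∘ e.symm) y) := by
  refine (eq_gradientVector g fun v => ?_).symm
  obtain ⟨w, rfl⟩ := chartFrame_surjective he hy v
  have hm := isMetricOn_coeff g he
  rw [metricForm_chartFrame, differential_chartFrame he hy hf, fderiv_apply_eq_sum_pderiv,
    Finset.sum_comm]
  refine Finset.sum_congr rfl fun k _ => ?_
  have e1 := congrFun (congrArg (fun X => Matrix.mulVec X fun j => pderiv j (f ∘ e.symm) y)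
    (Matrix.mul_nonsing_inv (coeff g e y) (hm.isUnit_det hy))) k
  simp only [← Matrix.mulVec_mulVec, Matrix.one_mulVec] at e1
  rw [← e1]
  simp only [Matrix.mulVec, dotProduct, Finset.mul_sum, Finset.sum_mul]
  refine Finset.sum_congr rfl fun i _ => Finset.sum_congr rfl fun j _ => ?_
  rw [hm.symm hy k i]
  ring

/-- The inner product `⟨∇φ, ∇f⟩`. -/
def gradientInner (φ f : M → ℝ) (p : M) : ℝ :=
  differential φ p (gradientVector g f p)

/-- `⟨∇φ, ∇f⟩ = g^{ij} ∂_i φ ∂_j f` in every chart. -/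
theorem gradientInner_chart (he : e ∈ IsManifold.maximalAtlas (𝓡 n) ∞ M)
    (hy : y ∈ e.target) {φ f : M → ℝ} (hφ : ContMDiff (𝓡 n) 𝓘(ℝ, ℝ) ∞ φ)
    (hf : ContMDiff (𝓡 n) 𝓘(ℝ, ℝ) ∞ f) :
    gradientInner g φ f (e.symm y) =
      ∑ i, ∑ j, (coeff g e y)⁻¹ i j * pderiv i (φ ∘ e.symm) y * pderiv j (f ∘ e.symm) y := by
  unfold gradientInner
  rw [gradientVector_chart g he hy hf, differential_chartFrame he hy hφ,
    fderiv_apply_eq_sum_pderiv]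
  simp only [Finset.sum_mul]
  refine Finset.sum_congr rfl fun i _ => Finset.sum_congr rfl fun j _ => ?_
  ring

theorem gradientNorm_eq (f : M → ℝ) (p : M) :
    gradientNorm g f p = √(gradientInner g f f p) := by
  unfold gradientInner
  rw [← metricForm_gradientVector]
  rfl

theorem gradientInner_self_nonneg (f : M → ℝ) (p : M) : 0 ≤ gradientInner g f f p := by
  unfold gradientInner
  rw [← metricForm_gradientVector]
  by_cases h : gradientVector g f p = 0
  · simp [h]
  · exact (g.pos p _ h).le

theorem differential_eq_zero_of_gradientInner_self {f : M → ℝ} {p : M}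
    (h : gradientInner g f f p = 0) : differential (n := n) f p = 0 := by
  have h0 : gradientVector g f p = 0 := by
    by_contra hne
    unfold gradientInner at h
    rw [← metricForm_gradientVector] at h
    exact (g.pos p _ hne).ne' h
  ext v
  rw [← metricForm_gradientVector g, h0]
  simp

end Riem

namespace Riem

set_option linter.unusedSectionVars false

variable {n : ℕ} {M : Type*} [TopologicalSpace M] [ChartedSpace (EuclideanSpace ℝ (Fin n)) M]
  [IsManifold (𝓡 n) ∞ M] [MeasurableSpace M] [BorelSpace M]
  {e e' : OpenPartialHomeomorph M (EuclideanSpace ℝ (Fin n))} {y : EuclideanSpace ℝ (Fin n)}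

variable (g : ContMDiffRiemannianMetric (𝓡 n) ∞ (EuclideanSpace ℝ (Fin n))
      (fun x : M => TangentSpace (𝓡 n) x))

/-! ### The Riemannian measure in a chart -/

theorem aemeasurable_chart_symm (e : OpenPartialHomeomorph M (EuclideanSpace ℝ (Fin n))) :
    AEMeasurable e.symm ((volume : Measure (EuclideanSpace ℝ (Fin n))).restrict e.target) :=
  e.continuousOn_symm.aemeasurable e.open_target.measurableSet

theorem aemeasurable_chart_symm_withDensity
    (e : OpenPartialHomeomorph M (EuclideanSpace ℝ (Fin n)))
    (D : EuclideanSpace ℝ (Fin n) → ENNReal) :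
    AEMeasurable e.symm (((volume : Measure (EuclideanSpace ℝ (Fin n))).restrict
      e.target).withDensity D) :=
  (aemeasurable_chart_symm e).mono_ac (withDensity_absolutelyContinuous _ _)

theorem chartVolume_apply (e : OpenPartialHomeomorph M (EuclideanSpace ℝ (Fin n))) {B : Set M}
    (hB : MeasurableSet B) : chartVolume g e B =
      ∫⁻ y in e.target ∩ e.symm ⁻¹' B, ENNReal.ofReal √(coeff g e y).det := by
  unfold chartVolume
  rw [Measure.map_apply_of_aemeasurable (aemeasurable_chart_symm_withDensity e _) hB,
    withDensity_apply' _ _, Measure.restrict_restrict' e.open_target.measurableSet, inter_comm]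

theorem measurableSet_chart_preimage (e : OpenPartialHomeomorph M (EuclideanSpace ℝ (Fin n)))
    {B : Set M} (hB : MeasurableSet B) : MeasurableSet (e.target ∩ e.symm ⁻¹' B) := by
  have h1 : Measurable (e.target.domRestrict e.symm) :=
    (continuousOn_iff_continuous_domRestrict.1 e.continuousOn_symm).measurable
  have h2 := e.open_target.measurableSet.subtype_image (h1 hB)
  convert h2 using 1
  ext z
  simp [and_comm]

/-- Determinants in the transformation law `G = Jᵀ G' J`, with `J` the Jacobian matrix of the
transition map. -/
theorem det_coeff_transition (he : e ∈ IsManifold.maximalAtlas (𝓡 n) ∞ M)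
    (he' : e' ∈ IsManifold.maximalAtlas (𝓡 n) ∞ M) (hy : y ∈ e.target)
    (hy' : e.symm y ∈ e'.source) :
    √(coeff g e y).det = |(fderiv ℝ (e' ∘ e.symm) y).det| *
      √(coeff g e' (e' (e.symm y))).det := by
  let b := (EuclideanSpace.basisFun (Fin n) ℝ).toBasis
  let J := LinearMap.toMatrix b b (fderiv ℝ (e' ∘ e.symm) y).toLinearMap
  have hJ : J.det = (fderiv ℝ (e' ∘ e.symm) y).det := LinearMap.det_toMatrix b _
  have hJa : ∀ a i, J a i = fderiv ℝ (e' ∘ e.symm) y (EuclideanSpace.single i 1) a := by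
    intro a i
    simp [J, b, LinearMap.toMatrix_apply]
  have h : coeff g e y = J.transpose * coeff g e' (e' (e.symm y)) * J := by
    ext i j
    rw [coeff_transition g he he' hy hy', Finset.sum_comm]
    simp only [Matrix.mul_apply, Matrix.transpose_apply, Finset.sum_mul, hJa]
    refine Finset.sum_congr rfl fun a _ => Finset.sum_congr rfl fun c _ => ?_
    ring
  rw [h, Matrix.det_mul, Matrix.det_mul, Matrix.det_transpose, hJ, mul_right_comm, ← sq,
    Real.sqrt_mul (sq_nonneg _), Real.sqrt_sq_eq_abs]

/-- Change of variables under the transition map: its Jacobian is exactly the ratio of the two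
densities. One inequality suffices to control a supremum of measures. -/
theorem chartVolume_inter_source_le (he : e ∈ IsManifold.maximalAtlas (𝓡 n) ∞ M)
    (he' : e' ∈ IsManifold.maximalAtlas (𝓡 n) ∞ M) {B : Set M} (hB : MeasurableSet B) :
    chartVolume g e (B ∩ e'.source) ≤ chartVolume g e' B := by
  have hB' := hB.inter e'.open_source.measurableSet
  rw [chartVolume_apply g e hB', chartVolume_apply g e' hB]
  set S := e.target ∩ e.symm ⁻¹' (B ∩ e'.source) with hS
  have hSm : MeasurableSet S := measurableSet_chart_preimage e hB'
  have hopen := isOpen_chart_transition_source (e := e) (e' := e')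
  have hd : ∀ z ∈ S, HasFDerivWithinAt (e' ∘ e.symm) (fderiv ℝ (e' ∘ e.symm) z) S z := by
    intro z hz
    exact (((contDiffOn_chart_transition he he').contDiffAt
      (hopen.mem_nhds ⟨hz.1, hz.2.2⟩)).differentiableAt (by simp)).hasFDerivAt.hasFDerivWithinAt
  have hi : InjOn (e' ∘ e.symm) S := fun a ha c hc hac =>
    e.symm.injOn ha.1 hc.1 (e'.injOn ha.2.2 hc.2.2 hac)
  calc ∫⁻ z in S, ENNReal.ofReal √(coeff g e z).det
      = ∫⁻ z in S, ENNReal.ofReal |(fderiv ℝ (e' ∘ e.symm) z).det| *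
          ENNReal.ofReal √(coeff g e' ((e' ∘ e.symm) z)).det := by
        refine setLIntegral_congr_fun hSm fun z hz => ?_
        simp only [Function.comp_apply]
        rw [det_coeff_transition g he he' hz.1 hz.2.2, ENNReal.ofReal_mul (abs_nonneg _)]
    _ = ∫⁻ z in (e' ∘ e.symm) '' S, ENNReal.ofReal √(coeff g e' z).det :=
        (lintegral_image_eq_lintegral_abs_det_fderiv_mul volume hSm hd hi
          fun z => ENNReal.ofReal √(coeff g e' z).det).symm
    _ ≤ ∫⁻ z in e'.target ∩ e'.symm ⁻¹' B, ENNReal.ofReal √(coeff g e' z).det := by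
        refine lintegral_mono_set ?_
        rintro _ ⟨z, hz, rfl⟩
        refine ⟨e'.map_source hz.2.2, ?_⟩
        simp only [Function.comp_apply, mem_preimage]
        rw [e'.left_inv hz.2.2]
        exact hz.2.1

theorem chartVolume_compl_source (e : OpenPartialHomeomorph M (EuclideanSpace ℝ (Fin n))) :
    chartVolume g e e.sourceᶜ = 0 := by
  rw [chartVolume_apply g e e.open_source.measurableSet.compl]
  have : e.target ∩ e.symm ⁻¹' e.sourceᶜ = ∅ := by
    ext z
    simp only [mem_inter_iff, mem_preimage, mem_compl_iff, mem_empty_iff_false, iff_false, not_and,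
      not_not]
    exact fun hz => e.map_target hz
  rw [this, Measure.restrict_empty, lintegral_zero_measure]

theorem chartVolume_le_volumeMeasure (he : e ∈ IsManifold.maximalAtlas (𝓡 n) ∞ M) :
    chartVolume g e ≤ volumeMeasure g :=
  le_iSup₂ (f := fun e (_ : e ∈ IsManifold.maximalAtlas (𝓡 n) ∞ M) => chartVolume g e) e he

theorem volumeMeasure_restrict_source (he : e ∈ IsManifold.maximalAtlas (𝓡 n) ∞ M) :
    (volumeMeasure g).restrict e.source = chartVolume g e := by
  have hs := e.open_source.measurableSet
  -- The right side bounds every chart measure: off `e.source` by the supremum itself, on `e.source`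
  -- by the change of variables. Its first summand disappears on `e.source`.
  have hle : volumeMeasure g ≤ (volumeMeasure g).restrict e.sourceᶜ + chartVolume g e := by
    refine iSup₂_le fun e' he' => Measure.le_iff.2 fun B hB => ?_
    rw [← measure_inter_add_sdiff B hs, Measure.add_apply, Measure.restrict_apply hB, add_comm]
    exact add_le_add (chartVolume_le_volumeMeasure g he' _)
      (chartVolume_inter_source_le g he' he hB)
  refine le_antisymm (Measure.le_iff.2 fun B hB => ?_) (Measure.le_iff.2 fun B hB => ?_)
  · rw [Measure.restrict_apply hB]
    refine (hle _).trans ?_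
    rw [Measure.add_apply, Measure.restrict_apply (hB.inter hs), inter_assoc, inter_compl_self,
      inter_empty, measure_empty, zero_add]
    exact measure_mono inter_subset_left
  · rw [Measure.restrict_apply hB, ← measure_inter_add_sdiff B hs]
    have : chartVolume g e (B \ e.source) = 0 :=
      measure_mono_null (fun _ hz => hz.2) (chartVolume_compl_source g e)
    rw [this, add_zero]
    exact chartVolume_le_volumeMeasure g he _

/-- Integrals of functions supported in the domain of a chart. -/
theorem integral_volumeMeasure (he : e ∈ IsManifold.maximalAtlas (𝓡 n) ∞ M) {h : M → ℝ}
    (hc : Continuous h) (hs : ∀ p, p ∉ e.source → h p = 0) :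
    ∫ p, h p ∂volumeMeasure g = ∫ y in e.target, h (e.symm y) * √(coeff g e y).det := by
  rw [← setIntegral_eq_integral_of_forall_compl_eq_zero (s := e.source) hs,
    volumeMeasure_restrict_source g he]
  have hcd := ((isMetricOn_coeff g he).contDiffOn_sqrt_det.continuousOn.aemeasurable (μ := volume)
    e.open_target.measurableSet).ennreal_ofReal
  unfold chartVolume
  rw [integral_map (aemeasurable_chart_symm_withDensity e _) hc.aestronglyMeasurable,
    integral_withDensity_eq_integral_toReal_smul₀ hcd (by simp)]
  refine integral_congr_ae (ae_of_all _ fun y => ?_)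
  simp [ENNReal.toReal_ofReal (Real.sqrt_nonneg _), mul_comm]

/-- The density is continuous on a closed ball inside the target of a chart, hence integrable there.
-/
theorem isLocallyFiniteMeasure_volumeMeasure : IsLocallyFiniteMeasure (volumeMeasure g) := by
  refine ⟨fun p => ?_⟩
  let e := chartAt (EuclideanSpace ℝ (Fin n)) p
  have he : e ∈ IsManifold.maximalAtlas (𝓡 n) ∞ M := IsManifold.chart_mem_maximalAtlas p
  have hp : p ∈ e.source := mem_chart_source _ p
  obtain ⟨r, hr, hrs⟩ := Metric.nhds_basis_closedBall.mem_iff.1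
    (e.open_target.mem_nhds (e.map_source hp))
  let V := e.source ∩ e ⁻¹' Metric.ball (e p) r
  have hV : IsOpen V := e.isOpen_inter_preimage Metric.isOpen_ball
  refine ⟨V, hV.mem_nhds ⟨hp, Metric.mem_ball_self hr⟩, ?_⟩
  have h1 : volumeMeasure g V = chartVolume g e V := by
    rw [← volumeMeasure_restrict_source g he, Measure.restrict_apply hV.measurableSet,
      inter_eq_left.2 inter_subset_left]
  rw [h1, chartVolume_apply g e hV.measurableSet]
  have hsub : e.target ∩ e.symm ⁻¹' V ⊆ Metric.closedBall (e p) r := by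
    rintro z ⟨hz, -, hz'⟩
    rw [mem_preimage, e.right_inv hz] at hz'
    exact Metric.ball_subset_closedBall hz'
  refine (lintegral_mono_set hsub).trans_lt ?_
  have hi : IntegrableOn (fun y => √(coeff g e y).det) (Metric.closedBall (e p) r) :=
    ((isMetricOn_coeff g he).contDiffOn_sqrt_det.continuousOn.mono hrs).integrableOn_compact
      (isCompact_closedBall _ _)
  exact hi.lintegral_lt_top

/-- The density is positive, and a non-empty open set has a non-empty open image in a suitable
chart. -/
theorem isOpenPosMeasure_volumeMeasure : (volumeMeasure g).IsOpenPosMeasure := by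
  refine ⟨fun V hV ⟨p, hp⟩ h0 => ?_⟩
  let e := chartAt (EuclideanSpace ℝ (Fin n)) p
  have he : e ∈ IsManifold.maximalAtlas (𝓡 n) ∞ M := IsManifold.chart_mem_maximalAtlas p
  have hm := isMetricOn_coeff g he
  have h1 : chartVolume g e V = 0 :=
    le_antisymm ((chartVolume_le_volumeMeasure g he V).trans h0.le) zero_le
  have ho : IsOpen (e.target ∩ e.symm ⁻¹' V) := e.symm.isOpen_inter_preimage hV
  rw [chartVolume_apply g e hV.measurableSet, lintegral_eq_zero_iff'
    (((hm.contDiffOn_sqrt_det.continuousOn.mono inter_subset_left).aemeasurable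
      ho.measurableSet).ennreal_ofReal)] at h1
  have h2 : ∀ᵐ z ∂(volume : Measure (EuclideanSpace ℝ (Fin n))).restrict
      (e.target ∩ e.symm ⁻¹' V), False := by
    filter_upwards [h1, ae_restrict_mem ho.measurableSet] with z hz hz'
    have := Real.sqrt_pos.2 (hm.det_pos hz'.1)
    simp only [Pi.zero_apply, ENNReal.ofReal_eq_zero] at hz
    linarith
  rw [ae_iff] at h2
  simp only [not_false_eq_true, ofPred_true, Measure.restrict_apply_univ] at h2
  exact ho.measure_ne_zero volume ⟨e p, e.map_source (mem_chart_source _ p), by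
    simpa [e, e.left_inv (mem_chart_source _ p)] using hp⟩ h2

end Riem

namespace Riem

set_option linter.unusedSectionVars false

variable {n : ℕ} {M : Type*} [TopologicalSpace M] [ChartedSpace (EuclideanSpace ℝ (Fin n)) M]
  [IsManifold (𝓡 n) ∞ M]
  {e e' : OpenPartialHomeomorph M (EuclideanSpace ℝ (Fin n))} {y : EuclideanSpace ℝ (Fin n)}

variable (g : ContMDiffRiemannianMetric (𝓡 n) ∞ (EuclideanSpace ℝ (Fin n))
      (fun x : M => TangentSpace (𝓡 n) x))

/-! ### The pairing of gradients -/

theorem contDiffOn_gradientInner_chart (he : e ∈ IsManifold.maximalAtlas (𝓡 n) ∞ M)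
    {φ f : M → ℝ} (hφ : ContMDiff (𝓡 n) 𝓘(ℝ, ℝ) ∞ φ) (hf : ContMDiff (𝓡 n) 𝓘(ℝ, ℝ) ∞ f) :
    ContDiffOn ℝ ∞ (gradientInner g φ f ∘ e.symm) e.target := by
  have hm := isMetricOn_coeff g he
  have h1 : ContDiffOn ℝ ∞ (fun y => ∑ i, ∑ j,
      (coeff g e y)⁻¹ i j * pderiv i (φ ∘ e.symm) y * pderiv j (f ∘ e.symm) y) e.target :=
    ContDiffOn.sum fun i _ => ContDiffOn.sum fun j _ => ((hm.contDiffOn_inv i j).mul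
      (contDiffOn_pderiv hm.isOpen (contDiffOn_comp_chart_symm he hφ) i)).mul
      (contDiffOn_pderiv hm.isOpen (contDiffOn_comp_chart_symm he hf) j)
  exact h1.congr fun y hy => gradientInner_chart g he hy hφ hf

theorem continuousOn_of_comp_chart_symm {h : M → ℝ} (hc : ContinuousOn (h ∘ e.symm) e.target) :
    ContinuousOn h e.source :=
  (hc.comp e.continuousOn fun _ hp => e.map_source hp).congr fun p hp => by
    simp [e.left_inv hp]

theorem continuous_gradientInner {φ f : M → ℝ} (hφ : ContMDiff (𝓡 n) 𝓘(ℝ, ℝ) ∞ φ)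
    (hf : ContMDiff (𝓡 n) 𝓘(ℝ, ℝ) ∞ f) : Continuous (gradientInner g φ f) := by
  refine continuous_iff_continuousAt.2 fun p => ?_
  have he : chartAt (EuclideanSpace ℝ (Fin n)) p ∈ IsManifold.maximalAtlas (𝓡 n) ∞ M :=
    IsManifold.chart_mem_maximalAtlas p
  exact (continuousOn_of_comp_chart_symm
    (contDiffOn_gradientInner_chart g he hφ hf).continuousOn).continuousAt
    ((chartAt _ p).open_source.mem_nhds (mem_chart_source _ p))

theorem differential_congr {φ ψ : M → ℝ} {p : M} (h : φ =ᶠ[𝓝 p] ψ) :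
    differential (n := n) φ p = differential ψ p := by
  unfold differential mvfderiv
  ext v
  simp only [ContinuousLinearMap.comp_apply]
  rw [h.mfderiv_eq]
  rfl

theorem differential_const (c : ℝ) (p : M) : differential (n := n) (fun _ : M => c) p = 0 :=
  mvfderiv_const (I := 𝓡 n) c

theorem differential_add {φ ψ : M → ℝ} (hφ : ContMDiff (𝓡 n) 𝓘(ℝ, ℝ) ∞ φ)
    (hψ : ContMDiff (𝓡 n) 𝓘(ℝ, ℝ) ∞ ψ) (p : M) :
    differential (n := n) (fun q => φ q + ψ q) p = differential φ p + differential ψ p :=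
  mvfderiv_add (I := 𝓡 n) (hφ.mdifferentiableAt (by simp)) (hψ.mdifferentiableAt (by simp))

theorem gradientInner_add {φ ψ : M → ℝ} (hφ : ContMDiff (𝓡 n) 𝓘(ℝ, ℝ) ∞ φ)
    (hψ : ContMDiff (𝓡 n) 𝓘(ℝ, ℝ) ∞ ψ) (f : M → ℝ) (p : M) :
    gradientInner g (fun q => φ q + ψ q) f p = gradientInner g φ f p + gradientInner g ψ f p := by
  simp [gradientInner, differential_add hφ hψ]

theorem gradientInner_const (c : ℝ) (f : M → ℝ) (p : M) :
    gradientInner g (fun _ => c) f p = 0 := by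
  simp [gradientInner, differential_const]

theorem gradientInner_eq_zero_of_notMem {φ : M → ℝ} (f : M → ℝ) {p : M} (hp : p ∉ tsupport φ) :
    gradientInner g φ f p = 0 := by
  unfold gradientInner
  rw [differential_congr (notMem_tsupport_iff_eventuallyEq.1 hp)]
  exact gradientInner_const g 0 f p

/-! ### Integration by parts on the manifold -/

variable [T2Space M] [CompactSpace M] [MeasurableSpace M] [BorelSpace M]

theorem integrable_volumeMeasure {h : M → ℝ} (hc : Continuous h) :
    Integrable h (volumeMeasure g) :=
  have := isLocallyFiniteMeasure_volumeMeasure g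
  hc.integrable_of_hasCompactSupport (HasCompactSupport.of_compactSpace h)

/-- The weak form for a test function supported in one chart. The Laplacian enters as a function `c`
tied to the chart `e`, because its chart independence is to be deduced from this identity. -/
theorem integral_gradientInner_of_laplacian (he : e ∈ IsManifold.maximalAtlas (𝓡 n) ∞ M)
    {φ f c : M → ℝ} (hφ : ContMDiff (𝓡 n) 𝓘(ℝ, ℝ) ∞ φ) (hf : ContMDiff (𝓡 n) 𝓘(ℝ, ℝ) ∞ f)
    (hs : tsupport φ ⊆ e.source) (hc : ContinuousOn c e.source)
    (hL : ∀ y ∈ e.target, laplacian (coeff g e) (f ∘ e.symm) y = c (e.symm y)) :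
    ∫ p, gradientInner g φ f p ∂volumeMeasure g = ∫ p, φ p * c p ∂volumeMeasure g := by
  have hm := isMetricOn_coeff g he
  have hφc : Continuous fun p => φ p * c p := by
    refine (hφ.continuous.continuousOn.mul hc).continuous_of_tsupport_subset e.open_source ?_
    exact (closure_mono (Function.support_mul_subset_left _ _)).trans hs
  rw [integral_volumeMeasure g he (continuous_gradientInner g hφ hf) fun p hp =>
      gradientInner_eq_zero_of_notMem g f fun m => hp (hs m),
    integral_volumeMeasure g he hφc fun p hp => by
      rw [image_eq_zero_of_notMem_tsupport fun m => hp (hs m), zero_mul]]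
  -- Outside `e.target` the values of `e.symm` have no meaning, so `φ` is transported to coordinates
  -- and extended by zero; compactness of `tsupport φ` keeps the support of `χ` inside the target.
  let χ : EuclideanSpace ℝ (Fin n) → ℝ := e.target.indicator (φ ∘ e.symm)
  have hχ : ∀ z ∈ e.target, χ z = φ (e.symm z) := fun z hz => indicator_of_mem hz _
  have hχs : ContDiffOn ℝ ∞ χ e.target := (contDiffOn_comp_chart_symm he hφ).congr hχ
  have hK : IsCompact (e '' tsupport φ) :=
    (isClosed_tsupport φ).isCompact.image_of_continuousOn (e.continuousOn.mono hs)
  have hsup : tsupport χ ⊆ e '' tsupport φ := by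
    refine closure_minimal (fun z hz => ?_) hK.isClosed
    have hzt : z ∈ e.target := mem_of_indicator_ne_zero hz
    refine ⟨e.symm z, subset_tsupport _ ?_, e.right_inv hzt⟩
    rw [Function.mem_support, ← hχ z hzt]
    exact hz
  have hsupt : tsupport χ ⊆ e.target := hsup.trans (by
    rintro _ ⟨p, hp, rfl⟩
    exact e.map_source (hs hp))
  have key := hm.integral_mul_laplacian (contDiffOn_comp_chart_symm he hf) hχs
    (hK.of_isClosed_subset (isClosed_tsupport _) hsup) hsupt
  have hχ0 : ∀ z, z ∉ e.target → χ z = 0 := fun z hz => indicator_of_notMem hz _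
  have hχd : ∀ z, z ∉ e.target → ∀ i, pderiv i χ z = 0 := by
    intro z hz i
    rw [pderiv_congr i (notMem_tsupport_iff_eventuallyEq.1 fun m => hz (hsupt m))]
    exact pderiv_const i 0 z
  have k1 := setIntegral_eq_integral_of_forall_compl_eq_zero (μ := volume) (s := e.target)
    (f := fun z => χ z * laplacian (coeff g e) (f ∘ e.symm) z * √(coeff g e z).det)
    fun z hz => by simp [hχ0 z hz]
  have k2 := setIntegral_eq_integral_of_forall_compl_eq_zero (μ := volume) (s := e.target)
    (f := fun z => (∑ i, ∑ j, (coeff g e z)⁻¹ i j * pderiv i χ z * pderiv j (f ∘ e.symm) z) *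
      √(coeff g e z).det)
    fun z hz => by simp [hχd z hz]
  rw [← k1, ← k2] at key
  have ht := e.open_target.measurableSet
  refine Eq.trans (setIntegral_congr_fun ht fun z hz => ?_)
    (key.symm.trans (setIntegral_congr_fun ht fun z hz => ?_))
  · rw [gradientInner_chart g he hz hφ hf]
    simp only [fun i => pderiv_congr_of_isOpen e.open_target hz i hχ]
    rfl
  · rw [hχ z hz, hL z hz]

/-- A partition of unity subordinate to chart domains splits `φ` into pieces to which the one-chart
version applies; by compactness only finitely many pieces are non-zero. -/
theorem integral_gradientInner_of_eigen {f : M → ℝ} {c : ℝ}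
    (hf : ContMDiff (𝓡 n) 𝓘(ℝ, ℝ) ∞ f)
    (hL : ∀ e ∈ IsManifold.maximalAtlas (𝓡 n) ∞ M, ∀ y ∈ e.target,
      laplacian (coeff g e) (f ∘ e.symm) y = c * f (e.symm y))
    {φ : M → ℝ} (hφ : ContMDiff (𝓡 n) 𝓘(ℝ, ℝ) ∞ φ) :
    ∫ p, gradientInner g φ f p ∂volumeMeasure g = c * ∫ p, φ p * f p ∂volumeMeasure g := by
  obtain ⟨ρ, hρ⟩ := SmoothPartitionOfUnity.exists_isSubordinate_chartAt_source (𝓡 n) M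
  have hfin := ρ.locallyFinite.finite_nonempty_of_compact
  let t := hfin.toFinset
  have hsum : ∀ p, ∑ i ∈ t, ρ i p * φ p = φ p := by
    intro p
    rw [← Finset.sum_mul]
    have h1 := ρ.sum_eq_one (mem_univ p)
    rw [finsum_eq_sum_of_support_subset (s := t)] at h1
    · rw [h1, one_mul]
    · intro i hi
      simp only [t, Finite.coe_toFinset]
      exact ⟨p, hi⟩
  have hsm : ∀ i, ContMDiff (𝓡 n) 𝓘(ℝ, ℝ) ∞ fun p => ρ i p * φ p := fun i =>
    (ρ i).contMDiff.mul hφ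
  have hone : ∀ i, ∫ p, gradientInner g (fun p => ρ i p * φ p) f p ∂volumeMeasure g =
      c * ∫ p, ρ i p * φ p * f p ∂volumeMeasure g := by
    intro i
    have he : chartAt (EuclideanSpace ℝ (Fin n)) i ∈ IsManifold.maximalAtlas (𝓡 n) ∞ M :=
      IsManifold.chart_mem_maximalAtlas i
    rw [integral_gradientInner_of_laplacian g he (hsm i) hf (c := fun p => c * f p)
      ((closure_mono (Function.support_mul_subset_left _ _)).trans (hρ i))
      (continuous_const.mul hf.continuous).continuousOn (hL _ he), ← integral_const_mul]
    refine integral_congr_ae (ae_of_all _ fun p => ?_)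
    simp only
    ring
  have hind : ∀ s : Finset M, ContMDiff (𝓡 n) 𝓘(ℝ, ℝ) ∞ (fun p => ∑ i ∈ s, ρ i p * φ p) ∧
      ∫ p, gradientInner g (fun p => ∑ i ∈ s, ρ i p * φ p) f p ∂volumeMeasure g =
      c * ∫ p, (∑ i ∈ s, ρ i p * φ p) * f p ∂volumeMeasure g := by
    classical
    intro s
    induction s using Finset.induction_on with
    | empty => simp [gradientInner_const, contMDiff_const]
    | insert a s ha ih =>
      simp only [Finset.sum_insert ha]
      refine ⟨(hsm a).add ih.1, ?_⟩
      simp only [gradientInner_add g (hsm a) ih.1, add_mul]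
      rw [integral_add (integrable_volumeMeasure g (continuous_gradientInner g (hsm a) hf))
          (integrable_volumeMeasure g (continuous_gradientInner g ih.1 hf)),
        integral_add
          (integrable_volumeMeasure g ((hsm a).continuous.fun_mul hf.continuous))
          (integrable_volumeMeasure g (ih.1.continuous.fun_mul hf.continuous)), ih.2, hone]
      ring
  simpa only [hsum] using (hind t).2

end Riem

namespace Riem

set_option linter.unusedSectionVars false

variable {n : ℕ} {M : Type*} [TopologicalSpace M] [ChartedSpace (EuclideanSpace ℝ (Fin n)) M]
  [IsManifold (𝓡 n) ∞ M]
  {e e' : OpenPartialHomeomorph M (EuclideanSpace ℝ (Fin n))} {y : EuclideanSpace ℝ (Fin n)}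
  {g : ContMDiffRiemannianMetric (𝓡 n) ∞ (EuclideanSpace ℝ (Fin n))
      (fun x : M => TangentSpace (𝓡 n) x)} {f : M → ℝ}

/-! ### Static potentials -/

/-- Expresses `df = 0` as the vanishing of a real function, continuous when `f` is smooth, so that
the condition is visibly closed. -/
theorem differential_eq_zero_iff (f : M → ℝ) (p : M) :
    differential (n := n) f p = 0 ↔ gradientInner g f f p = 0 :=
  ⟨fun h => by simp [gradientInner, h], fun h => differential_eq_zero_of_gradientInner_self g h⟩

theorem differential_eq_zero_iff_pderiv (he : e ∈ IsManifold.maximalAtlas (𝓡 n) ∞ M)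
    (hy : y ∈ e.target) (hf : ContMDiff (𝓡 n) 𝓘(ℝ, ℝ) ∞ f) :
    differential (n := n) f (e.symm y) = 0 ↔ ∀ i, pderiv i (f ∘ e.symm) y = 0 := by
  constructor
  · intro h i
    unfold pderiv
    rw [← differential_chartFrame he hy hf, h]
    rfl
  · intro h
    ext v
    obtain ⟨w, rfl⟩ := chartFrame_surjective he hy v
    rw [differential_chartFrame he hy hf, fderiv_eq_zero_of_pderiv h]
    rfl

namespace IsStaticPotential

theorem laplacian_eq (h : IsStaticPotential g f) (hn : 2 ≤ n)
    (he : e ∈ IsManifold.maximalAtlas (𝓡 n) ∞ M) (hy : y ∈ e.target) :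
    laplacian (coeff g e) (f ∘ e.symm) y =
      scalar (coeff g e) y / ((n : ℝ) - 1) * f (e.symm y) := by
  have h1 := (isMetricOn_coeff g he).laplacian_of_static (F := f ∘ e.symm) hy
    (h.equation e he y hy)
  have hn' : (2 : ℝ) ≤ n := by exact_mod_cast hn
  have h2 : (n : ℝ) - 1 ≠ 0 := by linarith
  field_simp
  rw [mul_comm, h1]
  rfl

/-- The static equation solved for the Hessian. The factor `f` on the right drives unique
continuation, total geodesy and the constancy of `|∇f|` on `Z`. -/
theorem hess_eq (h : IsStaticPotential g f) (hn : 2 ≤ n)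
    (he : e ∈ IsManifold.maximalAtlas (𝓡 n) ∞ M) (hy : y ∈ e.target) (i j : Fin n) :
    hess (coeff g e) (f ∘ e.symm) i j y = (ricci (coeff g e) i j y -
      scalar (coeff g e) y / ((n : ℝ) - 1) * coeff g e y i j) * (f ∘ e.symm) y := by
  have h1 := h.equation e he y hy i j
  rw [h.laplacian_eq hn he hy] at h1
  simp only [Function.comp_apply]
  linear_combination h1

theorem continuousOn_hess_factor (g : ContMDiffRiemannianMetric (𝓡 n) ∞
      (EuclideanSpace ℝ (Fin n)) (fun x : M => TangentSpace (𝓡 n) x))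
    (he : e ∈ IsManifold.maximalAtlas (𝓡 n) ∞ M) (i j : Fin n) :
    ContinuousOn (fun z => ricci (coeff g e) i j z -
      scalar (coeff g e) z / ((n : ℝ) - 1) * coeff g e z i j) e.target := by
  have hm := isMetricOn_coeff g he
  exact (hm.contDiffOn_ricci i j).continuousOn.sub
    ((hm.contDiffOn_scalar.continuousOn.div_const _).mul (hm.smooth i j).continuousOn)

theorem eventually_eq_zero (h : IsStaticPotential g f) (hn : 2 ≤ n) {p : M} (h₀ : f p = 0)
    (h₁ : differential (n := n) f p = 0) : ∀ᶠ q in 𝓝 p, f q = 0 := by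
  let e := chartAt (EuclideanSpace ℝ (Fin n)) p
  have he : e ∈ IsManifold.maximalAtlas (𝓡 n) ∞ M := IsManifold.chart_mem_maximalAtlas p
  have hp : p ∈ e.source := mem_chart_source _ p
  have hm := isMetricOn_coeff g he
  have hy := e.map_source hp
  rw [← e.left_inv hp] at h₀ h₁
  have h2 := eventually_eq_zero_of_pderiv_pderiv_eq e.open_target
    (contDiffOn_comp_chart_symm he h.smooth)
    (fun k i j => (hm.contDiffOn_christoffel k i j).continuousOn)
    (continuousOn_hess_factor g he)
    (fun z hz i j => by rw [← h.hess_eq hn he hz]; unfold hess; ring) hy h₀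
    ((differential_eq_zero_iff_pderiv he hy h.smooth).1 h₁)
  filter_upwards [(e.continuousAt hp).eventually h2, e.open_source.mem_nhds hp] with q hq hqs
  simpa [e.left_inv hqs] using hq

variable [ConnectedSpace M]

/-- The set where `f` and `df` both vanish is closed by continuity and open by unique continuation.
If it were non-empty it would be all of `M`, against `f ≠ 0`. -/
theorem differential_ne_zero (h : IsStaticPotential g f) (hn : 2 ≤ n) {p : M} (h₀ : f p = 0) :
    differential (n := n) f p ≠ 0 := by
  intro h₁
  let C : Set M := {q | f q = 0 ∧ gradientInner g f f q = 0}
  have hC : IsClosed C := (isClosed_eq h.smooth.continuous continuous_const).inter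
    (isClosed_eq (continuous_gradientInner g h.smooth h.smooth) continuous_const)
  have hO : IsOpen C := by
    refine isOpen_iff_mem_nhds.2 fun q hq => ?_
    have hq' := h.eventually_eq_zero hn hq.1 ((differential_eq_zero_iff f q).2 hq.2)
    filter_upwards [eventually_eventually_nhds.2 hq'] with r hr
    refine ⟨hr.self_of_nhds, (differential_eq_zero_iff (n := n) f r).1 ?_⟩
    rw [differential_congr (ψ := fun _ => 0) hr]
    exact differential_const 0 r
  have hu := IsClopen.eq_univ ⟨hC, hO⟩ ⟨p, h₀, (differential_eq_zero_iff f p).1 h₁⟩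
  refine h.ne_zero (funext fun q => ?_)
  have : q ∈ C := hu ▸ mem_univ q
  exact this.1

theorem frequently_ne_zero (h : IsStaticPotential g f) (hn : 2 ≤ n) (p : M) :
    ∃ᶠ q in 𝓝 p, f q ≠ 0 := by
  intro h0
  simp only [not_not] at h0
  refine h.differential_ne_zero hn h0.self_of_nhds ?_
  rw [differential_congr (ψ := fun _ => 0) h0]
  exact differential_const 0 p

/-! ### Chart independence of the scalar curvature -/

variable [T2Space M] [CompactSpace M]

/-- Suppose the value in `e` were larger at `p`, hence on a neighbourhood `W`. For a bump function
`ψ` supported in `W`, test the weak equation with `φ = ψ f` in both charts. The left sides coincide,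
so the integral of `ψ f² (s_e - s_e') / (n - 1)` is zero; but this integrand is non-negative, and
positive somewhere because `f` is not identically zero near `p`. -/
theorem scalar_le_of_charts (h : IsStaticPotential g f) (hn : 2 ≤ n)
    (he : e ∈ IsManifold.maximalAtlas (𝓡 n) ∞ M) (he' : e' ∈ IsManifold.maximalAtlas (𝓡 n) ∞ M)
    {p : M} (hp : p ∈ e.source) (hp' : p ∈ e'.source) :
    scalar (coeff g e) (e p) ≤ scalar (coeff g e') (e' p) := by
  borelize M
  have := isLocallyFiniteMeasure_volumeMeasure g
  have := isOpenPosMeasure_volumeMeasure g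
  by_contra! hlt
  have hn' : (2 : ℝ) ≤ n := by exact_mod_cast hn
  have hn1 : (0 : ℝ) < n - 1 := by linarith
  have cont : ∀ {e : OpenPartialHomeomorph M (EuclideanSpace ℝ (Fin n))},
      e ∈ IsManifold.maximalAtlas (𝓡 n) ∞ M →
      ContinuousOn (fun q => scalar (coeff g e) (e q)) e.source := fun {e} he =>
    (isMetricOn_coeff g he).contDiffOn_scalar.continuousOn.comp e.continuousOn
      fun q hq => e.map_source hq
  let W : Set M := {q | q ∈ e.source ∩ e'.source ∧
    scalar (coeff g e') (e' q) < scalar (coeff g e) (e q)}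
  have hW : W ∈ 𝓝 p := by
    have c1 := (cont he).continuousAt (e.open_source.mem_nhds hp)
    have c2 := (cont he').continuousAt (e'.open_source.mem_nhds hp')
    filter_upwards [e.open_source.mem_nhds hp, e'.open_source.mem_nhds hp',
      c2.eventually_lt c1 hlt] with q h1 h2 h3
    exact ⟨⟨h1, h2⟩, h3⟩
  obtain ⟨ψ, -, hψW⟩ := (SmoothBumpFunction.nhds_basis_tsupport (I := 𝓡 n) p).mem_iff.1 hW
  have hφ : ContMDiff (𝓡 n) 𝓘(ℝ, ℝ) ∞ fun q => ψ q * f q := ψ.contMDiff.mul h.smooth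
  have hφs : tsupport (fun q => ψ q * f q) ⊆ W :=
    (closure_mono (Function.support_mul_subset_left _ _)).trans hψW
  have weak : ∀ {e : OpenPartialHomeomorph M (EuclideanSpace ℝ (Fin n))},
      e ∈ IsManifold.maximalAtlas (𝓡 n) ∞ M → tsupport (fun q => ψ q * f q) ⊆ e.source →
      Continuous (fun q => ψ q * f q * (scalar (coeff g e) (e q) / ((n : ℝ) - 1) * f q)) ∧
      ∫ q, gradientInner g (fun q => ψ q * f q) f q ∂volumeMeasure g =
        ∫ q, ψ q * f q * (scalar (coeff g e) (e q) / ((n : ℝ) - 1) * f q) ∂volumeMeasure g := by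
    intro e he hs
    have hc := ((cont he).div_const ((n : ℝ) - 1)).mul h.smooth.continuous.continuousOn
    refine ⟨(hφ.continuous.continuousOn.mul hc).continuous_of_tsupport_subset e.open_source
      ((closure_mono (Function.support_mul_subset_left _ _)).trans hs),
      integral_gradientInner_of_laplacian g he hφ h.smooth hs hc fun z hz => ?_⟩
    rw [h.laplacian_eq hn he hz]
    simp only [e.right_inv hz]
  obtain ⟨k1, i1⟩ := weak he fun q hq => (hφs hq).1.1
  obtain ⟨k2, i2⟩ := weak he' fun q hq => (hφs hq).1.2
  obtain ⟨q, hqf, hqψ⟩ := ((h.frequently_ne_zero hn p).and_eventually ψ.support_mem_nhds).exists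
  let d : M → ℝ := fun q => ψ q * f q * (scalar (coeff g e) (e q) / ((n : ℝ) - 1) * f q) -
    ψ q * f q * (scalar (coeff g e') (e' q) / ((n : ℝ) - 1) * f q)
  have hd : ∀ q, d q = ψ q * f q ^ 2 *
      ((scalar (coeff g e) (e q) - scalar (coeff g e') (e' q)) / ((n : ℝ) - 1)) := by
    intro q
    simp only [d]
    ring
  have hpos : ∀ q ∈ W, 0 < (scalar (coeff g e) (e q) - scalar (coeff g e') (e' q)) /
      ((n : ℝ) - 1) := fun q hq => div_pos (sub_pos.2 hq.2) hn1
  have hd0 : 0 ≤ d := by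
    intro q
    rw [hd]
    by_cases hq : q ∈ tsupport ψ
    · exact mul_nonneg (mul_nonneg ψ.nonneg (sq_nonneg _)) (hpos q (hψW hq)).le
    · simp [image_eq_zero_of_notMem_tsupport hq]
  have hdq : d q ≠ 0 := by
    rw [hd]
    exact mul_ne_zero (mul_ne_zero hqψ (pow_ne_zero _ hqf))
      (hpos q (hψW (subset_tsupport _ hqψ))).ne'
  have hint := (k1.sub k2).integral_pos_of_hasCompactSupport_nonneg_nonzero
    (μ := volumeMeasure g) (HasCompactSupport.of_compactSpace _) hd0 hdq
  have hz : ∫ q, d q ∂volumeMeasure g = 0 := by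
    simp only [d]
    rw [integral_sub (integrable_volumeMeasure g k1) (integrable_volumeMeasure g k2), ← i1, i2,
      sub_self]
  exact hint.ne' hz

/-- The scalar curvature of a static metric does not depend on the chart. -/
theorem scalar_eq_of_charts (h : IsStaticPotential g f) (hn : 2 ≤ n)
    (he : e ∈ IsManifold.maximalAtlas (𝓡 n) ∞ M) (he' : e' ∈ IsManifold.maximalAtlas (𝓡 n) ∞ M)
    {p : M} (hp : p ∈ e.source) (hp' : p ∈ e'.source) :
    scalar (coeff g e) (e p) = scalar (coeff g e') (e' p) :=
  le_antisymm (h.scalar_le_of_charts hn he he' hp hp') (h.scalar_le_of_charts hn he' he hp' hp)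

end IsStaticPotential

end Riem

namespace Riem

set_option linter.unusedSectionVars false

/-! ### New charts from the inverse function theorem -/

section LocalDiffeomorphism

variable {n : ℕ}

/-- A smooth map with injective differential at a point is a diffeomorphism near that point. -/
theorem exists_openPartialHomeomorph {U : Set (EuclideanSpace ℝ (Fin n))} (hU : IsOpen U)
    {ψ : EuclideanSpace ℝ (Fin n) → EuclideanSpace ℝ (Fin n)} (hψ : ContDiffOn ℝ ∞ ψ U)
    {x : EuclideanSpace ℝ (Fin n)} (hx : x ∈ U) (hi : Function.Injective (fderiv ℝ ψ x)) :
    ∃ S : OpenPartialHomeomorph (EuclideanSpace ℝ (Fin n)) (EuclideanSpace ℝ (Fin n)),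
      x ∈ S.source ∧ S.source ⊆ U ∧ (∀ z, S z = ψ z) ∧ ContDiffOn ℝ ∞ S S.source ∧
      ContDiffOn ℝ ∞ S.symm S.target := by
  have hdet : (fderiv ℝ ψ x).det ≠ 0 := by
    intro h0
    have h1 : IsUnit (fderiv ℝ ψ x).toLinearMap :=
      LinearMap.isUnit_iff_ker_eq_bot _ |>.2 (LinearMap.ker_eq_bot.2 hi)
    exact (LinearMap.isUnit_iff_isUnit_det _ |>.1 h1).ne_zero h0
  have hc : ContDiffAt ℝ ∞ ψ x := hψ.contDiffAt (hU.mem_nhds hx)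
  have hd : ∀ z ∈ U, DifferentiableAt ℝ ψ z := fun z hz =>
    (hψ.contDiffAt (hU.mem_nhds hz)).differentiableAt (by simp)
  -- On `V` the differential stays invertible, so the local inverse is smooth on its whole domain
  -- and not only at the image of `x`.
  let V : Set (EuclideanSpace ℝ (Fin n)) := U ∩ (fun z => (fderiv ℝ ψ z).det) ⁻¹' {0}ᶜ
  have hV : IsOpen V :=
    (ContinuousLinearMap.continuous_det.comp_continuousOn
      (hψ.continuousOn_fderiv_of_isOpen hU (by simp))).isOpen_inter_preimage hU
      isOpen_compl_singleton
  have hf' : HasFDerivAt ψ (((fderiv ℝ ψ x).toContinuousLinearEquivOfDetNeZero hdet :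
      EuclideanSpace ℝ (Fin n) ≃L[ℝ] EuclideanSpace ℝ (Fin n)) :
      EuclideanSpace ℝ (Fin n) →L[ℝ] EuclideanSpace ℝ (Fin n)) x := by
    rw [ContinuousLinearMap.coe_toContinuousLinearEquivOfDetNeZero]
    exact (hd x hx).hasFDerivAt
  let S₀ := hc.toOpenPartialHomeomorph ψ hf' (by simp)
  have hxS : x ∈ S₀.source := hc.mem_toOpenPartialHomeomorph_source hf' (by simp)
  let S := S₀.restrOpen V hV
  have hS : ∀ z, S z = ψ z := fun z => rfl
  have hsub : S.source ⊆ V := inter_subset_right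
  refine ⟨S, ⟨hxS, hx, hdet⟩, hsub.trans inter_subset_left, hS,
    hψ.mono (hsub.trans inter_subset_left), fun z hz => ?_⟩
  have hw : S.symm z ∈ V := hsub (S.map_target hz)
  have hne : (fderiv ℝ ψ (S.symm z)).det ≠ 0 := hw.2
  refine (S.contDiffAt_symm hz
    (f₀' := (fderiv ℝ ψ (S.symm z)).toContinuousLinearEquivOfDetNeZero hne) ?_
    (hψ.contDiffAt (hU.mem_nhds hw.1))).contDiffWithinAt
  rw [ContinuousLinearMap.coe_toContinuousLinearEquivOfDetNeZero]
  exact (hd _ hw.1).hasFDerivAt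

theorem fderiv_apply_eq_pderiv {ψ : EuclideanSpace ℝ (Fin n) → EuclideanSpace ℝ (Fin n)}
    {x : EuclideanSpace ℝ (Fin n)} (hψ : DifferentiableAt ℝ ψ x) (i a : Fin n) :
    fderiv ℝ ψ x (EuclideanSpace.single i 1) a = pderiv i (fun z => ψ z a) x := by
  have h := hasFDerivWithinAt_euclidean.1 (hψ.hasFDerivAt.hasFDerivWithinAt (s := univ)) a
  unfold pderiv
  rw [(hasFDerivWithinAt_univ.1 h).fderiv]
  rfl

theorem pderiv_coord (i a : Fin n) (x : EuclideanSpace ℝ (Fin n)) :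
    pderiv i (fun z => z a) x = if a = i then 1 else 0 := by
  have h := fderiv_apply_eq_pderiv (differentiableAt_id (𝕜 := ℝ) (x := x)) i a
  simp only [id_eq] at h
  rw [← h, fderiv_id]
  simp

end LocalDiffeomorphism

variable {n : ℕ} {M : Type*} [TopologicalSpace M] [ChartedSpace (EuclideanSpace ℝ (Fin n)) M]
  [IsManifold (𝓡 n) ∞ M]
  {e e' : OpenPartialHomeomorph M (EuclideanSpace ℝ (Fin n))} {y : EuclideanSpace ℝ (Fin n)}

theorem trans_mem_maximalAtlas (he : e ∈ IsManifold.maximalAtlas (𝓡 n) ∞ M)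
    {S : OpenPartialHomeomorph (EuclideanSpace ℝ (Fin n)) (EuclideanSpace ℝ (Fin n))}
    (hS : ContDiffOn ℝ ∞ S S.source) (hS' : ContDiffOn ℝ ∞ S.symm S.target) :
    e.trans S ∈ IsManifold.maximalAtlas (𝓡 n) ∞ M := by
  refine OpenPartialHomeomorph.mem_maximalAtlas_of_contMDiffOn _ ?_ ?_
  · refine (contMDiffOn_iff_contDiffOn.2 hS).comp
      ((contMDiffOn_of_mem_maximalAtlas he).mono ?_) ?_
    · intro p hp
      exact ((OpenPartialHomeomorph.trans_source e S) ▸ hp).1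
    · intro p hp
      exact ((OpenPartialHomeomorph.trans_source e S) ▸ hp).2
  · refine (contMDiffOn_symm_of_mem_maximalAtlas he).comp
      ((contMDiffOn_iff_contDiffOn.2 hS').mono ?_) ?_
    · intro p hp
      exact ((OpenPartialHomeomorph.trans_target e S) ▸ hp).1
    · intro p hp
      exact ((OpenPartialHomeomorph.trans_target e S) ▸ hp).2

/-- Composing a chart with a map of injective differential gives a chart, near a point. -/
theorem exists_chart_comp (he : e ∈ IsManifold.maximalAtlas (𝓡 n) ∞ M)
    {ψ : EuclideanSpace ℝ (Fin n) → EuclideanSpace ℝ (Fin n)} (hψ : ContDiffOn ℝ ∞ ψ e.target)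
    {p : M} (hp : p ∈ e.source) (hi : Function.Injective (fderiv ℝ ψ (e p))) :
    ∃ e' ∈ IsManifold.maximalAtlas (𝓡 n) ∞ M, p ∈ e'.source ∧ e'.source ⊆ e.source ∧
      ∀ q ∈ e'.source, e' q = ψ (e q) := by
  obtain ⟨S, hx, -, hSψ, hS, hS'⟩ := exists_openPartialHomeomorph e.open_target hψ
    (e.map_source hp) hi
  refine ⟨e.trans S, trans_mem_maximalAtlas he hS hS', ?_, ?_, fun q _ => hSψ _⟩
  · rw [OpenPartialHomeomorph.trans_source]
    exact ⟨hp, hx⟩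
  · rw [OpenPartialHomeomorph.trans_source]
    exact inter_subset_left

variable (g : ContMDiffRiemannianMetric (𝓡 n) ∞ (EuclideanSpace ℝ (Fin n))
      (fun x : M => TangentSpace (𝓡 n) x))

/-- Reparametrizing a chart by a map `σ` of injective differential gives a chart, near a point. -/
theorem exists_chart_reparam (he : e ∈ IsManifold.maximalAtlas (𝓡 n) ∞ M)
    {σ : EuclideanSpace ℝ (Fin n) → EuclideanSpace ℝ (Fin n)} (hσ : ContDiff ℝ ∞ σ)
    {x : EuclideanSpace ℝ (Fin n)} (hx : σ x ∈ e.target)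
    (hi : Function.Injective (fderiv ℝ σ x)) :
    ∃ e' ∈ IsManifold.maximalAtlas (𝓡 n) ∞ M, x ∈ e'.target ∧
      (∀ z ∈ e'.target, σ z ∈ e.target ∧ e'.symm z = e.symm (σ z)) ∧
      ∀ z ∈ e'.target, ∀ i j, coeff g e' z i j = ∑ a, ∑ b,
        pderiv i (fun w => σ w a) z * pderiv j (fun w => σ w b) z * coeff g e (σ z) a b := by
  obtain ⟨S, hxS, -, hSσ, hS, hS'⟩ := exists_openPartialHomeomorph isOpen_univ hσ.contDiffOn
    (mem_univ x) hi
  have he' : e.trans S.symm ∈ IsManifold.maximalAtlas (𝓡 n) ∞ M :=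
    trans_mem_maximalAtlas he (S := S.symm) hS' (by simpa using hS)
  have ht : ∀ z, z ∈ (e.trans S.symm).target ↔ z ∈ S.source ∧ σ z ∈ e.target := by
    intro z
    rw [OpenPartialHomeomorph.trans_target]
    simp [hSσ]
  have hs : ∀ z, (e.trans S.symm).symm z = e.symm (σ z) := by
    intro z
    simp [hSσ]
  refine ⟨_, he', (ht x).2 ⟨hxS, hx⟩, fun z hz => ⟨((ht z).1 hz).2, hs z⟩, fun z hz i j => ?_⟩
  have hze := ((ht z).1 hz).2
  have hsrc : (e.trans S.symm).symm z ∈ e.source := by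
    rw [hs]
    exact e.map_target hze
  have hd : DifferentiableAt ℝ σ z := hσ.differentiable (by simp) z
  have htr : (e ∘ (e.trans S.symm).symm) =ᶠ[𝓝 z] σ := by
    filter_upwards [hd.continuousAt.preimage_mem_nhds (e.open_target.mem_nhds hze)] with w hw
    simp only [Function.comp_apply]
    rw [hs, e.right_inv hw]
  rw [coeff_transition g he' he hz hsrc, htr.fderiv_eq]
  simp only [fderiv_apply_eq_pderiv hd]
  rw [hs, e.right_inv hze]

/-! ### Construction of normal coordinates -/

theorem injective_of_forall_single {L : EuclideanSpace ℝ (Fin n) →L[ℝ] EuclideanSpace ℝ (Fin n)}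
    {A B : Matrix (Fin n) (Fin n) ℝ} (hL : ∀ i a, L (EuclideanSpace.single i 1) a = A a i)
    (hBA : B * A = 1) : Function.Injective L := by
  have hv : ∀ v, (L v).ofLp = A.mulVec v.ofLp := by
    intro v
    ext a
    conv_lhs => rw [eq_sum_single v]
    simp [Matrix.mulVec, dotProduct, hL, mul_comm]
  intro v w h
  have h1 := congrArg (fun u => B.mulVec u.ofLp) h
  simp only [hv, Matrix.mulVec_mulVec, hBA, Matrix.one_mulVec] at h1
  ext i
  exact congrFun h1 i

/-- Factor the positive definite matrix at `p` as `Bᵀ B`. The affine change of coordinates with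
linear part `B⁻¹` and value `e p` at `0` turns it into the identity. -/
theorem exists_chart_coeff_eq_one (p : M) : ∃ e ∈ IsManifold.maximalAtlas (𝓡 n) ∞ M,
    0 ∈ e.target ∧ e.symm 0 = p ∧ coeff g e 0 = 1 := by
  let e := chartAt (EuclideanSpace ℝ (Fin n)) p
  have he : e ∈ IsManifold.maximalAtlas (𝓡 n) ∞ M := IsManifold.chart_mem_maximalAtlas p
  have hp : p ∈ e.source := mem_chart_source _ p
  have hm := isMetricOn_coeff g he
  have hy := e.map_source hp
  obtain ⟨B, hB⟩ : ∃ B : Matrix (Fin n) (Fin n) ℝ, coeff g e (e p) = B.transpose * B := by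
    open scoped MatrixOrder in
    obtain ⟨B, hB⟩ := CStarAlgebra.nonneg_iff_eq_star_mul_self.mp
      (hm.posDef _ hy).posSemidef.nonneg
    exact ⟨B, by rw [hB, Matrix.star_eq_conjTranspose, Matrix.conjTranspose_eq_transpose_of_trivial]⟩
  have hBu : IsUnit B.det := by
    have := hm.isUnit_det hy
    rw [hB, Matrix.det_mul] at this
    exact isUnit_of_mul_isUnit_right this
  let σ : EuclideanSpace ℝ (Fin n) → EuclideanSpace ℝ (Fin n) := fun x =>
    WithLp.toLp 2 fun a => e p a + ∑ k, B⁻¹ a k * x k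
  have hσ : ContDiff ℝ ∞ σ := by
    refine contDiff_euclidean.2 fun a => contDiff_const.add (ContDiff.sum fun k _ =>
      contDiff_const.mul ?_)
    exact contDiff_euclidean.1 contDiff_id k
  have hdc : ∀ (k : Fin n) z, DifferentiableAt ℝ (fun x : EuclideanSpace ℝ (Fin n) => x k) z :=
    fun k z => differentiableAt_euclidean.1 differentiableAt_id k
  have hpd : ∀ i a z, pderiv i (fun x => σ x a) z = B⁻¹ a i := by
    intro i a z
    change pderiv i (fun x => e p a + ∑ k, B⁻¹ a k * x k) z = _
    rw [pderiv_add i (differentiableAt_const _)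
      (DifferentiableAt.fun_sum fun k _ => (hdc k z).const_mul _), pderiv_const,
      pderiv_sum i fun k _ => (hdc k z).const_mul _]
    simp only [fun k => pderiv_const_mul i (B⁻¹ a k) (hdc k z), pderiv_coord]
    simp
  have hσ0 : σ 0 = e p := by
    ext a
    simp [σ]
  have hi : Function.Injective (fderiv ℝ σ 0) :=
    injective_of_forall_single (A := B⁻¹) (B := B) (fun i a => by
      rw [fderiv_apply_eq_pderiv (hσ.differentiable (by simp) 0), hpd])
      (Matrix.mul_nonsing_inv B hBu)
  obtain ⟨e', he', h0, hsymm, hco⟩ := exists_chart_reparam g he hσ (x := 0) (hσ0 ▸ hy) hi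
  refine ⟨e', he', h0, ?_, ?_⟩
  · rw [(hsymm 0 h0).2, hσ0, e.left_inv hp]
  · have h1 : coeff g e' 0 = (B⁻¹).transpose * coeff g e (e p) * B⁻¹ := by
      ext i j
      rw [hco 0 h0, hσ0, Finset.sum_comm]
      simp only [hpd, Matrix.mul_apply, Matrix.transpose_apply, Finset.sum_mul]
      refine Finset.sum_congr rfl fun a _ => Finset.sum_congr rfl fun b _ => ?_
      ring
    rw [h1, hB, mul_assoc, mul_assoc, Matrix.mul_nonsing_inv B hBu, mul_one,
      ← Matrix.transpose_mul, Matrix.mul_nonsing_inv B hBu, Matrix.transpose_one]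

/-- Normal coordinates exist around every point. -/
theorem exists_chart_isNormalAt (p : M) : ∃ e ∈ IsManifold.maximalAtlas (𝓡 n) ∞ M,
    e.symm 0 = p ∧ IsNormalAt e.target (coeff g e) 0 := by
  obtain ⟨e, he, h0, hep, hone⟩ := exists_chart_coeff_eq_one g p
  have hm := isMetricOn_coeff g he
  let c : Fin n → Fin n → Fin n → ℝ := fun k i j => christoffel (coeff g e) k i j 0
  have hcs : ∀ k i j, c k i j = c k j i := fun k i j => hm.christoffel_symm h0 k i j
  -- The second derivatives of this correction are `-Γ^a_kl`, which cancel the two Christoffel terms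
  -- of `∂g` at `0`. It has no linear part, so `g_ij = δ_ij` survives.
  let q : Fin n → EuclideanSpace ℝ (Fin n) → ℝ := fun a x =>
    ∑ k, ∑ l, -(1 / 2) * c a k l * (x k * x l)
  let σ : EuclideanSpace ℝ (Fin n) → EuclideanSpace ℝ (Fin n) := fun x =>
    WithLp.toLp 2 fun a => x a + q a x
  have sc : ∀ k : Fin n, ContDiff ℝ ∞ fun x : EuclideanSpace ℝ (Fin n) => x k :=
    contDiff_euclidean.1 contDiff_id
  have sq : ∀ a, ContDiff ℝ ∞ (q a) := fun a => ContDiff.sum fun k _ => ContDiff.sum fun l _ =>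
    contDiff_const.mul ((sc k).mul (sc l))
  have hσ : ContDiff ℝ ∞ σ := contDiff_euclidean.2 fun a => (sc a).add (sq a)
  have hdc : ∀ (k : Fin n) z, DifferentiableAt ℝ (fun x : EuclideanSpace ℝ (Fin n) => x k) z :=
    fun k z => (sc k).differentiable (by simp) z
  have hdm : ∀ (k l : Fin n) z,
      DifferentiableAt ℝ (fun x : EuclideanSpace ℝ (Fin n) => x k * x l) z :=
    fun k l z => (hdc k z).fun_mul (hdc l z)
  have hpq : ∀ i a z, pderiv i (q a) z = -∑ k, c a i k * z k := by
    intro i a z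
    simp only [q]
    rw [pderiv_sum i fun k _ => DifferentiableAt.fun_sum fun l _ => (hdm k l z).const_mul _]
    simp only [fun k => pderiv_sum i fun l (_ : l ∈ Finset.univ) =>
        (hdm k l z).const_mul (-(1 / 2) * c a k l),
      fun k l => pderiv_const_mul i (-(1 / 2) * c a k l) (hdm k l z),
      fun k l => pderiv_mul i (hdc k z) (hdc l z), pderiv_coord, mul_add, Finset.sum_add_distrib,
      ite_mul, mul_ite, one_mul, zero_mul, mul_one, mul_zero, Finset.sum_ite_eq',
      Finset.mem_univ, if_true]
    rw [Finset.sum_comm]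
    simp only [Finset.sum_ite_eq', Finset.mem_univ, if_true]
    rw [← Finset.sum_add_distrib, ← Finset.sum_neg_distrib]
    refine Finset.sum_congr rfl fun k _ => ?_
    rw [hcs a k i]
    ring
  have hpd : ∀ i a z, pderiv i (fun x => σ x a) z = (if a = i then 1 else 0)
      - ∑ k, c a i k * z k := by
    intro i a z
    change pderiv i (fun x => x a + q a x) z = _
    rw [pderiv_add i (hdc a z) ((sq a).differentiable (by simp) z), pderiv_coord, hpq]
    ring
  have hpd0 : ∀ i a, pderiv i (fun x => σ x a) 0 = if a = i then 1 else 0 := by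
    intro i a
    rw [hpd]
    simp
  have hpp : ∀ m i a, pderiv m (pderiv i fun x => σ x a) 0 = -c a i m := by
    intro m i a
    have : (pderiv i fun x => σ x a) = fun z => (if a = i then 1 else 0)
      - ∑ k, c a i k * z k := funext (hpd i a)
    rw [this, pderiv_sub m (differentiableAt_const _)
      (DifferentiableAt.fun_sum fun k _ => (hdc k 0).const_mul _), pderiv_const,
      pderiv_sum m fun k _ => (hdc k 0).const_mul _]
    simp only [fun k => pderiv_const_mul m (c a i k) (hdc k 0), pderiv_coord]
    simp
  have hσ0 : σ 0 = 0 := by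
    ext a
    simp [σ, q]
  have hd0 : DifferentiableAt ℝ σ 0 := hσ.differentiable (by simp) 0
  have hfd : fderiv ℝ σ 0 = ContinuousLinearMap.id ℝ _ := by
    ext v a
    conv_lhs => rw [eq_sum_single v]
    simp [fderiv_apply_eq_pderiv hd0, hpd0]
  obtain ⟨e', he', h0', hsymm, hco⟩ := exists_chart_reparam g he hσ (x := 0) (hσ0.symm ▸ h0)
    (by rw [hfd]; exact fun _ _ h => h)
  have hone' : coeff g e' 0 = 1 := by
    ext i j
    rw [hco 0 h0', hσ0, hone]
    simp [hpd0, Matrix.one_apply, eq_comm]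
  refine ⟨e', he', by rw [(hsymm 0 h0').2, hσ0, hep], ⟨isMetricOn_coeff g he', h0', hone', ?_⟩⟩
  intro m i j
  have dG : ∀ a b, DifferentiableAt ℝ (fun z => coeff g e (σ z) a b) 0 := by
    intro a b
    have : DifferentiableAt ℝ (fun z => coeff g e z a b) (σ 0) :=
      differentiableAt_of_contDiffOn e.open_target (hm.smooth a b) (hσ0.symm ▸ h0)
    exact this.comp 0 hd0
  have pG : ∀ a b, pderiv m (fun z => coeff g e (σ z) a b) 0 =
      pderiv m (fun z => coeff g e z a b) 0 := by
    intro a b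
    have : DifferentiableAt ℝ (fun z => coeff g e z a b) (σ 0) :=
      differentiableAt_of_contDiffOn e.open_target (hm.smooth a b) (hσ0.symm ▸ h0)
    have h1 := fderiv_comp (x := 0) (g := fun z => coeff g e z a b) this hd0
    unfold pderiv
    change fderiv ℝ ((fun z => coeff g e z a b) ∘ σ) 0 _ = _
    rw [h1, hfd, hσ0]
    rfl
  have dσ : ∀ i a, DifferentiableAt ℝ (pderiv i fun x => σ x a) 0 := fun i a =>
    differentiableAt_of_contDiffOn isOpen_univ (contDiffOn_pderiv isOpen_univ
      (contDiff_euclidean.1 hσ a).contDiffOn i) (mem_univ _)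
  rw [pderiv_congr_of_isOpen e'.open_target h0' m fun z hz => hco z hz i j,
    pderiv_sum m fun a _ => DifferentiableAt.fun_sum fun b _ =>
      ((dσ i a).fun_mul (dσ j b)).fun_mul (dG a b)]
  simp only [fun a => pderiv_sum m fun b (_ : b ∈ Finset.univ) =>
      ((dσ i a).fun_mul (dσ j b)).fun_mul (dG a b),
    fun a b => pderiv_mul m ((dσ i a).fun_mul (dσ j b)) (dG a b),
    fun a b => pderiv_mul m (dσ i a) (dσ j b), hpp, hpd0, hσ0, hone, pG, hm.pderiv_metric h0]
  simp only [Matrix.one_apply, ite_mul, one_mul, zero_mul, Finset.sum_ite_eq, Finset.mem_univ,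
    if_true, mul_ite, mul_one, mul_zero, Finset.sum_add_distrib, Finset.sum_ite_eq',
    c]
  rw [hm.christoffel_symm h0 j i m, hm.christoffel_symm h0 i j m]
  ring

end Riem

namespace Riem

set_option linter.unusedSectionVars false

variable {n : ℕ} {M : Type*} [TopologicalSpace M] [ChartedSpace (EuclideanSpace ℝ (Fin n)) M]
  [IsManifold (𝓡 n) ∞ M]
  {e : OpenPartialHomeomorph M (EuclideanSpace ℝ (Fin n))} {y : EuclideanSpace ℝ (Fin n)}
  {g : ContMDiffRiemannianMetric (𝓡 n) ∞ (EuclideanSpace ℝ (Fin n))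
      (fun x : M => TangentSpace (𝓡 n) x)} {f : M → ℝ}

/-! ### Constancy of the scalar curvature -/

theorem contMDiff_of_comp_chart_symm {h : M → ℝ}
    (hc : ∀ e ∈ IsManifold.maximalAtlas (𝓡 n) ∞ M, ContDiffOn ℝ ∞ (h ∘ e.symm) e.target) :
    ContMDiff (𝓡 n) 𝓘(ℝ, ℝ) ∞ h := by
  intro p
  let e := chartAt (EuclideanSpace ℝ (Fin n)) p
  have he : e ∈ IsManifold.maximalAtlas (𝓡 n) ∞ M := IsManifold.chart_mem_maximalAtlas p
  have h1 : ContMDiffOn (𝓡 n) 𝓘(ℝ, ℝ) ∞ ((h ∘ e.symm) ∘ e) e.source :=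
    (contMDiffOn_iff_contDiffOn.2 (hc e he)).comp (contMDiffOn_of_mem_maximalAtlas he)
      fun q hq => e.map_source hq
  exact (h1.congr fun q hq => by simp [e.left_inv hq]).contMDiffAt
    (e.open_source.mem_nhds (mem_chart_source _ p))

/-- In a chart that carries `Z` to a convex set, the mean value inequality applies within `Z` alone.
It serves twice: for `Z = M`, and for a hypersurface straightened to a coordinate hyperplane. -/
theorem eventually_eq_of_differential_eq_zero {φ : M → ℝ} (hφ : ContMDiff (𝓡 n) 𝓘(ℝ, ℝ) ∞ φ)
    {Z : Set M} (hd : ∀ q ∈ Z, differential (n := n) φ q = 0)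
    (he : e ∈ IsManifold.maximalAtlas (𝓡 n) ∞ M) {K : Set (EuclideanSpace ℝ (Fin n))}
    (hK : Convex ℝ K) (hZ : ∀ q ∈ e.source, q ∈ Z ↔ e q ∈ K) {p : M} (hpZ : p ∈ Z)
    (hp : p ∈ e.source) : ∀ᶠ q in 𝓝[Z] p, φ q = φ p := by
  obtain ⟨r, hr, hball⟩ := Metric.isOpen_iff.1 e.open_target (e p) (e.map_source hp)
  have key : ∀ z ∈ Metric.ball (e p) r ∩ K, HasFDerivWithinAt (φ ∘ e.symm)
      (0 : EuclideanSpace ℝ (Fin n) →L[ℝ] ℝ) (Metric.ball (e p) r ∩ K) z := by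
    intro z hz
    have hzt := hball hz.1
    have hzZ : e.symm z ∈ Z := (hZ _ (e.map_target hzt)).2 (by rw [e.right_inv hzt]; exact hz.2)
    have h1 := (differentiableAt_of_contDiffOn e.open_target
      (contDiffOn_comp_chart_symm he hφ) hzt).hasFDerivAt
    rw [fderiv_eq_zero_of_pderiv ((differential_eq_zero_iff_pderiv he hzt hφ).1 (hd _ hzZ))] at h1
    exact h1.hasFDerivWithinAt
  filter_upwards [self_mem_nhdsWithin, mem_nhdsWithin_of_mem_nhds
    ((e.continuousAt hp).preimage_mem_nhds (Metric.ball_mem_nhds _ hr)),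
    mem_nhdsWithin_of_mem_nhds (e.open_source.mem_nhds hp)] with q hqZ hqb hqs
  have h2 := ((convex_ball (e p) r).inter hK).norm_image_sub_le_of_norm_hasFDerivWithin_le
    (C := 0) key (fun _ _ => by simp) ⟨Metric.mem_ball_self hr, (hZ p hp).1 hpZ⟩
    ⟨hqb, (hZ q hqs).1 hqZ⟩
  rw [zero_mul, norm_le_zero_iff, sub_eq_zero] at h2
  simpa [e.left_inv hqs, e.left_inv hp] using h2

theorem eq_of_differential_eq_zero [ConnectedSpace M] {φ : M → ℝ}
    (hφ : ContMDiff (𝓡 n) 𝓘(ℝ, ℝ) ∞ φ) (hd : ∀ q, differential (n := n) φ q = 0) (p q : M) :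
    φ p = φ q := by
  refine IsLocallyConstant.apply_eq_of_preconnectedSpace
    ((IsLocallyConstant.iff_eventually_eq φ).2 fun x => ?_) p q
  have h := eventually_eq_of_differential_eq_zero hφ (Z := univ) (fun q _ => hd q)
    (IsManifold.chart_mem_maximalAtlas x) (convex_univ (𝕜 := ℝ)) (fun q _ => by simp)
    (mem_univ x) (mem_chart_source (EuclideanSpace ℝ (Fin n)) x)
  rwa [nhdsWithin_univ] at h

/-- The scalar curvature as a function on `M`, computed at each point in the preferred chart. -/
def scalarCurvature (g : ContMDiffRiemannianMetric (𝓡 n) ∞ (EuclideanSpace ℝ (Fin n))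
      (fun x : M => TangentSpace (𝓡 n) x)) (p : M) : ℝ :=
  scalar (coeff g (chartAt (EuclideanSpace ℝ (Fin n)) p)) (chartAt (EuclideanSpace ℝ (Fin n)) p p)

namespace IsStaticPotential

variable [ConnectedSpace M] [T2Space M] [CompactSpace M]

theorem scalarCurvature_chart (h : IsStaticPotential g f) (hn : 2 ≤ n)
    (he : e ∈ IsManifold.maximalAtlas (𝓡 n) ∞ M) (hy : y ∈ e.target) :
    scalarCurvature g (e.symm y) = scalar (coeff g e) y := by
  have h1 := h.scalar_eq_of_charts hn he (IsManifold.chart_mem_maximalAtlas (e.symm y))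
    (e.map_target hy) (mem_chart_source _ _)
  rw [e.right_inv hy] at h1
  exact h1.symm

theorem contMDiff_scalarCurvature (h : IsStaticPotential g f) (hn : 2 ≤ n) :
    ContMDiff (𝓡 n) 𝓘(ℝ, ℝ) ∞ (scalarCurvature g) :=
  contMDiff_of_comp_chart_symm fun _ he => (isMetricOn_coeff g he).contDiffOn_scalar.congr
    fun _ hy => h.scalarCurvature_chart hn he hy

theorem differential_scalarCurvature (h : IsStaticPotential g f) (hn : 2 ≤ n) (p : M) :
    differential (n := n) (scalarCurvature g) p = 0 := by
  have hS := h.contMDiff_scalarCurvature hn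
  have off : ∀ q, f q ≠ 0 → gradientInner g (scalarCurvature g) (scalarCurvature g) q = 0 := by
    intro q hq
    -- At a point with `f ≠ 0`, the divergence `f ∂_j s = 0` in normal coordinates gives `ds = 0`.
    obtain ⟨e, he, rfl, hN⟩ := exists_chart_isNormalAt g q
    refine (differential_eq_zero_iff _ _).1
      ((differential_eq_zero_iff_pderiv he hN.mem hS).2 fun j => ?_)
    rw [pderiv_congr_of_isOpen (F := scalarCurvature g ∘ e.symm) e.open_target hN.mem j
      (fun z hz => h.scalarCurvature_chart hn he hz)]
    exact (mul_eq_zero.1 (hN.mul_pderiv_scalar_eq_zero (contDiffOn_comp_chart_symm he h.smooth)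
      (fun z hz => h.equation e he z hz) j)).resolve_left hq
  -- The points with `ds = 0` form a closed set containing the dense set `f ≠ 0`.
  have hC : IsClosed {q | gradientInner g (scalarCurvature g) (scalarCurvature g) q = 0} :=
    isClosed_eq (continuous_gradientInner g hS hS) continuous_const
  exact (differential_eq_zero_iff _ _).2
    (hC.mem_of_frequently_of_tendsto ((h.frequently_ne_zero hn p).mono off) tendsto_id)

theorem exists_scalar_eq (h : IsStaticPotential g f) (hn : 2 ≤ n) :
    ∃ s, HasConstantScalarCurvature g s := by
  obtain ⟨p⟩ := (inferInstance : Nonempty M)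
  refine ⟨scalarCurvature g p, fun e he y hy => ?_⟩
  rw [← h.scalarCurvature_chart hn he hy]
  exact eq_of_differential_eq_zero (h.contMDiff_scalarCurvature hn)
    (h.differential_scalarCurvature hn) _ _

theorem isLaplaceEigenfunction (h : IsStaticPotential g f) (hn : 2 ≤ n) {s : ℝ}
    (hs : HasConstantScalarCurvature g s) : IsLaplaceEigenfunction g f (s / ((n : ℝ) - 1)) :=
  ⟨h.smooth, h.ne_zero, fun e he y hy => by rw [h.laplacian_eq hn he hy, hs e he y hy]⟩

end IsStaticPotential

/-! ### Eigenfunctions -/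

namespace IsLaplaceEigenfunction

variable [ConnectedSpace M] [T2Space M] [CompactSpace M] [MeasurableSpace M] [BorelSpace M] {c : ℝ}

/-- The energy identity `∫ |∇f|² = c ∫ f²`: the left side is positive, since `df = 0` everywhere
would make `f` constant, and the integral on the right is non-negative. -/
theorem eigenvalue_pos (h : IsLaplaceEigenfunction g f c) (hfc : ¬ ∃ c : ℝ, ∀ x, f x = c) :
    0 < c := by
  have := isLocallyFiniteMeasure_volumeMeasure g
  have := isOpenPosMeasure_volumeMeasure g
  have hE := integral_gradientInner_of_eigen g h.smooth h.equation h.smooth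
  have hc := continuous_gradientInner g h.smooth h.smooth
  obtain ⟨p, hp⟩ : ∃ p, gradientInner g f f p ≠ 0 := by
    by_contra! h0
    obtain ⟨p⟩ := (inferInstance : Nonempty M)
    exact hfc ⟨f p, fun x => eq_of_differential_eq_zero h.smooth
      (fun q => (differential_eq_zero_iff f q).2 (h0 q)) x p⟩
  have h1 : 0 < ∫ p, gradientInner g f f p ∂volumeMeasure g :=
    hc.integral_pos_of_hasCompactSupport_nonneg_nonzero (HasCompactSupport.of_compactSpace _)
      (gradientInner_self_nonneg g f) hp
  have h2 : 0 ≤ ∫ p, f p * f p ∂volumeMeasure g := integral_nonneg fun p => mul_self_nonneg _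
  rw [hE] at h1
  exact pos_of_mul_pos_left h1 h2

theorem integral_eq_zero (h : IsLaplaceEigenfunction g f c) (hc : c ≠ 0) :
    ∫ p, f p ∂volumeMeasure g = 0 := by
  -- The test function `1` has zero gradient, which leaves `0 = c ∫ f`.
  have h1 := integral_gradientInner_of_eigen g h.smooth h.equation (φ := fun _ => 1)
    contMDiff_const
  simp only [gradientInner_const, integral_zero, one_mul] at h1
  exact (mul_eq_zero.1 h1.symm).resolve_left hc

end IsLaplaceEigenfunction

/-- A continuous function of mean zero is neither everywhere positive nor everywhere negative,
because open sets have positive measure; connectedness then provides a zero. -/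
theorem nonempty_zero_of_integral_eq_zero [ConnectedSpace M] [T2Space M] [CompactSpace M]
    [MeasurableSpace M] [BorelSpace M] (hf : Continuous f)
    (hi : ∫ p, f p ∂volumeMeasure g = 0) : (f ⁻¹' {0}).Nonempty := by
  have := isLocallyFiniteMeasure_volumeMeasure g
  have := isOpenPosMeasure_volumeMeasure g
  obtain ⟨p⟩ := (inferInstance : Nonempty M)
  have noPos : ∀ u : M → ℝ, Continuous u → ∫ p, u p ∂volumeMeasure g = 0 →
      ∃ q, u q ≤ 0 := by
    intro u hu hu0
    by_contra! hpos
    exact (hu.integral_pos_of_hasCompactSupport_nonneg_nonzero (μ := volumeMeasure g)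
      (HasCompactSupport.of_compactSpace _) (fun q => (hpos q).le) (hpos p).ne').ne' hu0
  obtain ⟨a, ha⟩ := noPos f hf hi
  obtain ⟨b, hb⟩ := noPos (fun q => -f q) hf.neg (by rw [integral_neg, hi, neg_zero])
  obtain ⟨q, hq⟩ := mem_range_of_exists_le_of_exists_ge hf ⟨a, ha⟩ ⟨b, by simpa using hb⟩
  exact ⟨q, hq⟩

end Riem

namespace Riem

set_option linter.unusedSectionVars false

/-! ### Functions along geodesics -/

section Curves

variable {n : ℕ} {U : Set (EuclideanSpace ℝ (Fin n))}
  {G : EuclideanSpace ℝ (Fin n) → Matrix (Fin n) (Fin n) ℝ} {F : EuclideanSpace ℝ (Fin n) → ℝ}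
  {x : ℝ → EuclideanSpace ℝ (Fin n)} {t : ℝ}

theorem hasDerivAt_comp_curve (hF : DifferentiableAt ℝ F (x t)) (hx : DifferentiableAt ℝ x t) :
    HasDerivAt (fun τ => F (x τ)) (∑ i, deriv (fun τ => x τ i) t * pderiv i F (x t)) t := by
  have h := hF.hasFDerivAt.comp_hasDerivAt t hx.hasDerivAt
  rw [fderiv_apply_eq_sum_pderiv] at h
  refine h.congr_deriv (Finset.sum_congr rfl fun i _ => ?_)
  have h1 := (EuclideanSpace.proj (𝕜 := ℝ) i).hasFDerivAt.comp_hasDerivAt t hx.hasDerivAt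
  exact congrArg (· * _) h1.deriv.symm

theorem contDiffAt_deriv_coord (hx : ContDiffAt ℝ ∞ x t) (i : Fin n) :
    ContDiffAt ℝ 1 (deriv fun τ => x τ i) t :=
  ((contDiffAt_euclidean.1 hx i).fderiv_right (m := 1)
    (WithTop.coe_le_coe.2 (le_top : (1 + 1 : ℕ∞) ≤ ⊤))).clm_apply
    contDiffAt_const

/-- `(F ∘ x)'' = ∇∇F (ẋ, ẋ)` along a geodesic `x`. -/
theorem hasDerivAt_deriv_comp_geodesic (hU : IsOpen U) (hF : ContDiffOn ℝ ∞ F U)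
    (hx : ContDiffAt ℝ ∞ x t) (ht : x t ∈ U)
    (hgeo : ∀ k, deriv (deriv fun τ => x τ k) t + ∑ i, ∑ j, christoffel G k i j (x t)
      * deriv (fun τ => x τ i) t * deriv (fun τ => x τ j) t = 0) :
    HasDerivAt (deriv fun τ => F (x τ))
      (∑ i, ∑ j, hess G F i j (x t) * deriv (fun τ => x τ i) t * deriv (fun τ => x τ j) t) t := by
  have hev : ∀ᶠ τ in 𝓝 t, ContDiffAt ℝ 1 x τ ∧ x τ ∈ U :=
    ((hx.of_le (by simp)).eventually (by simp)).and
      (hx.continuousAt.eventually (hU.mem_nhds ht))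
  have h1 : (deriv fun τ => F (x τ)) =ᶠ[𝓝 t]
      fun τ => ∑ i, deriv (fun τ => x τ i) τ * pderiv i F (x τ) := by
    filter_upwards [hev] with τ hτ
    exact (hasDerivAt_comp_curve (differentiableAt_of_contDiffOn hU hF hτ.2)
      (hτ.1.differentiableAt (by simp))).deriv
  have hxd : ∀ i, HasDerivAt (deriv fun τ => x τ i) (deriv (deriv fun τ => x τ i) t) t :=
    fun i => ((contDiffAt_deriv_coord hx i).differentiableAt (by simp)).hasDerivAt
  have hpd := fun i => hasDerivAt_comp_curve
    (differentiableAt_of_contDiffOn hU (contDiffOn_pderiv hU hF i) ht)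
    (hx.differentiableAt (by simp))
  refine ((HasDerivAt.fun_sum fun i (_ : i ∈ Finset.univ) =>
    (hxd i).fun_mul (hpd i)).congr_of_eventuallyEq h1).congr_deriv ?_
  -- The geodesic equation replaces the acceleration; contracted with `∂_k F`, it is the Christoffel
  -- part of the Hessian.
  have h4 : ∀ k, deriv (deriv fun τ => x τ k) t = -∑ i, ∑ j, christoffel G k i j (x t)
      * deriv (fun τ => x τ i) t * deriv (fun τ => x τ j) t := fun k =>
    eq_neg_of_add_eq_zero_left (hgeo k)
  simp only [h4, hess, sub_mul, Finset.sum_sub_distrib, Finset.sum_add_distrib, neg_mul,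
    Finset.sum_neg_distrib, Finset.sum_mul, Finset.mul_sum]
  rw [add_comm, ← sub_eq_add_neg]
  congr 1
  · rw [Finset.sum_comm]
    refine Finset.sum_congr rfl fun i _ => Finset.sum_congr rfl fun j _ => ?_
    ring
  · rw [Finset.sum_comm]
    refine Finset.sum_congr rfl fun i _ => ?_
    rw [Finset.sum_comm]
    refine Finset.sum_congr rfl fun j _ => Finset.sum_congr rfl fun k _ => ?_
    ring

end Curves

variable {n : ℕ} {M : Type*} [TopologicalSpace M] [ChartedSpace (EuclideanSpace ℝ (Fin n)) M]
  [IsManifold (𝓡 n) ∞ M]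
  {e : OpenPartialHomeomorph M (EuclideanSpace ℝ (Fin n))} {y : EuclideanSpace ℝ (Fin n)}
  {g : ContMDiffRiemannianMetric (𝓡 n) ∞ (EuclideanSpace ℝ (Fin n))
      (fun x : M => TangentSpace (𝓡 n) x)} {f : M → ℝ}

theorem tangentMap_velocity {γ : ℝ → M} {t : ℝ} (hf : MDifferentiableAt (𝓡 n) 𝓘(ℝ, ℝ) f (γ t))
    (hγ : MDifferentiableAt 𝓘(ℝ, ℝ) (𝓡 n) γ t) :
    tangentMap (𝓡 n) 𝓘(ℝ, ℝ) f (velocity n γ t) = ⟨f (γ t), deriv (fun τ => f (γ τ)) t⟩ := by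
  unfold velocity
  rw [← tangentMap_comp_at ⟨t, (1 : ℝ)⟩ hf hγ]
  simp only [tangentMap, mfderiv_eq_fderiv]
  rfl

/-- The velocity is shared with a curve `c` in `Z`, along which `f` vanishes. Applying the tangent
map of `f` to this equality in the tangent bundle compares base points and derivatives at once. -/
theorem eq_zero_of_mem_tangentVectors {γ : ℝ → M} {t : ℝ} (hf : ContMDiff (𝓡 n) 𝓘(ℝ, ℝ) ∞ f)
    (hγ : MDifferentiableAt 𝓘(ℝ, ℝ) (𝓡 n) γ t)
    (hv : velocity n γ t ∈ tangentVectors n (f ⁻¹' {0})) :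
    f (γ t) = 0 ∧ deriv (fun τ => f (γ τ)) t = 0 := by
  obtain ⟨c, hc, hcZ, hcv⟩ := hv
  have hfd : ∀ p, MDifferentiableAt (𝓡 n) 𝓘(ℝ, ℝ) f p := fun p => hf.mdifferentiableAt (by simp)
  have h1 := tangentMap_velocity (hfd _) (hc.mdifferentiableAt (by simp))
  rw [hcv, tangentMap_velocity (hfd _) hγ] at h1
  have h0 : (fun τ => f (c τ)) =ᶠ[𝓝 0] fun _ => 0 := hcZ
  refine ⟨(congrArg TotalSpace.proj h1).trans h0.self_of_nhds, ?_⟩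
  have h2 := congrArg (fun v : TangentBundle 𝓘(ℝ, ℝ) ℝ => (show ℝ from v.2)) h1
  refine Eq.trans (b := deriv (fun τ => f (c τ)) 0) h2 ?_
  rw [h0.deriv_eq]
  simp

/-! ### The zero set of a static potential -/

/-- Near a zero where `df ≠ 0`, the function `f` is a coordinate. -/
theorem exists_chart_coord_eq (hf : ContMDiff (𝓡 n) 𝓘(ℝ, ℝ) ∞ f) {p : M}
    (hp : differential (n := n) f p ≠ 0) : ∃ e ∈ IsManifold.maximalAtlas (𝓡 n) ∞ M,
      p ∈ e.source ∧ ∃ i : Fin n, ∀ q ∈ e.source, e q i = f q := by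
  let e := chartAt (EuclideanSpace ℝ (Fin n)) p
  have he : e ∈ IsManifold.maximalAtlas (𝓡 n) ∞ M := IsManifold.chart_mem_maximalAtlas p
  have hps : p ∈ e.source := mem_chart_source _ p
  have hF := contDiffOn_comp_chart_symm he hf
  obtain ⟨i, hi⟩ : ∃ i, pderiv i (f ∘ e.symm) (e p) ≠ 0 := by
    by_contra! h0
    rw [← differential_eq_zero_iff_pderiv he (e.map_source hps) hf, e.left_inv hps] at h0
    exact hp h0
  -- Replace a coordinate with `∂_i f ≠ 0` by `f` itself. The Jacobian matrix is the identity except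
  -- for row `i`, whose diagonal entry is `∂_i f`.
  let ψ : EuclideanSpace ℝ (Fin n) → EuclideanSpace ℝ (Fin n) := fun x =>
    WithLp.toLp 2 fun a => if a = i then f (e.symm x) else x a
  have hψ : ContDiffOn ℝ ∞ ψ e.target := by
    refine contDiffOn_euclidean.2 fun a => ?_
    by_cases ha : a = i
    · simp only [ψ, ha, if_true]
      exact hF
    · simpa [ψ, ha] using (contDiff_euclidean.1 contDiff_id a).contDiffOn
  have hψd : DifferentiableAt ℝ ψ (e p) :=
    (hψ.contDiffAt (e.open_target.mem_nhds (e.map_source hps))).differentiableAt (by simp)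
  have hinj : Function.Injective (fderiv ℝ ψ (e p)) := by
    refine (injective_iff_map_eq_zero _).2 fun v hv => ?_
    have hcomp : ∀ a, ∑ k, v k * pderiv k (fun z => ψ z a) (e p) = 0 := by
      intro a
      have h1 := congrArg (fun w => w a) hv
      rw [eq_sum_single v] at h1
      simpa [fderiv_apply_eq_pderiv hψd] using h1
    have hne : ∀ a, a ≠ i → v a = 0 := by
      intro a ha
      have h2 := hcomp a
      have h3 : (fun z => ψ z a) = fun z => z a := by
        funext z
        simp [ψ, ha]
      simpa [h3, pderiv_coord] using h2
    have hvi : v i = 0 := by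
      have h2 := hcomp i
      have h3 : (fun z => ψ z i) = f ∘ e.symm := by
        funext z
        simp [ψ]
      rw [h3, Finset.sum_eq_single i (fun k _ hk => by rw [hne k hk, zero_mul]) (by simp)] at h2
      exact (mul_eq_zero.1 h2).resolve_right hi
    ext a
    by_cases ha : a = i
    · simpa [ha] using hvi
    · simpa using hne a ha
  obtain ⟨e', he', hp', hsub, heq⟩ := exists_chart_comp he hψ hps hinj
  refine ⟨e', he', hp', i, fun q hq => ?_⟩
  rw [heq q hq]
  simp [ψ, e.left_inv (hsub hq)]

namespace IsStaticPotential

/-- Along a geodesic, `(f ∘ γ)'' = ∇∇f(γ', γ') = a (f ∘ γ)` with `a` continuous at `t₀`, while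
tangency to `Z` gives zero initial data. -/
theorem isTotallyGeodesic (h : IsStaticPotential g f) (hn : 2 ≤ n) :
    IsTotallyGeodesic g (f ⁻¹' {0}) := by
  intro γ J hγ t₀ ht₀ hv
  have hJ := hγ.isOpen
  have hsm : ∀ t ∈ J, ContMDiffAt 𝓘(ℝ, ℝ) (𝓡 n) ∞ γ t := fun t ht =>
    hγ.smooth.contMDiffAt (hJ.mem_nhds ht)
  obtain ⟨h₀, h₁⟩ := eq_zero_of_mem_tangentVectors h.smooth
    ((hsm t₀ ht₀).mdifferentiableAt (by simp)) hv
  let e := chartAt (EuclideanSpace ℝ (Fin n)) (γ t₀)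
  have he : e ∈ IsManifold.maximalAtlas (𝓡 n) ∞ M := IsManifold.chart_mem_maximalAtlas _
  have hF := contDiffOn_comp_chart_symm he h.smooth
  let x : ℝ → EuclideanSpace ℝ (Fin n) := fun t => e (γ t)
  have hdom : ∀ᶠ t in 𝓝 t₀, t ∈ J ∧ γ t ∈ e.source :=
    (hJ.eventually_mem ht₀).and ((hsm t₀ ht₀).continuousAt.eventually
      (e.open_source.mem_nhds (mem_chart_source _ _)))
  have hx : ∀ t, t ∈ J ∧ γ t ∈ e.source → ContDiffAt ℝ ∞ x t := fun t ht =>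
    contMDiffAt_iff_contDiffAt.1 (((contMDiffOn_of_mem_maximalAtlas he).contMDiffAt
      (e.open_source.mem_nhds ht.2)).comp t (hsm t ht.1))
  have hfx : (fun t => f (γ t)) =ᶠ[𝓝 t₀] fun t => (f ∘ e.symm) (x t) := by
    filter_upwards [hdom] with t ht
    simp [x, e.left_inv ht.2]
  let A : Fin n → Fin n → EuclideanSpace ℝ (Fin n) → ℝ := fun i j z =>
    ricci (coeff g e) i j z - scalar (coeff g e) z / ((n : ℝ) - 1) * coeff g e z i j
  let a : ℝ → ℝ := fun t => ∑ i, ∑ j,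
    A i j (x t) * deriv (fun τ => x τ i) t * deriv (fun τ => x τ j) t
  have hx₀ := hx t₀ hdom.self_of_nhds
  have hxt₀ : x t₀ ∈ e.target := e.map_source (mem_chart_source _ _)
  have ha : ContinuousAt a t₀ := by
    have hxd : ∀ i, ContinuousAt (deriv fun τ => x τ i) t₀ := fun i =>
      (contDiffAt_deriv_coord hx₀ i).continuousAt
    refine tendsto_finsetSum _ fun i _ => tendsto_finsetSum _ fun j _ => ?_
    exact ((((continuousOn_hess_factor g he i j).continuousAt
      (e.open_target.mem_nhds hxt₀)).comp hx₀.continuousAt).mul (hxd i)).mul (hxd j)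
  have key := eventually_eq_zero_of_deriv_deriv_eq_mul (h := fun t => (f ∘ e.symm) (x t)) ha ?_
    (hfx.self_of_nhds.symm.trans h₀) (by rw [← hfx.deriv_eq]; exact h₁)
  · filter_upwards [key, hfx] with t ht hft
    exact hft.trans ht
  · filter_upwards [hdom] with t ht
    have hxt : x t ∈ e.target := e.map_source ht.2
    refine ⟨(hasDerivAt_comp_curve (differentiableAt_of_contDiffOn e.open_target hF hxt)
      ((hx t ht).differentiableAt (by simp))).differentiableAt,
      (hasDerivAt_deriv_comp_geodesic (G := coeff g e) e.open_target hF (hx t ht) hxt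
        (hγ.equation e he t ht.1 ht.2)).congr_deriv ?_⟩
    simp only [a, A, h.hess_eq hn he hxt, Finset.sum_mul]
    refine Finset.sum_congr rfl fun i _ => Finset.sum_congr rfl fun j _ => ?_
    ring

/-- `d|∇f|²` is linear in the Hessian of `f`, which is a multiple of `f` and so vanishes on `Z`. The
whole differential is zero there, not only its restriction to `Z`. -/
theorem differential_gradientInner (h : IsStaticPotential g f) (hn : 2 ≤ n) {p : M}
    (hp : f p = 0) : differential (n := n) (gradientInner g f f) p = 0 := by
  let e := chartAt (EuclideanSpace ℝ (Fin n)) p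
  have he : e ∈ IsManifold.maximalAtlas (𝓡 n) ∞ M := IsManifold.chart_mem_maximalAtlas p
  have hps : p ∈ e.source := mem_chart_source _ p
  have hy := e.map_source hps
  have hu : ContMDiff (𝓡 n) 𝓘(ℝ, ℝ) ∞ (gradientInner g f f) := contMDiff_of_comp_chart_symm
    fun e he => contDiffOn_gradientInner_chart g he h.smooth h.smooth
  rw [← e.left_inv hps, differential_eq_zero_iff_pderiv he hy hu]
  intro a
  rw [pderiv_congr_of_isOpen (F := gradientInner g f f ∘ e.symm) e.open_target hy a
    (fun z hz => gradientInner_chart g he hz h.smooth h.smooth),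
    (isMetricOn_coeff g he).pderiv_gradient_norm_sq (contDiffOn_comp_chart_symm he h.smooth) hy]
  simp [h.hess_eq hn he hy, e.left_inv hps, hp]

variable [ConnectedSpace M]

theorem gradient_ne_zero (h : IsStaticPotential g f) (hn : 2 ≤ n) {p : M} (hp : f p = 0) :
    gradient g f p ≠ 0 := by
  intro h0
  refine h.differential_ne_zero hn hp ?_
  ext v
  rw [← metricForm_gradientVector g]
  have h1 : gradientVector g f p = 0 := h0
  simp [h1]

theorem isSmoothHypersurface (h : IsStaticPotential g f) (hn : 2 ≤ n) :
    IsSmoothHypersurface n (f ⁻¹' {0}) := by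
  intro p hp
  obtain ⟨e, he, hpe, i, hi⟩ := exists_chart_coord_eq h.smooth (h.differential_ne_zero hn hp)
  exact ⟨e, he, hpe, i, fun q hq => by rw [hi q hq]; rfl⟩

/-- In charts that straighten `Z`, the vanishing of `d|∇f|²` on `Z` makes `|∇f|²` locally constant
on the subspace `Z`, hence constant on its connected subsets. -/
theorem gradientInner_eq_of_mem_connectedComponentIn (h : IsStaticPotential g f) (hn : 2 ≤ n)
    {p q : M} (hp : f p = 0) (hq : q ∈ connectedComponentIn (f ⁻¹' {0}) p) :
    gradientInner g f f q = gradientInner g f f p := by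
  have hu : ContMDiff (𝓡 n) 𝓘(ℝ, ℝ) ∞ (gradientInner g f f) := contMDiff_of_comp_chart_symm
    fun e he => contDiffOn_gradientInner_chart g he h.smooth h.smooth
  let Z : Set M := f ⁻¹' {0}
  have hloc : IsLocallyConstant (Z.domRestrict (gradientInner g f f)) := by
    refine (IsLocallyConstant.iff_eventually_eq _).2 fun r => ?_
    obtain ⟨e, he, hre, i, hi⟩ := h.isSmoothHypersurface hn r r.2
    have hK : Convex ℝ {z : EuclideanSpace ℝ (Fin n) | z i = 0} :=
      convex_hyperplane (f := fun z : EuclideanSpace ℝ (Fin n) => z i)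
        ⟨fun _ _ => rfl, fun _ _ => rfl⟩ 0
    have := eventually_eq_of_differential_eq_zero hu (Z := Z)
      (fun s hs => h.differential_gradientInner hn hs) he hK hi r.2 hre
    rwa [nhdsWithin_eq_map_subtype_coe r.2, eventually_map] at this
  have hpC := mem_connectedComponentIn (F := Z) hp
  have hsub : connectedComponentIn Z p ⊆ Z := connectedComponentIn_subset Z p
  have hpre : IsPreconnected (Subtype.val ⁻¹' connectedComponentIn Z p : Set Z) := by
    refine Topology.IsInducing.subtypeVal.isPreconnected_image.1 ?_
    rw [Subtype.image_preimage_coe, inter_eq_self_of_subset_right hsub]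
    exact isPreconnected_connectedComponentIn
  exact hloc.apply_eq_of_isPreconnected hpre (x := ⟨q, hsub hq⟩) (y := ⟨p, hp⟩) hq hpC

end IsStaticPotential

end Riem

end

theorem mainTheorem6 {n : ℕ} (hn : 2 ≤ n)
    {M : Type*} [TopologicalSpace M] [T2Space M] [CompactSpace M] [ConnectedSpace M]
    [ChartedSpace (EuclideanSpace ℝ (Fin n)) M] [IsManifold (𝓡 n) ∞ M]
    [MeasurableSpace M] [BorelSpace M]
    (g : ContMDiffRiemannianMetric (𝓡 n) ∞ (EuclideanSpace ℝ (Fin n))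
      (fun x : M => TangentSpace (𝓡 n) x))
    (f : M → ℝ) (hf : Riem.IsStaticPotential g f) (hfc : ¬ ∃ c : ℝ, ∀ x, f x = c) :
    (∃ s : ℝ, 0 < s ∧ Riem.HasConstantScalarCurvature g s ∧
      Riem.IsLaplaceEigenfunction g f (s / ((n : ℝ) - 1))) ∧
    (Integrable f (Riem.volumeMeasure g) ∧ ∫ x, f x ∂(Riem.volumeMeasure g) = 0) ∧
    (f ⁻¹' {0}).Nonempty ∧
    (∀ p ∈ f ⁻¹' {0}, Riem.gradient g f p ≠ 0) ∧
    Riem.IsSmoothHypersurface n (f ⁻¹' {0}) ∧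
    Riem.IsTotallyGeodesic g (f ⁻¹' {0}) ∧
    (∀ p ∈ f ⁻¹' {0}, ∀ q ∈ connectedComponentIn (f ⁻¹' {0}) p,
      Riem.gradientNorm g f q = Riem.gradientNorm g f p) := by
  obtain ⟨s, hs⟩ := hf.exists_scalar_eq hn
  have hL := hf.isLaplaceEigenfunction hn hs
  have hn1 : (0 : ℝ) < (n : ℝ) - 1 := by
    have : (2 : ℝ) ≤ n := by exact_mod_cast hn
    linarith
  have hc := hL.eigenvalue_pos hfc
  have hint := hL.integral_eq_zero hc.ne'
  refine ⟨⟨s, (div_pos_iff_of_pos_right hn1).1 hc, hs, hL⟩,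
    ⟨Riem.integrable_volumeMeasure g hf.smooth.continuous, hint⟩,
    Riem.nonempty_zero_of_integral_eq_zero hf.smooth.continuous hint,
    fun p hp => hf.gradient_ne_zero hn hp, hf.isSmoothHypersurface hn, hf.isTotallyGeodesic hn,
    fun p hp q hq => ?_⟩
  rw [Riem.gradientNorm_eq, Riem.gradientNorm_eq,
    hf.gradientInner_eq_of_mem_connectedComponentIn hn hp hq]
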